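/- **Setting.** A surface is a connected closed oriented $2$-manifold. A (generalized) pseudo-Anosov homeomorphism $f:S\to S$ is an orientation-preserving homeomorphism of a surface with two $f$-invariant transverse measured foliations $(\mathcal F^s,\mu^s)$, $(\mathcal F^u,\mu^u)$, with finitely many common prong singularities ($1$-prongs allowed), and some $\lambda>1$ such that $f$ multiplies the $\mu^s$-measure of unstable arcs by $\lambda$ and the $\mu^u$-measure of stable arcs by $\lambda^{-1}$. $\mathrm{Sing}(f)$ is the set of prong singularities; if there are none, $\mathrm{Sing}(f)$ is a chosen nonempty finite $f$-invariant set (a finite family of periodic orbits), which is part of the data. The leaf of a point of $\mathrm{Sing}(f)$ contains all its separatrices (the components of the leaf minus that point). Intervals are compact, embedded in a leaf, and not reduced to a point. **First intersection points.** $z\notin \mathrm{Sing}(f)$ is a first intersection point of $f$ if there are $p,q\in\mathrm{Sing}(f)$ such that $z$ lies on a stable separatrix of $p$ and on an unstable separatrix of $q$ and $(p,z]^s\cap(q,z]^u=\{z\}$. **Graphs.** An $s$-graph adapted to $f$ is a finite family $\delta^s$ of stable intervals with union $\cup\delta^s$ such that: $f(\cup\delta^s)\subset\cup\delta^s$; each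 interval lies in the stable leaf of a point of $\mathrm{Sing}(f)$; for each stable separatrix of each $p\in\mathrm{Sing}(f)$ some interval of $\delta^s$ has $p$ as an endpoint and is otherwise contained in this separatrix; all endpoints of the intervals lie in unstable leaves of points of $\mathrm{Sing}(f)$. Adapted $u$-graphs are defined symmetrically, with $f^{-1}$. The regular part of a graph is its union minus all endpoints of its intervals. A regular $u$-rail of $\delta^s$ is an unstable interval with interior disjoint from $\cup\delta^s$ and endpoints in the regular part of $\delta^s$. An extreme $u$-rail of $\delta^s$ is an unstable interval $J$ with at least one endpoint not in the regular part, for which there is an embedded rectangle (an embedded unit square with horizontal lines in stable leaves and vertical lines in unstable leaves) with both stable sides in $\cup\delta^s$, with $J$ as one of its unstable sides, and all of whose other vertical lines are regular $u$-rails of $\delta^s$. Regular and extreme $s$-rails of a $u$-graph are defined symmetrically. Adapted graphs $\delta^s,\delta^u$ are compatible if the endpoints of each and its extreme rails are contained in the union of the other. **The number $n(z)$.** For a first intersection point $z$ as above let $J^u(z)=[q,z]^u$ and $\mathcal J^u(z)=\bigcup_{i\ge0}f^{-i}(J^u(z))$. Let $\delta^s(z)$ be the family of all stable intervals with one endpoint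 in $\mathrm{Sing}(f)$, the other in $\mathcal J^u(z)$, and interior disjoint from $\mathcal J^u(z)$; let $\delta^u(z)$ be the family of all unstable intervals with one endpoint in $\mathrm{Sing}(f)$, the other in $\cup\delta^s(z)$, and interior disjoint from $\cup\delta^s(z)$. The compatibility coefficient $n(z)$ is the least $N\in\mathbb N$ such that $\delta^s(z)$ and $f^n(\delta^u(z))$ are compatible for all $n\ge N$. **Corollary.** (1) For every pseudo-Anosov homeomorphism $f$, the number $n(z)$ exists for every first intersection point $z$ of $f$, and the compatibility order $$n(f)=\max\{n(z): z\text{ a first intersection point of } f\}$$ exists (the set is nonempty and bounded). (2) Let $f:S_f\to S_f$ and $g:S_g\to S_g$ be pseudo-Anosov homeomorphisms and $h:S_f\to S_g$ a homeomorphism with $h\circ f=g\circ h$. If the foliations of $f$ have no prong singularities, assume also that $h(\mathrm{Sing}(f))=\mathrm{Sing}(g)$ for the chosen families of periodic points. Then $n(f)=n(g)$. -/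

import Mathlib

open scoped Topology

/-- The two kinds of leaves carried by a pair of transverse foliations. -/
inductive LeafKind where
  | stable
  | unstable

/-- The transverse kind. -/
def LeafKind.other : LeafKind → LeafKind
  | .stable => .unstable
  | .unstable => .stable

/-- `A` is an arc (an embedded compact interval, not reduced to a point) with endpoints
`a` and `b`. -/
def IsArc {S : Type*} [TopologicalSpace S] (A : Set S) (a b : S) : Prop :=
  ∃ γ : unitInterval → S, Continuous γ ∧ Function.Injective γ ∧ Set.range γ = A ∧
    γ 0 = a ∧ γ 1 = b

/-- The set of endpoints of an arc. -/
def arcEnds {S : Type*} [TopologicalSpace S] (A : Set S) : Set S :=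
  {a | ∃ b, IsArc A a b}

/-- A pair of transverse measured foliations `(𝓕ˢ, μˢ)`, `(𝓕ᵘ, μᵘ)` with finitely many prong
singularities (spines, i.e. `1`-prongs, allowed) on an oriented compact surface, given by an atlas
of natural charts.

Around every point `p` there is a chart `z = chart p`, centred at `p`, in which the pair is the
standard `k`-prong model, `k = prong p` (`k = 2` means that `p` is a regular point): with
`w = z ^ (k / 2)`, defined up to sign away from `p`,
* the stable leaves are the curves `Im w = const` and `μˢ = |d Im w|`,
* the unstable leaves are the curves `Re w = const` and `μᵘ = |d Re w|`.

The field `compat` says that these local data match: near every `q ≠ p` in the domain of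
`chart p`, the point `q` is regular and `chart q` is a branch of `w`, up to a translation
(`chart q + c` is a square root of `z ^ k`). Hence the changes of coordinates between natural
coordinates `w` are `w ↦ ± w + c`, which are the coordinate changes that preserve both foliations,
both transverse measures and the orientation. The charts also make the space a topological surface
and orient it. -/
structure TransverseMeasuredFoliations (S : Type*) [TopologicalSpace S] where
  prong : S → ℕ
  prong_pos : ∀ p, 1 ≤ prong p
  chart : S → OpenPartialHomeomorph S ℂ
  mem_source : ∀ p, p ∈ (chart p).source
  chart_self : ∀ p, chart p p = 0
  compat : ∀ p, ∀ q ∈ (chart p).source, q ≠ p →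
    prong q = 2 ∧ ∃ c : ℂ, ∀ᶠ x in 𝓝 q, (chart q x + c) ^ 2 = (chart p x) ^ prong p

namespace TransverseMeasuredFoliations

variable {S : Type*} [TopologicalSpace S] (F : TransverseMeasuredFoliations S)

/-- The local leaf of the given kind through `p`: the union of the `prong p` horizontal
(resp. vertical) prongs at `p`. In the model, `w` is real iff `w ^ 2 = z ^ k` is a real number
`≥ 0`, and `w` is purely imaginary iff `z ^ k` is a real number `≤ 0`. -/
def localLeaf (k : LeafKind) (p : S) : Set S :=
  {x | x ∈ (F.chart p).source ∧ ((F.chart p x) ^ F.prong p).im = 0 ∧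
    match k with
    | .stable => 0 ≤ ((F.chart p x) ^ F.prong p).re
    | .unstable => ((F.chart p x) ^ F.prong p).re ≤ 0}

/-- `A` is a stable (resp. unstable) compact interval with endpoints `a` and `b`: an arc that,
near each of its points `p`, lies in the local leaf through `p`. -/
def IsLeafArc (k : LeafKind) (A : Set S) (a b : S) : Prop :=
  IsArc A a b ∧ ∀ p ∈ A, ∀ᶠ x in 𝓝[A] p, x ∈ F.localLeaf k p

/-- The stable (resp. unstable) leaf through `x`; the leaf through a prong singularity consists of
the singularity and all its separatrices. -/
def leaf (k : LeafKind) (x : S) : Set S :=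
  {y | y = x ∨ ∃ A, F.IsLeafArc k A x y}

/-- `σ` is a stable (resp. unstable) separatrix of `p`: a connected component, inside the leaf,
of the leaf through `p` minus `p`. -/
def IsSeparatrix (k : LeafKind) (p : S) (σ : Set S) : Prop :=
  ∃ x ∈ F.leaf k p, x ≠ p ∧ σ = {y | (y = x ∨ ∃ A, F.IsLeafArc k A x y ∧ p ∉ A)}

/-- `ρ` parametrizes an embedded rectangle: it is an embedding of the unit square, the arcs
`ρ ({s} × [0,1])` are intervals in leaves of kind `k` and the arcs `ρ ([0,1] × {t})` are intervals
in leaves of the transverse kind. -/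
def IsEmbeddedRectangle (k : LeafKind) (ρ : unitInterval × unitInterval → S) : Prop :=
  Continuous ρ ∧ Function.Injective ρ ∧
  (∀ s, F.IsLeafArc k (Set.range fun t => ρ (s, t)) (ρ (s, 0)) (ρ (s, 1))) ∧
  (∀ t, F.IsLeafArc k.other (Set.range fun s => ρ (s, t)) (ρ (0, t)) (ρ (1, t)))

end TransverseMeasuredFoliations

/-- The regular part of a graph (a family of arcs): its union minus all endpoints. -/
def regularPart {S : Type*} [TopologicalSpace S] (δ : Set (Set S)) : Set S :=
  ⋃₀ δ \ ⋃ I ∈ δ, arcEnds I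

namespace TransverseMeasuredFoliations

variable {S : Type*} [TopologicalSpace S] (F : TransverseMeasuredFoliations S)

/-- Regular rails of kind `k` of a graph `δ` made of arcs of the transverse kind (for
`k = unstable`: regular `u`-rails of an `s`-graph). -/
def IsRegularRail (k : LeafKind) (δ : Set (Set S)) (J : Set S) : Prop :=
  ∃ a b, F.IsLeafArc k J a b ∧ a ∈ regularPart δ ∧ b ∈ regularPart δ ∧
    Disjoint (J \ {a, b}) (⋃₀ δ)

/-- Extreme rails of kind `k` of a graph `δ` made of arcs of the transverse kind: intervals `J`
with an endpoint outside the regular part of `δ` that are a side of an embedded rectangle whose two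
transverse sides lie in `δ` and all of whose other leaves of kind `k` are regular rails. -/
def IsExtremeRail (k : LeafKind) (δ : Set (Set S)) (J : Set S) : Prop :=
  (∃ a b, F.IsLeafArc k J a b ∧ (a ∉ regularPart δ ∨ b ∉ regularPart δ)) ∧
  ∃ ρ : unitInterval × unitInterval → S, F.IsEmbeddedRectangle k ρ ∧
    (∀ s, ρ (s, 0) ∈ ⋃₀ δ) ∧ (∀ s, ρ (s, 1) ∈ ⋃₀ δ) ∧
    ∃ s₀ : unitInterval, (s₀ = 0 ∨ s₀ = 1) ∧ J = (Set.range fun t => ρ (s₀, t)) ∧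
      ∀ s, s ≠ s₀ → F.IsRegularRail k δ (Set.range fun t => ρ (s, t))

end TransverseMeasuredFoliations

/-- The structure of a generalized pseudo-Anosov homeomorphism on `f`: invariant transverse
measured foliations, and a stretch factor `λ > 1` such that in natural coordinates `f` is
`(x, y) ↦ ± (λ⁻¹ x, λ y)`, that is, `f` preserves both foliations and the orientation, the
`μˢ`-measure of unstable arcs is multiplied by `λ` and the `μᵘ`-measure of stable arcs by `λ⁻¹`.

`sing` is the set `Sing(f)`: the prong singularities if there are any, and otherwise a chosen
nonempty finite invariant set (a finite family of periodic orbits of `f`). -/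
structure PseudoAnosov {S : Type*} [TopologicalSpace S] (f : S ≃ₜ S) extends
    TransverseMeasuredFoliations S where
  stretch : ℝ
  one_lt_stretch : 1 < stretch
  prong_map : ∀ p, prong (f p) = prong p
  map_chart : ∀ p, prong p = 2 → ∃ ε : ℝ, (ε = 1 ∨ ε = -1) ∧
    ∀ᶠ x in 𝓝 p, chart (f p) (f x) =
      ⟨ε * (stretch⁻¹ * (chart p x).re), ε * (stretch * (chart p x).im)⟩
  sing : Set S
  sing_finite : sing.Finite
  sing_nonempty : sing.Nonempty
  sing_invariant : f '' sing = sing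
  sing_eq : (∃ p, prong p ≠ 2) → sing = {p | prong p ≠ 2}

namespace PseudoAnosov

variable {S : Type*} [TopologicalSpace S] {f : S ≃ₜ S} (F : PseudoAnosov f)

/-- `z` is a first intersection point: `z ∉ Sing(f)`, and `(p, z]ˢ ∩ (q, z]ᵘ = {z}` for some
`p, q ∈ Sing(f)` with `z` on a stable separatrix of `p` and on an unstable separatrix of `q`. -/
def IsFirstIntersection (z : S) : Prop :=
  z ∉ F.sing ∧ ∃ p ∈ F.sing, ∃ q ∈ F.sing, ∃ I J : Set S,
    F.IsLeafArc .stable I p z ∧ F.IsLeafArc .unstable J q z ∧ (I \ {p}) ∩ (J \ {q}) = {z}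

/-- The primitive segment `Jᵘ(z) = [q, z]ᵘ`, where `q` is the singular point on the unstable leaf
of `z`. (A leaf contains at most one singular point, and the interval is unique.) -/
def primitiveSegment (z : S) : Set S :=
  {x | ∃ q ∈ F.sing, ∃ J, F.IsLeafArc .unstable J q z ∧ x ∈ J}

/-- `𝓙ᵘ(z)`, the union of all `f⁻ⁱ(Jᵘ(z))`, `i ∈ ℕ`. -/
def backwardSegments (z : S) : Set S :=
  ⋃ i : ℕ, f^[i] ⁻¹' F.primitiveSegment z

/-- The graph of kind `k` generated by a family of arcs with union `K`: all intervals of kind `k`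
with one endpoint in `Sing(f)`, the other in `K`, and interior disjoint from `K`. -/
def generatedGraph (k : LeafKind) (K : Set S) : Set (Set S) :=
  {I | ∃ p ∈ F.sing, ∃ x ∈ K, F.IsLeafArc k I p x ∧ Disjoint (I \ {p, x}) K}

/-- `δˢ(z)`. -/
def stableGraph (z : S) : Set (Set S) :=
  F.generatedGraph .stable (F.backwardSegments z)

/-- `δᵘ(z)`. -/
def unstableGraph (z : S) : Set (Set S) :=
  F.generatedGraph .unstable (⋃₀ F.stableGraph z)

/-- `δ` is an `s`-graph (resp. `u`-graph) adapted to `f`. -/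
structure IsAdapted (k : LeafKind) (δ : Set (Set S)) : Prop where
  finite : δ.Finite
  isLeafArc : ∀ I ∈ δ, ∃ a b, F.IsLeafArc k I a b
  invariant : match k with
    | .stable => f '' ⋃₀ δ ⊆ ⋃₀ δ
    | .unstable => f.symm '' ⋃₀ δ ⊆ ⋃₀ δ
  subset_leaf : ∀ I ∈ δ, ∃ p ∈ F.sing, I ⊆ F.leaf k p
  separatrix : ∀ p ∈ F.sing, ∀ σ, F.IsSeparatrix k p σ → ∃ I ∈ δ, p ∈ arcEnds I ∧ I \ {p} ⊆ σ
  ends : ∀ I ∈ δ, ∀ a ∈ arcEnds I, ∃ q ∈ F.sing, a ∈ F.leaf k.other q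

/-- Compatibility of an adapted `s`-graph and an adapted `u`-graph. -/
structure Compatible (δs δu : Set (Set S)) : Prop where
  adapted_stable : F.IsAdapted .stable δs
  adapted_unstable : F.IsAdapted .unstable δu
  ends_stable : ∀ I ∈ δs, arcEnds I ⊆ ⋃₀ δu
  ends_unstable : ∀ J ∈ δu, arcEnds J ⊆ ⋃₀ δs
  extreme_unstable : ∀ J, F.IsExtremeRail .unstable δs J → J ⊆ ⋃₀ δu
  extreme_stable : ∀ I, F.IsExtremeRail .stable δu I → I ⊆ ⋃₀ δs

/-- The natural numbers `N` such that `δˢ(z)` and `fⁿ(δᵘ(z))` are compatible for all `n ≥ N`. -/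
def compatibleOrders (z : S) : Set ℕ :=
  {N | ∀ n ≥ N, F.Compatible (F.stableGraph z) ((fun J => f^[n] '' J) '' F.unstableGraph z)}

/-- The compatibility coefficient `n(z)`, the minimum of `compatibleOrders z` (if nonempty). -/
noncomputable def compatibilityCoefficient (z : S) : ℕ :=
  sInf (F.compatibleOrders z)

/-- The set of all `n(z)`, `z` a first intersection point of `f`. -/
def coefficients : Set ℕ :=
  F.compatibilityCoefficient '' {z | F.IsFirstIntersection z}

/-- The compatibility order `n(f)`, the maximum of `coefficients` (if it exists). -/
noncomputable def compatibilityOrder : ℕ :=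
  sSup F.coefficients

end PseudoAnosov

/-!
The theorem rests on an explicit description of the leaves through the marked points `Sing(f)`.
In natural coordinates `f` is `± (λ⁻¹ x, λ y)`, also with values in the ramified coordinate at a
prong (`IsAffine.hgt_map`). Hence `f` permutes the prongs at the marked points, and each of them
can be prolonged by the expanding iterates to a ray, parametrized by arc length on `[0, ∞)`
(`Marked.ray`), on which the dynamics is the scaling by `λ` or `λ⁻¹` (`contr_ray`). A topological
argument shows that all intervals in leaves of marked points are segments of rays
(`exists_eq_image_ray`) and that the separatrices are the open rays (`exists_eq_of_isSeparatrix`).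

Separatrices are dense (`closure_ray`): beside the closure of one that is not dense there would be
a gap, and a suitable open set in the gap would be wandering, whereas an area-preserving map of a
surface of finite area is recurrent (`IsAffine.exists_iterate_mem`). So any two transverse
separatrices meet, by the scaling arbitrarily close to the origin of the first and arbitrarily far
out on the second (`exists_ray_eq_ray_lt`).

For a first intersection point `z` on an unstable ray, `δˢ(z)` and `δᵘ(z)` therefore consist of one
initial segment of each ray, up to its first hit of a compact set (`generatedGraph_eq`). An extreme
rail of such a graph is a segment of a ray. It starts at one of the finitely many ends of the graph,
and its interior cannot cross the interior of an edge or contain a marked point, because it is a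
limit of regular rails (`IsExtremeRail.exists_end`). As every ray crosses the graph arbitrarily far
out, extreme rails are bounded (`exists_bound_isExtremeRail`). Now `fⁿ(δᵘ(z))` grows exponentially
and so absorbs the ends and the extreme rails of `δˢ(z)`, while its own extreme rails are contracted
into `δˢ(z)`; this gives `n(z)` (`nonempty_compatibleOrders`). Since `n(f z) = n(z)`, only the `z`
in a fundamental domain of an unstable ray matter. A stable ray that reaches this domain without an
earlier intersection has bounded length there, so there are finitely many such `z`
(`finite_isFirstIntersection`), and `n(f)` exists.

For the invariance, everything is natural under homeomorphisms that preserve the two kinds of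
leaves and `Sing` (`IsConjugacy.compatibilityOrder_eq`). That a topological conjugacy `h` is of
this kind is proved with the marked set enlarged to `Sing(f) ∪ h⁻¹(Sing(g))`. The rays of the
contracted kind consist of the points that the marked points attract (`exists_eq_ray_iff`), so `h`
maps rays into rays. Along the image of a ray the transverse coordinate takes countably many
values, hence is constant (`hgt_eq_of_isPreconnected`), and by density this holds on all local
leaves (`Marked.map_localLeaf`). Finally, `h` preserves the number of prongs, which counts the rays
that start at a point (`Marked.prong_le`), and hence maps `Sing(f)` to `Sing(g)`.
-/

/-! ### Arcs -/

section Arcs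

open Set Filter

variable {S T : Type*} [TopologicalSpace S] [TopologicalSpace T]

theorem IsArc.symm {A : Set S} {a b : S} (h : IsArc A a b) : IsArc A b a := by
  obtain ⟨γ, hc, hi, hr, h0, h1⟩ := h
  refine ⟨fun t => γ (unitInterval.symm t), by fun_prop,
    hi.comp unitInterval.symm_bijective.injective, ?_, by simpa using h1, by simpa using h0⟩
  rw [← hr]
  exact unitInterval.symm_bijective.surjective.range_comp γ

theorem IsArc.image {A : Set S} {a b : S} (h : IsArc A a b) {g : S → T} (hg : Continuous g)
    (hgi : Function.Injective g) : IsArc (g '' A) (g a) (g b) := by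
  obtain ⟨γ, hc, hi, rfl, rfl, rfl⟩ := h
  exact ⟨g ∘ γ, hg.comp hc, hgi.comp hi, range_comp g γ, rfl, rfl⟩

/-- An arc is the image of `[0,1]` under a continuous function of a real variable that is
injective on `[0,1]`. -/
theorem IsArc.exists_real {A : Set S} {a b : S} (h : IsArc A a b) :
    ∃ α : ℝ → S, Continuous α ∧ InjOn α (Icc 0 1) ∧ α '' Icc 0 1 = A ∧ α 0 = a ∧ α 1 = b := by
  obtain ⟨γ, hc, hi, hr, h0, h1⟩ := h
  refine ⟨IccExtend zero_le_one γ, hc.Icc_extend', ?_, ?_, ?_, ?_⟩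
  · intro x hx y hy hxy
    rw [IccExtend_of_mem _ _ hx, IccExtend_of_mem _ _ hy] at hxy
    simpa using hi hxy
  · rw [← hr]
    ext y
    constructor
    · rintro ⟨x, hx, rfl⟩
      rw [IccExtend_of_mem _ _ hx]
      exact ⟨_, rfl⟩
    · rintro ⟨x, rfl⟩
      exact ⟨x, x.2, IccExtend_val _ _ _⟩
  · rw [IccExtend_left, ← h0]; rfl
  · rw [IccExtend_right, ← h1]; rfl

theorem isArc_image_Icc {γ : ℝ → S} {s t : ℝ} (hst : s < t) (hc : ContinuousOn γ (Icc s t))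
    (hi : InjOn γ (Icc s t)) : IsArc (γ '' Icc s t) (γ s) (γ t) := by
  have hmem : ∀ u : unitInterval, s + u * (t - s) ∈ Icc s t := by
    intro u
    have h0 := u.2.1
    have h1 := u.2.2
    constructor <;> nlinarith
  refine ⟨fun u => γ (s + u * (t - s)), ?_, ?_, ?_, by simp, by simp⟩
  · exact hc.comp_continuous (by fun_prop) hmem
  · intro u v huv
    have := hi (hmem u) (hmem v) huv
    have h2 : (u : ℝ) * (t - s) = v * (t - s) := by linarith
    exact Subtype.ext (mul_right_cancel₀ (by linarith) h2)
  · ext y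
    constructor
    · rintro ⟨u, rfl⟩
      exact ⟨_, hmem u, rfl⟩
    · rintro ⟨x, hx, rfl⟩
      have hp : 0 < t - s := by linarith
      refine ⟨⟨(x - s) / (t - s), div_nonneg (by linarith [hx.1]) hp.le, ?_⟩, ?_⟩
      · rw [div_le_one hp]; linarith [hx.2]
      · simp only
        congr 1
        field_simp
        ring

theorem isArc_image_uIcc {γ : ℝ → S} {s t : ℝ} (hst : s ≠ t) (hc : ContinuousOn γ (uIcc s t))
    (hi : InjOn γ (uIcc s t)) : IsArc (γ '' uIcc s t) (γ s) (γ t) := by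
  rcases lt_or_gt_of_ne hst with h | h
  · rw [uIcc_of_le h.le] at *
    exact isArc_image_Icc h hc hi
  · rw [uIcc_of_ge h.le] at *
    exact (isArc_image_Icc h hc hi).symm

/-- The two endpoints of an arc are determined by the arc. -/
theorem IsArc.ends_eq [T2Space S] {A : Set S} {a b a' b' : S} (h : IsArc A a b)
    (h' : IsArc A a' b') : (a' = a ∧ b' = b) ∨ (a' = b ∧ b' = a) := by
  obtain ⟨γ, hc, hi, hr, h0, h1⟩ := h
  obtain ⟨γ', hc', hi', hr', h0', h1'⟩ := h'
  have hemb : Topology.IsClosedEmbedding γ := hc.isClosedEmbedding hi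
  have hex : ∀ t, ∃ s, γ s = γ' t := fun t => by
    have : γ' t ∈ range γ := by rw [hr, ← hr']; exact ⟨t, rfl⟩
    exact this
  choose φ hφ using hex
  have hφc : Continuous φ := by
    rw [hemb.isEmbedding.continuous_iff]
    have : γ ∘ φ = γ' := funext hφ
    rwa [this]
  have hφi : Function.Injective φ := fun s t hst => hi' (by rw [← hφ, ← hφ, hst])
  have hφs : Function.Surjective φ := by
    intro s
    have : γ s ∈ range γ' := by rw [hr', ← hr]; exact ⟨s, rfl⟩
    obtain ⟨t, ht⟩ := this
    exact ⟨t, hi ((hφ t).trans ht)⟩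
  -- the change of parameter is a monotone or an antitone bijection of `[0, 1]`
  rcases hφc.strictMono_of_inj hφi with hm | hm
  · left
    have e0 : φ 0 = 0 := by
      obtain ⟨t, ht⟩ := hφs 0
      exact le_antisymm ((hm.monotone unitInterval.nonneg').trans ht.le) unitInterval.nonneg'
    have e1 : φ 1 = 1 := by
      obtain ⟨t, ht⟩ := hφs 1
      exact le_antisymm unitInterval.le_one' (ht.ge.trans (hm.monotone unitInterval.le_one'))
    rw [← h0', ← h1', ← h0, ← h1, ← hφ, ← hφ, e0, e1]
    exact ⟨rfl, rfl⟩
  · right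
    have e0 : φ 0 = 1 := by
      obtain ⟨t, ht⟩ := hφs 1
      exact le_antisymm unitInterval.le_one' (ht.ge.trans (hm.antitone unitInterval.nonneg'))
    have e1 : φ 1 = 0 := by
      obtain ⟨t, ht⟩ := hφs 0
      exact le_antisymm ((hm.antitone unitInterval.le_one').trans ht.le) unitInterval.nonneg'
    rw [← h0', ← h1', ← h0, ← h1, ← hφ, ← hφ, e0, e1]
    exact ⟨rfl, rfl⟩

theorem IsArc.arcEnds_eq [T2Space S] {A : Set S} {a b : S} (h : IsArc A a b) :
    arcEnds A = {a, b} := by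
  ext x
  constructor
  · rintro ⟨y, hy⟩
    rcases h.ends_eq hy with ⟨h1, -⟩ | ⟨h1, -⟩
    · exact Or.inl h1
    · exact Or.inr h1
  · rintro (rfl | rfl)
    · exact ⟨_, h⟩
    · exact ⟨_, h.symm⟩

theorem arcEnds_image (h : S ≃ₜ T) (A : Set S) : arcEnds (h '' A) = h '' arcEnds A := by
  ext x
  constructor
  · rintro ⟨y, hy⟩
    have := hy.image h.symm.continuous h.symm.injective
    rw [← image_comp] at this
    simp only [Homeomorph.symm_comp_self, image_id] at this
    exact ⟨h.symm x, ⟨_, this⟩, by simp⟩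
  · rintro ⟨y, ⟨z, hz⟩, rfl⟩
    exact ⟨_, hz.image h.continuous h.injective⟩

theorem regularPart_image (h : S ≃ₜ T) (δ : Set (Set S)) :
    regularPart ((fun A => h '' A) '' δ) = h '' regularPart δ := by
  unfold regularPart
  rw [image_sdiff h.injective]
  congr 1
  · rw [sUnion_image, image_sUnion]
    rw [sUnion_eq_biUnion, biUnion_image]
  · rw [biUnion_image, image_iUnion₂]
    simp only [arcEnds_image]

end Arcs

/-! ### Natural coordinates and straight lines -/

namespace LeafKind

/-- The square of a unit tangent vector of a leaf of the given kind, in a natural coordinate. -/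
def sgn : LeafKind → ℝ
  | .stable => 1
  | .unstable => -1

/-- A unit tangent vector of a leaf of the given kind, in a natural coordinate. -/
noncomputable def dir : LeafKind → ℂ
  | .stable => 1
  | .unstable => Complex.I

/-- The natural coordinate that is constant on leaves of the given kind. -/
def cross : LeafKind → ℂ → ℝ
  | .stable, w => w.im
  | .unstable, w => w.re

/-- The square of the transverse coordinate `cross k w`, as a function of `w ^ 2`. Unlike
`cross k w` it does not depend on the choice of a branch of `w`. -/
noncomputable def hgt (k : LeafKind) (W : ℂ) : ℝ := (‖W‖ - k.sgn * W.re) / 2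

@[simp] theorem other_other (k : LeafKind) : k.other.other = k := by cases k <;> rfl

theorem sgn_other (k : LeafKind) : k.other.sgn = -k.sgn := by cases k <;> simp [sgn, other]

theorem sgn_mul_self (k : LeafKind) : k.sgn * k.sgn = 1 := by cases k <;> simp [sgn]

theorem sgn_ne_zero (k : LeafKind) : (k.sgn : ℂ) ≠ 0 := by cases k <;> simp [sgn]

theorem dir_sq (k : LeafKind) : k.dir ^ 2 = k.sgn := by cases k <;> simp [dir, sgn]

theorem norm_dir (k : LeafKind) : ‖k.dir‖ = 1 := by cases k <;> simp [dir]

theorem hgt_sq (k : LeafKind) (w : ℂ) : k.hgt (w ^ 2) = k.cross w ^ 2 := by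
  have h : ‖w‖ ^ 2 = w.re ^ 2 + w.im ^ 2 := by
    rw [← Complex.normSq_eq_norm_sq, Complex.normSq_apply]; ring
  have h2 : (w ^ 2).re = w.re ^ 2 - w.im ^ 2 := by simp [pow_two]
  unfold hgt
  rw [norm_pow, h, h2]
  cases k <;> (simp [sgn, cross]; try ring)

theorem hgt_add_hgt (k : LeafKind) (W : ℂ) : k.hgt W + k.other.hgt W = ‖W‖ := by
  unfold hgt; rw [sgn_other]; ring

theorem hgt_nonneg (k : LeafKind) (W : ℂ) : 0 ≤ k.hgt W := by
  have h := Complex.abs_re_le_norm W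
  have h1 := neg_abs_le W.re
  have h2 := le_abs_self W.re
  unfold hgt
  cases k <;> simp [sgn] <;> linarith

theorem hgt_le_norm (k : LeafKind) (W : ℂ) : k.hgt W ≤ ‖W‖ := by
  rw [← k.hgt_add_hgt W]; linarith [k.other.hgt_nonneg W]

theorem continuous_hgt (k : LeafKind) : Continuous k.hgt := by
  unfold hgt; fun_prop

theorem hgt_eq_zero_iff (k : LeafKind) (W : ℂ) : k.hgt W = 0 ↔ W = k.sgn * ‖W‖ := by
  constructor
  · intro h
    have h1 : ‖W‖ = k.sgn * W.re := by unfold hgt at h; linarith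
    have h3 : W.re ^ 2 = ‖W‖ ^ 2 := by
      rw [h1]; cases k <;> simp [sgn]
    have h4 : ‖W‖ ^ 2 = W.re ^ 2 + W.im ^ 2 := by
      rw [← Complex.normSq_eq_norm_sq, Complex.normSq_apply]; ring
    have h5 : W.im = 0 := by nlinarith
    apply Complex.ext
    · rw [← Complex.ofReal_mul, Complex.ofReal_re, h1, ← mul_assoc, sgn_mul_self, one_mul]
    · rw [← Complex.ofReal_mul, Complex.ofReal_im, h5]
  · intro h
    have h1 : W.re = k.sgn * ‖W‖ := by
      conv_lhs => rw [h]
      rw [← Complex.ofReal_mul, Complex.ofReal_re]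
    unfold hgt
    rw [h1, ← mul_assoc, sgn_mul_self]; ring

theorem hgt_sgn_mul (k : LeafKind) {r : ℝ} (hr : 0 ≤ r) : k.hgt (k.sgn * r) = 0 := by
  rw [hgt_eq_zero_iff]
  rw [norm_mul, Complex.norm_real, Complex.norm_real, Real.norm_of_nonneg hr]
  cases k <;> simp [sgn]

theorem hgt_other_sgn_mul (k : LeafKind) {r : ℝ} (hr : 0 ≤ r) : k.other.hgt (k.sgn * r) = r := by
  have h := k.hgt_add_hgt (k.sgn * r)
  rw [k.hgt_sgn_mul hr, zero_add] at h
  rw [h, norm_mul, Complex.norm_real, Complex.norm_real, Real.norm_of_nonneg hr]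
  cases k <;> simp [sgn]

theorem cross_add (k : LeafKind) (z w : ℂ) : k.cross (z + w) = k.cross z + k.cross w := by
  cases k <;> simp [cross]

theorem cross_neg (k : LeafKind) (z : ℂ) : k.cross (-z) = -k.cross z := by
  cases k <;> simp [cross]

theorem continuous_cross : ∀ k : LeafKind, Continuous k.cross
  | .stable => Complex.continuous_im
  | .unstable => Complex.continuous_re

theorem cross_real_mul_dir (k : LeafKind) (v : ℝ) : k.cross (v * k.dir) = 0 := by
  cases k <;> simp [cross, dir]

theorem eq_dir_or_of_sq {k : LeafKind} {u : ℂ} (hu : u ^ 2 = k.sgn) : u = k.dir ∨ u = -k.dir :=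
  sq_eq_sq_iff_eq_or_eq_neg.1 (hu.trans k.dir_sq.symm)

theorem cross_real_mul {k : LeafKind} {u : ℂ} (hu : u ^ 2 = k.sgn) (v : ℝ) :
    k.cross (v * u) = 0 := by
  rcases eq_dir_or_of_sq hu with rfl | rfl
  · exact k.cross_real_mul_dir v
  · rw [mul_neg, cross_neg, k.cross_real_mul_dir, neg_zero]

theorem exists_real_mul_dir {k : LeafKind} {z : ℂ} (hz : k.cross z = 0) :
    ∃ v : ℝ, z = v * k.dir := by
  cases k
  · exact ⟨z.re, Complex.ext (by simp [dir]) (by simpa [dir, cross] using hz)⟩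
  · exact ⟨z.im, Complex.ext (by simpa [dir, cross] using hz) (by simp [dir])⟩

theorem exists_real_mul {k : LeafKind} {u z : ℂ} (hu : u ^ 2 = k.sgn) (hz : k.cross z = 0) :
    ∃ v : ℝ, z = v * u := by
  obtain ⟨v, hv⟩ := exists_real_mul_dir hz
  rcases eq_dir_or_of_sq hu with rfl | rfl
  · exact ⟨v, hv⟩
  · exact ⟨-v, by rw [hv]; push_cast; ring⟩

theorem norm_eq_one_of_sq {k : LeafKind} {u : ℂ} (hu : u ^ 2 = k.sgn) : ‖u‖ = 1 := by
  rcases eq_dir_or_of_sq hu with rfl | rfl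
  · exact k.norm_dir
  · rw [norm_neg, k.norm_dir]

end LeafKind

/-- Two continuous branches of a square root that agree at a point where they do not vanish agree
near this point. -/
theorem eventually_eq_of_sq_eq {X : Type*} [TopologicalSpace X] {x : X} {A B : X → ℂ}
    (hA : ContinuousAt A x) (hB : ContinuousAt B x) (h0 : A x = B x) (hne : A x ≠ 0)
    (h : ∀ᶠ y in 𝓝 x, A y ^ 2 = B y ^ 2) : ∀ᶠ y in 𝓝 x, A y = B y := by
  have h1 : ContinuousAt (fun y => A y + B y) x := hA.add hB
  have h2 : ∀ᶠ y in 𝓝 x, A y + B y ≠ 0 := by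
    refine h1.eventually_ne ?_
    rw [← h0, ← two_mul]
    exact mul_ne_zero two_ne_zero hne
  filter_upwards [h, h2] with y hy hy2
  rcases sq_eq_sq_iff_eq_or_eq_neg.1 hy with h | h
  · exact h
  · exact absurd (by rw [h]; ring) hy2

namespace TransverseMeasuredFoliations

open Set Filter

variable {S : Type*} [TopologicalSpace S] (F : TransverseMeasuredFoliations S)

/-- The square `w ^ 2 = z ^ k` of the natural coordinate around `p`. -/
noncomputable def quad (p x : S) : ℂ := F.chart p x ^ F.prong p

theorem prong_ne_zero (p : S) : F.prong p ≠ 0 := Nat.one_le_iff_ne_zero.1 (F.prong_pos p)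

theorem quad_self (p : S) : F.quad p p = 0 := by
  simp [quad, F.chart_self, F.prong_ne_zero]

theorem continuousAt_quad {p x : S} (hx : x ∈ (F.chart p).source) : ContinuousAt (F.quad p) x :=
  ((F.chart p).continuousAt hx).pow _

theorem eq_of_chart_eq_zero {p x : S} (hx : x ∈ (F.chart p).source) (h : F.chart p x = 0) :
    x = p :=
  (F.chart p).injOn hx (F.mem_source p) (h.trans (F.chart_self p).symm)

theorem quad_ne_zero {p x : S} (hx : x ∈ (F.chart p).source) (h : x ≠ p) : F.quad p x ≠ 0 :=
  pow_ne_zero _ fun h0 => h (F.eq_of_chart_eq_zero hx h0)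

theorem mem_localLeaf_iff {k : LeafKind} {p x : S} :
    x ∈ F.localLeaf k p ↔ x ∈ (F.chart p).source ∧ k.hgt (F.quad p x) = 0 := by
  have hW : ‖F.quad p x‖ ^ 2 = (F.quad p x).re ^ 2 + (F.quad p x).im ^ 2 := by
    rw [← Complex.normSq_eq_norm_sq, Complex.normSq_apply]; ring
  unfold localLeaf
  rw [mem_ofPred_eq]
  change _ ∧ (F.quad p x).im = 0 ∧ (match k with
    | .stable => 0 ≤ (F.quad p x).re
    | .unstable => (F.quad p x).re ≤ 0) ↔ _
  refine and_congr_right fun _ => ?_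
  have hn := norm_nonneg (F.quad p x)
  cases k
  · simp only [LeafKind.hgt, LeafKind.sgn]
    constructor
    · rintro ⟨h1, h2⟩
      rw [h1] at hW
      have : ‖F.quad p x‖ = (F.quad p x).re := by
        rw [← sq_eq_sq₀ hn h2]; linarith
      linarith
    · intro h
      have h1 : ‖F.quad p x‖ = (F.quad p x).re := by linarith
      rw [h1] at hW
      exact ⟨by nlinarith, by linarith⟩
  · simp only [LeafKind.hgt, LeafKind.sgn]
    constructor
    · rintro ⟨h1, h2⟩
      rw [h1] at hW
      have : ‖F.quad p x‖ = -(F.quad p x).re := by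
        rw [← sq_eq_sq₀ hn (by linarith)]; linarith
      linarith
    · intro h
      have h1 : ‖F.quad p x‖ = -(F.quad p x).re := by linarith
      rw [h1] at hW
      exact ⟨by nlinarith, by linarith⟩

theorem self_mem_localLeaf (k : LeafKind) (p : S) : p ∈ F.localLeaf k p := by
  rw [mem_localLeaf_iff, F.quad_self]
  exact ⟨F.mem_source p, by simp [LeafKind.hgt]⟩

/-- Local leaves of the two kinds through a point meet only there. -/
theorem eq_of_mem_localLeaf {k : LeafKind} {p x : S} (h1 : x ∈ F.localLeaf k p)
    (h2 : x ∈ F.localLeaf k.other p) : x = p := by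
  rw [mem_localLeaf_iff] at h1 h2
  by_contra hne
  have h := k.hgt_add_hgt (F.quad p x)
  rw [h1.2, h2.2, add_zero] at h
  exact F.quad_ne_zero h1.1 hne (norm_eq_zero.1 h.symm)

/-- `Ψ` is near `w₀` the inverse of a natural coordinate, up to translation and a rotation
by a square root of `c`. -/
def IsoAt (c : ℂ) (Ψ : ℂ → S) (w₀ : ℂ) : Prop :=
  ContinuousAt Ψ w₀ ∧ F.prong (Ψ w₀) = 2 ∧ ∃ u : ℂ, u ^ 2 = c ∧
    ∀ᶠ w in 𝓝 w₀, F.chart (Ψ w₀) (Ψ w) = u * (w - w₀)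

/-- Near `t`, the path `γ` is, in a natural coordinate, a straight line whose velocity is a square
root of `c`. For `c = k.sgn` this means that `γ` runs with unit speed along a leaf of kind `k`. -/
def LineAt (c : ℂ) (γ : ℝ → S) (t : ℝ) : Prop :=
  ContinuousAt γ t ∧ F.prong (γ t) = 2 ∧ ∃ u : ℂ, u ^ 2 = c ∧
    ∀ᶠ s in 𝓝 t, F.chart (γ t) (γ s) = ((s - t : ℝ) : ℂ) * u

variable {F}

theorem IsoAt.lineAt {c : ℂ} {Ψ : ℂ → S} {a v : ℂ} {t : ℝ} (h : F.IsoAt c Ψ (a + t * v)) :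
    F.LineAt (c * v ^ 2) (fun s : ℝ => Ψ (a + s * v)) t := by
  obtain ⟨hc, hp, u, hu, he⟩ := h
  have hl : Tendsto (fun s : ℝ => a + (s : ℂ) * v) (𝓝 t) (𝓝 (a + t * v)) := by
    apply Continuous.tendsto; fun_prop
  refine ⟨ContinuousAt.comp (f := fun s : ℝ => a + (s : ℂ) * v) hc hl, hp, u * v,
    by rw [mul_pow, hu], ?_⟩
  filter_upwards [hl.eventually he] with s hs
  rw [hs]; push_cast; ring

theorem isoAt_of_quad {c : ℂ} (hc0 : c ≠ 0) {Ψ : ℂ → S} {w₀ : ℂ} (hw : w₀ ≠ 0) {p : S}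
    (hc : ContinuousAt Ψ w₀) (hs : Ψ w₀ ∈ (F.chart p).source) (hne : Ψ w₀ ≠ p)
    (hq : ∀ᶠ w in 𝓝 w₀, F.quad p (Ψ w) = c * w ^ 2) : F.IsoAt c Ψ w₀ := by
  obtain ⟨h2, a, ha⟩ := F.compat p _ hs hne
  refine ⟨hc, h2, ?_⟩
  obtain ⟨u₀, hu₀⟩ : ∃ u₀ : ℂ, u₀ ^ 2 = c := IsAlgClosed.exists_pow_nat_eq c two_pos
  have hev : ∀ᶠ w in 𝓝 w₀, (F.chart (Ψ w₀) (Ψ w) + a) ^ 2 = (u₀ * w) ^ 2 := by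
    filter_upwards [hc.eventually ha, hq] with w h1 h3
    rw [h1, mul_pow, hu₀, ← h3]; rfl
  have h0 := hev.self_of_nhds
  rw [F.chart_self, zero_add] at h0
  have hu0 : u₀ ≠ 0 := by rintro rfl; exact hc0 (by rw [← hu₀]; ring)
  have hcont : ContinuousAt (fun w => F.chart (Ψ w₀) (Ψ w) + a) w₀ :=
    ((((F.chart (Ψ w₀)).continuousAt (F.mem_source _)).comp hc)).add continuousAt_const
  obtain ⟨u, hu, hua⟩ : ∃ u : ℂ, u ^ 2 = c ∧ a = u * w₀ := by
    rcases sq_eq_sq_iff_eq_or_eq_neg.1 h0 with h | h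
    · exact ⟨u₀, hu₀, h⟩
    · exact ⟨-u₀, by rw [neg_sq, hu₀], by rw [h]; ring⟩
  refine ⟨u, hu, ?_⟩
  have hu1 : u ≠ 0 := by rintro rfl; exact hc0 (by rw [← hu]; ring)
  have := eventually_eq_of_sq_eq hcont (B := fun w => u * w) (by fun_prop)
    (by simp only [F.chart_self, zero_add, hua])
    (by simp only [F.chart_self, zero_add, hua]; exact mul_ne_zero hu1 hw)
    (by filter_upwards [hev] with w h; rw [h, mul_pow, mul_pow, hu, hu₀])
  filter_upwards [this] with w h
  rw [mul_sub, ← hua, ← h]; ring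

/-- Inverses of natural coordinates around regular points are isometric. -/
theorem isoAt_chart_symm {y : S} (hy : F.prong y = 2) {w : ℂ} (hw : w ∈ (F.chart y).target) :
    F.IsoAt 1 (F.chart y).symm w := by
  have hcont := (F.chart y).continuousAt_symm hw
  have hev : ∀ᶠ v in 𝓝 w, v ∈ (F.chart y).target := (F.chart y).open_target.mem_nhds hw
  by_cases h0 : w = 0
  · subst h0
    have e : (F.chart y).symm 0 = y := by
      conv_lhs => rw [← F.chart_self y]
      exact (F.chart y).left_inv (F.mem_source y)
    refine ⟨hcont, by rw [e, hy], 1, one_pow 2, ?_⟩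
    filter_upwards [hev] with v hv
    rw [e, (F.chart y).right_inv hv]; ring
  · refine isoAt_of_quad one_ne_zero h0 (p := y) hcont ((F.chart y).map_target hw) ?_ ?_
    · intro h
      apply h0
      rw [← (F.chart y).right_inv hw, h, F.chart_self]
    · filter_upwards [hev] with v hv
      rw [quad, hy, (F.chart y).right_inv hv, one_mul]

theorem LineAt.congr {c : ℂ} {γ γ' : ℝ → S} {t : ℝ} (h : F.LineAt c γ t) (he : γ =ᶠ[𝓝 t] γ') :
    F.LineAt c γ' t := by
  obtain ⟨hc, hp, u, hu, hev⟩ := h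
  have e := he.self_of_nhds
  refine ⟨hc.congr he, e ▸ hp, u, hu, ?_⟩
  filter_upwards [hev, he] with s h1 h2
  rw [← e, ← h2, h1]

theorem LineAt.comp_affine {c : ℂ} {γ : ℝ → S} {a b t : ℝ} (h : F.LineAt c γ (a * t + b)) :
    F.LineAt (c * a ^ 2) (fun s => γ (a * s + b)) t := by
  obtain ⟨hc, hp, u, hu, hev⟩ := h
  have hl : Tendsto (fun s : ℝ => a * s + b) (𝓝 t) (𝓝 (a * t + b)) := by
    apply Continuous.tendsto; fun_prop
  refine ⟨ContinuousAt.comp (f := fun s : ℝ => a * s + b) hc hl, hp, u * a,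
    by rw [mul_pow, hu], ?_⟩
  filter_upwards [hl.eventually hev] with s hs
  rw [hs]; push_cast; ring

theorem LineAt.reflect {c : ℂ} {γ : ℝ → S} {η b t : ℝ} (hη : η = 1 ∨ η = -1)
    (h : F.LineAt c γ (η * t + b)) : F.LineAt c (fun s => γ (η * s + b)) t := by
  have := h.comp_affine
  rcases hη with rfl | rfl <;> simpa using this

theorem LineAt.eventually_source {c : ℂ} {γ : ℝ → S} {t : ℝ} (h : F.LineAt c γ t) :
    ∀ᶠ s in 𝓝 t, γ s ∈ (F.chart (γ t)).source :=
  h.1.eventually_mem ((F.chart (γ t)).open_source.mem_nhds (F.mem_source _))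

/-- Two lines of the same slope through a point agree up to orientation. -/
theorem LineAt.eq_or_flip {c : ℂ} {γ γ' : ℝ → S} {t t' : ℝ} (h : F.LineAt c γ t)
    (h' : F.LineAt c γ' t') (he : γ t = γ' t') :
    ∃ η : ℝ, (η = 1 ∨ η = -1) ∧ ∀ᶠ s in 𝓝 t, γ s = γ' (η * (s - t) + t') := by
  obtain ⟨u, hu, hev⟩ := h.2.2
  obtain ⟨u', hu', hev'⟩ := h'.2.2
  have key : ∃ η : ℝ, (η = 1 ∨ η = -1) ∧ u = η * u' := by
    rcases sq_eq_sq_iff_eq_or_eq_neg.1 (hu.trans hu'.symm) with h | h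
    · exact ⟨1, Or.inl rfl, by simp [h]⟩
    · exact ⟨-1, Or.inr rfl, by simp [h]⟩
  obtain ⟨η, hη, hηu⟩ := key
  have hl : Tendsto (fun s : ℝ => η * (s - t) + t') (𝓝 t) (𝓝 t') := by
    have : Continuous (fun s : ℝ => η * (s - t) + t') := by fun_prop
    simpa using this.tendsto t
  refine ⟨η, hη, ?_⟩
  filter_upwards [hev, hl.eventually hev', h.eventually_source,
    hl.eventually h'.eventually_source] with s h1 h2 h3 h4
  apply (F.chart (γ t)).injOn h3 (he ▸ h4)
  rw [h1]
  rw [he, h2, hηu]; push_cast; ring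

/-- Unique continuation of straight lines. -/
theorem LineAt.eqOn [T2Space S] {c : ℂ} {γ γ' : ℝ → S} {I : Set ℝ}
    (hI : IsPreconnected I) (h : ∀ t ∈ I, F.LineAt c γ t) (h' : ∀ t ∈ I, F.LineAt c γ' t)
    {t₀ : ℝ} (ht₀ : t₀ ∈ I) (he : γ =ᶠ[𝓝 t₀] γ') : EqOn γ γ' I := by
  have hopen : IsOpen {t | γ =ᶠ[𝓝 t] γ'} := isOpen_setOfPred_eventually_nhds
  have hsub : I ⊆ {t | γ =ᶠ[𝓝 t] γ'} := by
    refine hI.subset_of_closure_inter_subset hopen ⟨t₀, ht₀, he⟩ ?_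
    rintro t ⟨htc, htI⟩
    by_contra hnot
    -- at a limit `t` of parameters of coincidence, the two lines agree at `t` and have one more common
    -- point near `t`, so that their directions agree too
    have hfr : ∃ᶠ s in 𝓝[≠] t, γ s = γ' s := by
      rw [mem_closure_iff_frequently] at htc
      rw [frequently_nhdsWithin_iff]
      refine htc.mono fun s hs => ⟨hs.self_of_nhds, ?_⟩
      rintro rfl
      exact hnot hs
    have e : γ t = γ' t := by
      refine tendsto_nhds_unique_of_frequently_eq ((h t htI).1.tendsto.mono_left
        nhdsWithin_le_nhds) ((h' t htI).1.tendsto.mono_left nhdsWithin_le_nhds) hfr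
    obtain ⟨u, hu, hev⟩ := (h t htI).2.2
    obtain ⟨u', hu', hev'⟩ := (h' t htI).2.2
    have hcom := (hev.and (hev'.and ((h t htI).eventually_source.and
      (h' t htI).eventually_source)))
    obtain ⟨s, ⟨hs, hst⟩, h1, h2, h3, h4⟩ := ((hfr.and_eventually
      (eventually_mem_nhdsWithin)).and_eventually (hcom.filter_mono nhdsWithin_le_nhds)).exists
    have huu : u = u' := by
      rw [hs, e, h2] at h1
      have : ((s - t : ℝ) : ℂ) ≠ 0 := by
        rw [Complex.ofReal_ne_zero, sub_ne_zero]; exact hst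
      exact (mul_left_cancel₀ this h1).symm
    apply hnot
    filter_upwards [hcom] with s ⟨h1, h2, h3, h4⟩
    apply (F.chart (γ t)).injOn h3 (e ▸ h4)
    rw [h1]; rw [e, h2, huu]
  exact fun t ht => (hsub ht).self_of_nhds

/-- Along a line that is a leaf of kind `k`, the transverse coordinate is locally constant. -/
theorem LineAt.hgt_eventually_eq {k : LeafKind} {γ : ℝ → S} {t : ℝ} (h : F.LineAt k.sgn γ t)
    {p : S} (hp : γ t ∈ (F.chart p).source) :
    ∀ᶠ s in 𝓝 t, k.hgt (F.quad p (γ s)) = k.hgt (F.quad p (γ t)) := by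
  obtain ⟨hc, h2, u, hu, hev⟩ := h
  by_cases he : γ t = p
  · subst he
    filter_upwards [hev] with s hs
    have e : F.quad (γ t) (γ s) = (((s - t : ℝ) : ℂ) * u) ^ 2 := by rw [quad, h2, hs]
    rw [F.quad_self, e, k.hgt_sq, LeafKind.cross_real_mul hu]
    simp [LeafKind.hgt]
  · obtain ⟨-, a, ha⟩ := F.compat p _ hp he
    have key : ∀ᶠ s in 𝓝 t, k.hgt (F.quad p (γ s)) = k.cross a ^ 2 := by
      filter_upwards [hev, hc.eventually ha] with s h1 h3
      have e : F.quad p (γ s) = (((s - t : ℝ) : ℂ) * u + a) ^ 2 := by rw [quad, ← h3, h1]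
      rw [e, k.hgt_sq, k.cross_add, LeafKind.cross_real_mul hu, zero_add]
    filter_upwards [key] with s hs
    rw [hs, key.self_of_nhds]

/-- Near a regular point of a line that is a leaf of kind `k`, the local leaf is this line. -/
theorem LineAt.eventually_localLeaf {k : LeafKind} {γ : ℝ → S} {t : ℝ} (h : F.LineAt k.sgn γ t)
    {ε : ℝ} (hε : 0 < ε) :
    ∀ᶠ x in 𝓝 (γ t), x ∈ F.localLeaf k (γ t) → ∃ s, |s - t| < ε ∧ x = γ s := by
  obtain ⟨hc, h2, u, hu, hev⟩ := h
  have hsrc := LineAt.eventually_source (F := F) ⟨hc, h2, u, hu, hev⟩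
  obtain ⟨δ, hδ, hball⟩ := Metric.eventually_nhds_iff.1 (hev.and hsrc)
  have hch : Tendsto (fun x => ‖F.chart (γ t) x‖) (𝓝 (γ t)) (𝓝 0) := by
    have := ((F.chart (γ t)).continuousAt (F.mem_source _)).norm.tendsto
    rwa [F.chart_self, norm_zero] at this
  filter_upwards [hch.eventually_lt_const (lt_min hε hδ)] with x hx hmem
  rw [mem_localLeaf_iff, quad, h2, k.hgt_sq] at hmem
  obtain ⟨v, hv⟩ := LeafKind.exists_real_mul hu (pow_eq_zero_iff two_ne_zero |>.1 hmem.2)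
  have hv1 : |v| < min ε δ := by
    rw [hv, norm_mul, LeafKind.norm_eq_one_of_sq hu, mul_one, Complex.norm_real] at hx
    exact hx
  refine ⟨t + v, by simpa using hv1.trans_le (min_le_left _ _), ?_⟩
  have := hball (y := t + v) (by simpa [Real.dist_eq] using hv1.trans_le (min_le_right _ _))
  apply (F.chart (γ t)).injOn hmem.1 this.2
  rw [this.1, hv]; simp

theorem LineAt.eventually_mem_localLeaf {k : LeafKind} {γ : ℝ → S} {t : ℝ}
    (h : F.LineAt k.sgn γ t) : ∀ᶠ s in 𝓝 t, γ s ∈ F.localLeaf k (γ t) := by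
  filter_upwards [h.hgt_eventually_eq (F.mem_source _), h.eventually_source] with s h1 h2
  rw [mem_localLeaf_iff, h1, F.quad_self]
  exact ⟨h2, by simp [LeafKind.hgt]⟩

end TransverseMeasuredFoliations

/-! ### Sectors at a point, and maps that are affine in natural coordinates -/

section

open Set Filter

/-- A function that is locally the square of an affine function with slope `ℓ`, and that tends
to `0` at `0`, is the square of a linear function. -/
theorem eq_sq_of_locally_sq_affine {V : ℝ → ℂ} {ℓ : ℂ} (hℓ : ℓ ≠ 0) {T : ℝ}
    (h : ∀ t ∈ Ioo 0 T, ∃ b : ℂ, ∀ᶠ s in 𝓝 t, V s = (s * ℓ + b) ^ 2)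
    (h0 : Tendsto V (𝓝[>] 0) (𝓝 0)) : ∀ t ∈ Ioo 0 T, V t = (t * ℓ) ^ 2 := by
  intro t ht
  obtain ⟨b, hb⟩ := h t ht
  have hopen : IsOpen {t | ∀ᶠ s in 𝓝 t, V s = (s * ℓ + b) ^ 2} := isOpen_setOfPred_eventually_nhds
  have hsub : Ioo 0 T ⊆ {t | ∀ᶠ s in 𝓝 t, V s = (s * ℓ + b) ^ 2} := by
    refine isPreconnected_Ioo.subset_of_closure_inter_subset hopen ⟨t, ht, hb⟩ ?_
    rintro t1 ⟨hc, h1⟩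
    obtain ⟨b', hb'⟩ := h t1 h1
    rw [mem_closure_iff_frequently] at hc
    obtain ⟨t2, h2, h3⟩ := (hc.and_eventually hb'.eventually_nhds).exists
    have h4 : ∀ᶠ s : ℝ in 𝓝 t2, (b - b') * (2 * ℓ * s + b + b') = 0 := by
      filter_upwards [h2, h3] with s e1 e2
      rw [e1] at e2
      linear_combination e2
    -- where two local square roots overlap, their constant terms agree
    have hbb : b = b' := by
      by_contra hne
      have h5 : ∀ᶠ s : ℝ in 𝓝 t2, 2 * ℓ * s + b + b' = 0 := by
        filter_upwards [h4] with s hs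
        exact (mul_eq_zero.1 hs).resolve_left (sub_ne_zero.2 hne)
      have h6 := h5.self_of_nhds
      obtain ⟨s, hs, hst⟩ := ((h5.filter_mono nhdsWithin_le_nhds).and
        (eventually_mem_nhdsWithin (a := t2) (s := {t2}ᶜ))).exists
      have : 2 * ℓ * ((s : ℂ) - t2) = 0 := by linear_combination hs - h6
      rcases mul_eq_zero.1 this with h | h
      · exact hℓ ((mul_eq_zero.1 h).resolve_left two_ne_zero)
      · exact hst (by exact_mod_cast sub_eq_zero.1 h)
    subst hbb
    exact hb'
  have hb0 : b = 0 := by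
    have hev : ∀ᶠ s in 𝓝[>] (0 : ℝ), V s = (s * ℓ + b) ^ 2 := by
      filter_upwards [Ioo_mem_nhdsGT (ht.1.trans ht.2)] with s hs
      exact (hsub hs).self_of_nhds
    have hlim : Tendsto (fun s : ℝ => ((s : ℂ) * ℓ + b) ^ 2) (𝓝[>] 0) (𝓝 (b ^ 2)) := by
      have : Continuous fun s : ℝ => ((s : ℂ) * ℓ + b) ^ 2 := by fun_prop
      have := (this.tendsto 0).mono_left (nhdsWithin_le_nhds (s := Ioi 0))
      simpa using this
    have := tendsto_nhds_unique (h0.congr' hev) hlim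
    exact pow_eq_zero_iff two_ne_zero |>.1 this.symm
  rw [(hsub ht).self_of_nhds, hb0, add_zero]

end

/-- The linear map `(x, y) ↦ (μ⁻¹ x, μ y)`. -/
noncomputable def stretchMap (μ : ℝ) (w : ℂ) : ℂ := ⟨μ⁻¹ * w.re, μ * w.im⟩

theorem stretchMap_real_mul (μ r : ℝ) (w : ℂ) : stretchMap μ (r * w) = r * stretchMap μ w := by
  apply Complex.ext <;> simp [stretchMap] <;> ring

theorem stretchMap_neg (μ : ℝ) (w : ℂ) : stretchMap μ (-w) = -stretchMap μ w := by
  apply Complex.ext <;> simp [stretchMap]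

theorem stretchMap_mul (μ ν : ℝ) (w : ℂ) :
    stretchMap (μ * ν) w = stretchMap μ (stretchMap ν w) := by
  apply Complex.ext <;> simp [stretchMap] <;> ring

theorem stretchMap_one (w : ℂ) : stretchMap 1 w = w := by
  apply Complex.ext <;> simp [stretchMap]

theorem stretchMap_sign_mul {ε : ℂ} (hε : ε ^ 2 = 1) (μ : ℝ) (w : ℂ) :
    stretchMap μ (ε * w) = ε * stretchMap μ w := by
  rcases sq_eq_sq_iff_eq_or_eq_neg.1 (hε.trans (one_pow 2).symm) with rfl | rfl
  · simp
  · simp [stretchMap_neg]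

theorem stretchMap_sq_eq {u v : ℂ} (h : u ^ 2 = v ^ 2) (μ : ℝ) :
    stretchMap μ u ^ 2 = stretchMap μ v ^ 2 := by
  rcases sq_eq_sq_iff_eq_or_eq_neg.1 h with rfl | rfl
  · rfl
  · rw [stretchMap_neg, neg_sq]

theorem stretchMap_ne_zero {μ : ℝ} (hμ : μ ≠ 0) {w : ℂ} (hw : w ≠ 0) : stretchMap μ w ≠ 0 := by
  intro h
  apply hw
  have h1 := congrArg Complex.re h
  have h2 := congrArg Complex.im h
  simp only [stretchMap, Complex.zero_re, Complex.zero_im, mul_eq_zero, inv_eq_zero, hμ,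
    false_or] at h1 h2
  exact Complex.ext h1 h2

namespace LeafKind

/-- The factor by which `(x, y) ↦ (μ⁻¹ x, μ y)` multiplies the coordinate `cross k`. -/
noncomputable def crossFactor (μ : ℝ) : LeafKind → ℝ
  | .stable => μ
  | .unstable => μ⁻¹

theorem cross_stretchMap (k : LeafKind) (μ : ℝ) (w : ℂ) :
    k.cross (stretchMap μ w) = k.crossFactor μ * k.cross w := by
  cases k <;> simp [cross, stretchMap, crossFactor]

end LeafKind

namespace TransverseMeasuredFoliations

open Set Filter

variable {S : Type*} [TopologicalSpace S] (F : TransverseMeasuredFoliations S)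

theorem zero_mem_target (p : S) : 0 ∈ (F.chart p).target := by
  have h0 := (F.chart p).map_source (F.mem_source p)
  rwa [F.chart_self] at h0

theorem chart_symm_zero (p : S) : (F.chart p).symm 0 = p := by
  conv_lhs => rw [← F.chart_self p]
  exact (F.chart p).left_inv (F.mem_source p)

/-- The inverse of a branch of the natural coordinate in a sector at `p` with bisector
`ℝ₊ ζ`. -/
noncomputable def sector (p : S) (ζ w : ℂ) : S :=
  (F.chart p).symm (w ^ ((2 / F.prong p : ℝ) : ℂ) * ζ)

theorem two_div_prong_pos (p : S) : (0 : ℝ) < 2 / F.prong p :=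
  div_pos two_pos (Nat.cast_pos.2 (F.prong_pos p))

theorem cpow_pow_prong (p : S) (w : ℂ) : (w ^ ((2 / F.prong p : ℝ) : ℂ)) ^ F.prong p = w ^ 2 := by
  rw [← Complex.cpow_nat_mul, ← Complex.cpow_natCast w 2]
  congr 1
  have : (F.prong p : ℂ) ≠ 0 := Nat.cast_ne_zero.2 (F.prong_ne_zero p)
  push_cast
  field_simp

theorem quad_sector {p : S} {ζ w : ℂ}
    (h : w ^ ((2 / F.prong p : ℝ) : ℂ) * ζ ∈ (F.chart p).target) :
    F.quad p (F.sector p ζ w) = ζ ^ F.prong p * w ^ 2 := by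
  rw [quad, sector, (F.chart p).right_inv h, mul_pow, F.cpow_pow_prong, mul_comm]

theorem sector_zero (p : S) (ζ : ℂ) : F.sector p ζ 0 = p := by
  have h : ((2 / F.prong p : ℝ) : ℂ) ≠ 0 := by exact_mod_cast (F.two_div_prong_pos p).ne'
  rw [sector, Complex.zero_cpow h, zero_mul, F.chart_symm_zero]

theorem isoAt_sector {p : S} {ζ w : ℂ} (hζ : ζ ≠ 0) (hw : 0 < w.re)
    (h : w ^ ((2 / F.prong p : ℝ) : ℂ) * ζ ∈ (F.chart p).target) :
    F.IsoAt (ζ ^ F.prong p) (F.sector p ζ) w := by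
  have hw0 : w ≠ 0 := by rintro rfl; simp at hw
  have hc : ContinuousAt (fun v : ℂ => v ^ ((2 / F.prong p : ℝ) : ℂ) * ζ) w :=
    (continuousAt_cpow_const (Or.inl hw)).mul continuousAt_const
  refine isoAt_of_quad (pow_ne_zero _ hζ) hw0 (p := p) ?_ ((F.chart p).map_target h) ?_ ?_
  · exact ContinuousAt.comp (f := fun v : ℂ => v ^ ((2 / F.prong p : ℝ) : ℂ) * ζ)
      ((F.chart p).continuousAt_symm h) hc
  · intro he
    have h1 := F.quad_sector h
    rw [he, F.quad_self] at h1
    exact mul_ne_zero (pow_ne_zero _ hζ) (pow_ne_zero 2 hw0) h1.symm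
  · filter_upwards [hc.eventually_mem ((F.chart p).open_target.mem_nhds h)] with v hv
    exact F.quad_sector hv

theorem norm_cpow_mul (p : S) {ζ : ℂ} (hζ : ‖ζ‖ = 1) (w : ℂ) :
    ‖w ^ ((2 / F.prong p : ℝ) : ℂ) * ζ‖ = ‖w‖ ^ (2 / F.prong p : ℝ) := by
  rw [norm_mul, hζ, mul_one, Complex.norm_cpow_real]

theorem tendsto_sector_zero (p : S) {ζ : ℂ} (hζ : ‖ζ‖ = 1) :
    Tendsto (F.sector p ζ) (𝓝 0) (𝓝 p) := by
  have h1 : Tendsto (fun w : ℂ => w ^ ((2 / F.prong p : ℝ) : ℂ) * ζ) (𝓝 0) (𝓝 0) := by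
    rw [tendsto_zero_iff_norm_tendsto_zero]
    simp only [F.norm_cpow_mul p hζ]
    have := (Real.continuousAt_rpow_const 0 (2 / F.prong p : ℝ)
      (Or.inr (F.two_div_prong_pos p).le)).tendsto.comp (tendsto_norm_zero (E := ℂ))
    rwa [Real.zero_rpow (F.two_div_prong_pos p).ne'] at this
  have h2 := ((F.chart p).continuousAt_symm (F.zero_mem_target p)).tendsto.comp h1
  rwa [F.chart_symm_zero] at h2

/-- A map of the surface to itself that is given by `(x, y) ↦ ± (μ⁻¹ x, μ y)` in natural
coordinates around regular points. -/
structure IsAffine (g : S → S) (μ : ℝ) : Prop where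
  continuous : Continuous g
  injective : Function.Injective g
  prong_map : ∀ p, F.prong (g p) = F.prong p
  map_chart : ∀ p, F.prong p = 2 → ∃ ε : ℂ, ε ^ 2 = 1 ∧
    ∀ᶠ x in 𝓝 p, F.chart (g p) (g x) = ε * stretchMap μ (F.chart p x)

variable {F}

theorem IsAffine.comp {g g' : S → S} {μ μ' : ℝ} (h : F.IsAffine g μ) (h' : F.IsAffine g' μ') :
    F.IsAffine (g ∘ g') (μ * μ') := by
  refine ⟨h.continuous.comp h'.continuous, h.injective.comp h'.injective, fun p => by
    rw [Function.comp, h.prong_map, h'.prong_map], fun p hp => ?_⟩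
  obtain ⟨ε', hε', hev'⟩ := h'.map_chart p hp
  obtain ⟨ε, hε, hev⟩ := h.map_chart (g' p) (by rw [h'.prong_map, hp])
  refine ⟨ε * ε', by rw [mul_pow, hε, hε', one_mul], ?_⟩
  filter_upwards [hev', h'.continuous.continuousAt.eventually hev] with x h1 h2
  simp only [Function.comp]
  rw [h2, h1, stretchMap_sign_mul hε', stretchMap_mul]; ring

variable (F) in
theorem isAffine_id : F.IsAffine id 1 :=
  ⟨continuous_id, Function.injective_id, fun _ => rfl, fun p _ => ⟨1, one_pow 2, by simp [stretchMap_one]⟩⟩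

theorem IsAffine.iterate {g : S → S} {μ : ℝ} (h : F.IsAffine g μ) (n : ℕ) :
    F.IsAffine g^[n] (μ ^ n) := by
  induction n with
  | zero => simpa using F.isAffine_id
  | succ n ih => rw [Function.iterate_succ, pow_succ]; exact ih.comp h

theorem IsAffine.symm {g : S ≃ₜ S} {μ : ℝ} (hμ : μ ≠ 0) (h : F.IsAffine g μ) :
    F.IsAffine g.symm μ⁻¹ := by
  have hp : ∀ p, F.prong (g.symm p) = F.prong p := fun p => by
    rw [← h.prong_map, g.apply_symm_apply]
  refine ⟨g.symm.continuous, g.symm.injective, hp, fun p h2 => ?_⟩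
  obtain ⟨ε, hε, hev⟩ := h.map_chart (g.symm p) (by rw [hp, h2])
  refine ⟨ε, hε, ?_⟩
  filter_upwards [(g.symm.continuous.tendsto p).eventually hev] with x hx
  rw [g.apply_symm_apply, g.apply_symm_apply] at hx
  rw [hx, stretchMap_sign_mul hε, ← mul_assoc, ← pow_two, hε, one_mul, ← stretchMap_mul,
    inv_mul_cancel₀ hμ, stretchMap_one]

theorem LineAt.map {g : S → S} {μ : ℝ} (hg : F.IsAffine g μ) {v : ℂ} {γ : ℝ → S} {t : ℝ}
    (h : F.LineAt (v ^ 2) γ t) : F.LineAt (stretchMap μ v ^ 2) (g ∘ γ) t := by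
  obtain ⟨hc, h2, u, hu, hev⟩ := h
  obtain ⟨ε, hε, hgev⟩ := hg.map_chart _ h2
  refine ⟨hg.continuous.continuousAt.comp hc, by rw [Function.comp, hg.prong_map, h2],
    ε * stretchMap μ u, by rw [mul_pow, hε, one_mul, stretchMap_sq_eq hu], ?_⟩
  filter_upwards [hev, hc.eventually hgev] with s h1 h3
  simp only [Function.comp]
  rw [h3, h1, stretchMap_real_mul]; ring

/-- Around every point, singular or not, an affine map multiplies the squared transverse
coordinates by the squares of its factors. -/
theorem IsAffine.hgt_map {g : S → S} {μ : ℝ} (hμ : μ ≠ 0) (hg : F.IsAffine g μ) (p : S) :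
    ∀ᶠ x in 𝓝 p, ∀ k : LeafKind,
      k.hgt (F.quad (g p) (g x)) = k.crossFactor μ ^ 2 * k.hgt (F.quad p x) := by
  have hcg : ContinuousAt (fun z => g ((F.chart p).symm z)) 0 :=
    hg.continuous.continuousAt.comp ((F.chart p).continuousAt_symm (F.zero_mem_target p))
  have hn : (0 : ℝ) < F.prong p := Nat.cast_pos.2 (F.prong_pos p)
  obtain ⟨ρ, hρ, hball⟩ := Metric.eventually_nhds_iff.1
    (((F.chart p).open_target.eventually_mem (F.zero_mem_target p)).and
      (hcg.eventually_mem ((F.chart (g p)).open_source.mem_nhds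
        (by rw [F.chart_symm_zero]; exact F.mem_source _))))
  have hch : Tendsto (fun x => ‖F.chart p x‖) (𝓝 p) (𝓝 0) := by
    have := ((F.chart p).continuousAt (F.mem_source _)).norm.tendsto
    rwa [F.chart_self, norm_zero] at this
  filter_upwards [hch.eventually_lt_const hρ,
    (F.chart p).open_source.eventually_mem (F.mem_source p)] with x hx hxs k
  by_cases hxp : x = p
  · subst hxp
    rw [F.quad_self, F.quad_self]
    simp [LeafKind.hgt]
  have hz : F.chart p x ≠ 0 := fun h => hxp (F.eq_of_chart_eq_zero hxs h)
  have hz' : 0 < ‖F.chart p x‖ := norm_pos_iff.2 hz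
  obtain ⟨ζ, hζ⟩ : ∃ ζ : ℂ, ζ = F.chart p x / ‖F.chart p x‖ := ⟨_, rfl⟩
  have hζ1 : ‖ζ‖ = 1 := by
    rw [hζ, norm_div, Complex.norm_real, norm_norm, div_self hz'.ne']
  have hζ0 : ζ ≠ 0 := by rintro rfl; simp at hζ1
  obtain ⟨η, hη⟩ : ∃ η : ℂ, η ^ 2 = ζ ^ F.prong p := IsAlgClosed.exists_pow_nat_eq _ two_pos
  have hη0 : η ≠ 0 := by
    rintro rfl
    exact pow_ne_zero (F.prong p) hζ0 (by rw [← hη]; simp)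
  -- along the radial line from `p` to `x`, `g` is a line in the natural coordinate at `g p`
  have hrad : ∀ t ∈ Ioo (0 : ℝ) (ρ ^ (F.prong p / 2 : ℝ)),
      ‖(t : ℂ) ^ ((2 / F.prong p : ℝ) : ℂ) * ζ‖ < ρ := by
    intro t ht
    rw [F.norm_cpow_mul p hζ1, Complex.norm_real, Real.norm_of_nonneg ht.1.le]
    refine (Real.rpow_lt_rpow ht.1.le ht.2 (F.two_div_prong_pos p)).trans_eq ?_
    rw [← Real.rpow_mul hρ.le]
    have : (F.prong p / 2 : ℝ) * (2 / F.prong p) = 1 := by field_simp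
    rw [this, Real.rpow_one]
  have hV := eq_sq_of_locally_sq_affine (V := fun s => F.quad (g p) (g (F.sector p ζ s)))
    (stretchMap_ne_zero hμ hη0) (T := ρ ^ (F.prong p / 2 : ℝ)) ?_ ?_
  · have ht0 : ‖F.chart p x‖ ^ (F.prong p / 2 : ℝ) ∈ Ioo (0 : ℝ) (ρ ^ (F.prong p / 2 : ℝ)) :=
      ⟨Real.rpow_pos_of_pos hz' _, Real.rpow_lt_rpow hz'.le hx (by positivity)⟩
    generalize htt : ‖F.chart p x‖ ^ (F.prong p / 2 : ℝ) = t at ht0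
    have hxt : F.sector p ζ t = x := by
      have h1 : t ^ (2 / F.prong p : ℝ) = ‖F.chart p x‖ := by
        rw [← htt, ← Real.rpow_mul hz'.le]
        have : (F.prong p / 2 : ℝ) * (2 / F.prong p) = 1 := by field_simp
        rw [this, Real.rpow_one]
      rw [sector, ← Complex.ofReal_cpow ht0.1.le, h1, hζ, mul_div_cancel₀ _
        (Complex.ofReal_ne_zero.2 hz'.ne'), (F.chart p).left_inv hxs]
    have h1 := hV t ht0
    simp only [hxt] at h1
    have h2 := F.quad_sector (p := p) (ζ := ζ) (w := t)
      (hball (by rw [dist_zero_right]; exact hrad t ht0)).1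
    rw [hxt, ← hη, ← mul_pow] at h2
    rw [h1, h2, k.hgt_sq, k.hgt_sq, ← stretchMap_real_mul, k.cross_stretchMap, mul_comm η]
    ring
  · intro t ht
    have hb := hball (by rw [dist_zero_right]; exact hrad t ht)
    have hl : F.LineAt (η ^ 2) (fun s : ℝ => F.sector p ζ s) t := by
      have h1 : F.IsoAt (ζ ^ F.prong p) (F.sector p ζ) (0 + (t : ℂ) * 1) := by
        rw [zero_add, mul_one]
        exact F.isoAt_sector hζ0 (by simpa using ht.1) hb.1
      have h2 := h1.lineAt
      simpa [hη] using h2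
    have hl2 := hl.map hg
    have hne : g (F.sector p ζ t) ≠ g p := by
      intro h
      have h1 := F.quad_sector (p := p) (ζ := ζ) (w := t) hb.1
      rw [hg.injective h, F.quad_self] at h1
      exact mul_ne_zero (pow_ne_zero _ hζ0) (pow_ne_zero 2 (Complex.ofReal_ne_zero.2 ht.1.ne'))
        h1.symm
    obtain ⟨-, a, ha⟩ := F.compat (g p) (g (F.sector p ζ t)) hb.2 hne
    obtain ⟨u, hu, hev⟩ := hl2.2.2
    have key : ∀ᶠ s : ℝ in 𝓝 t, F.quad (g p) (g (F.sector p ζ s)) =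
        (((s - t : ℝ) : ℂ) * u + a) ^ 2 := by
      filter_upwards [hev, hl2.1.eventually ha] with s h1 h3
      simp only [Function.comp] at h1 h3
      rw [quad, ← h3, h1]
    rcases sq_eq_sq_iff_eq_or_eq_neg.1 hu with h | h
    · refine ⟨-t * u + a, ?_⟩
      filter_upwards [key] with s hs
      rw [hs, ← h]; push_cast; ring
    · refine ⟨t * u - a, ?_⟩
      filter_upwards [key] with s hs
      have : stretchMap μ η = -u := by rw [h, neg_neg]
      rw [hs, this]; push_cast; ring
  · have h1 : Tendsto (fun s : ℝ => F.sector p ζ s) (𝓝[>] 0) (𝓝 p) :=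
      (F.tendsto_sector_zero p hζ1).comp
        ((Complex.continuous_ofReal.tendsto' 0 0 rfl).mono_left nhdsWithin_le_nhds)
    have h2 := (F.continuousAt_quad (F.mem_source (g p))).tendsto.comp
      ((hg.continuous.tendsto p).comp h1)
    rwa [F.quad_self] at h2

end TransverseMeasuredFoliations

/-! ### Separatrices as rays -/

open Set Filter

/-- Transverse measured foliations with a homeomorphism stretching them, together with a nonempty
finite invariant set `pts` of marked points that contains all prong singularities. The set of
marked points of a pseudo-Anosov homeomorphism is `sing`; for a comparison of two conjugate
homeomorphisms a larger set is needed. -/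
structure Marked {S : Type*} [TopologicalSpace S] (f : S ≃ₜ S) extends
    TransverseMeasuredFoliations S where
  stretch : ℝ
  one_lt_stretch : 1 < stretch
  prong_map : ∀ p, prong (f p) = prong p
  map_chart : ∀ p, prong p = 2 → ∃ ε : ℝ, (ε = 1 ∨ ε = -1) ∧
    ∀ᶠ x in 𝓝 p, chart (f p) (f x) =
      ⟨ε * (stretch⁻¹ * (chart p x).re), ε * (stretch * (chart p x).im)⟩
  pts : Set S
  pts_finite : pts.Finite
  pts_nonempty : pts.Nonempty
  pts_invariant : f '' pts = pts
  mem_pts : ∀ p, prong p ≠ 2 → p ∈ pts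

namespace Marked

variable {S : Type*} [TopologicalSpace S] {f : S ≃ₜ S} (M : Marked f)

theorem stretch_pos : 0 < M.stretch := one_pos.trans M.one_lt_stretch

theorem stretch_ne_zero : M.stretch ≠ 0 := M.stretch_pos.ne'

/-- The map that contracts the leaves of the given kind: `f` or its inverse. -/
def contr (_M : Marked f) : LeafKind → S ≃ₜ S
  | .stable => f
  | .unstable => f.symm

theorem contr_other (k : LeafKind) : M.contr k.other = (M.contr k).symm := by
  cases k <;> rfl

theorem isAffine : M.IsAffine f M.stretch := by
  refine ⟨f.continuous, f.injective, M.prong_map, fun p hp => ?_⟩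
  obtain ⟨ε, hε, hev⟩ := M.map_chart p hp
  refine ⟨ε, by rcases hε with rfl | rfl <;> simp, ?_⟩
  filter_upwards [hev] with x hx
  rw [hx]
  apply Complex.ext <;> simp [stretchMap]

/-- The factor by which `contr k` multiplies the horizontal natural coordinate is the inverse of
this number. -/
noncomputable def rate : LeafKind → ℝ
  | .stable => M.stretch
  | .unstable => M.stretch⁻¹

theorem rate_ne_zero (k : LeafKind) : M.rate k ≠ 0 := by
  cases k
  · exact M.stretch_ne_zero
  · exact inv_ne_zero M.stretch_ne_zero

theorem isAffine_contr (k : LeafKind) : M.IsAffine (M.contr k) (M.rate k) := by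
  cases k
  · exact M.isAffine
  · exact M.isAffine.symm M.stretch_ne_zero

theorem stretchMap_rate_dir (k : LeafKind) :
    stretchMap (M.rate k) k.dir = (M.stretch⁻¹ : ℝ) * k.dir := by
  cases k <;> apply Complex.ext <;> simp [stretchMap, rate, LeafKind.dir]

theorem stretchMap_rate_other_dir (k : LeafKind) :
    stretchMap (M.rate k.other) k.dir = (M.stretch : ℝ) * k.dir := by
  cases k <;> apply Complex.ext <;> simp [stretchMap, rate, LeafKind.dir, LeafKind.other]

theorem hgt_contr (k : LeafKind) (p : S) : ∀ᶠ x in 𝓝 p,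
    k.hgt (M.quad (M.contr k p) (M.contr k x)) = M.stretch ^ 2 * k.hgt (M.quad p x) ∧
    k.other.hgt (M.quad (M.contr k p) (M.contr k x)) =
      (M.stretch⁻¹) ^ 2 * k.other.hgt (M.quad p x) := by
  filter_upwards [(M.isAffine_contr k).hgt_map (M.rate_ne_zero k) p] with x hx
  rw [hx, hx]
  cases k <;> simp [LeafKind.crossFactor, rate, LeafKind.other]

variable {M}

/-- `contr k` maps unit speed leaves of kind `k` to such leaves, after a change of speed. -/
theorem _root_.TransverseMeasuredFoliations.LineAt.contr {k : LeafKind} {γ : ℝ → S} {t : ℝ}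
    (h : M.LineAt k.sgn γ t) :
    M.LineAt k.sgn (fun s => M.contr k (γ (M.stretch * s))) (t / M.stretch) := by
  rw [← k.dir_sq] at h
  have h1 := h.map (M.isAffine_contr k)
  rw [M.stretchMap_rate_dir] at h1
  have h2 : M.LineAt (((M.stretch⁻¹ : ℝ) * k.dir) ^ 2) (M.contr k ∘ γ)
      (M.stretch * (t / M.stretch) + 0) := by
    rwa [add_zero, mul_div_cancel₀ _ M.stretch_ne_zero]
  have h3 := h2.comp_affine
  have e : ((M.stretch⁻¹ : ℝ) * k.dir) ^ 2 * (M.stretch : ℂ) ^ 2 = k.sgn := by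
    have : (M.stretch : ℂ) ≠ 0 := Complex.ofReal_ne_zero.2 M.stretch_ne_zero
    rw [← k.dir_sq]; push_cast; field_simp
  rw [e] at h3
  simpa using h3

theorem _root_.TransverseMeasuredFoliations.LineAt.contr_symm {k : LeafKind} {γ : ℝ → S} {t : ℝ}
    (h : M.LineAt k.sgn γ t) :
    M.LineAt k.sgn (fun s => (M.contr k).symm (γ (s / M.stretch))) (M.stretch * t) := by
  rw [← k.dir_sq] at h
  have h1 := h.map (M.isAffine_contr k.other)
  rw [M.stretchMap_rate_other_dir, M.contr_other] at h1
  have h2 : M.LineAt (((M.stretch : ℝ) * k.dir) ^ 2) ((M.contr k).symm ∘ γ)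
      (M.stretch⁻¹ * (M.stretch * t) + 0) := by
    rwa [add_zero, inv_mul_cancel_left₀ M.stretch_ne_zero]
  have h3 := h2.comp_affine
  have e : ((M.stretch : ℝ) * k.dir) ^ 2 * ((M.stretch⁻¹ : ℝ) : ℂ) ^ 2 = k.sgn := by
    have : (M.stretch : ℂ) ≠ 0 := Complex.ofReal_ne_zero.2 M.stretch_ne_zero
    rw [← k.dir_sq]; push_cast; field_simp
  rw [e] at h3
  simpa [div_eq_inv_mul] using h3

variable (M)

theorem contr_mem_pts {k : LeafKind} {p : S} : M.contr k p ∈ M.pts ↔ p ∈ M.pts := by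
  have h1 : ∀ p, f p ∈ M.pts ↔ p ∈ M.pts := fun p => by
    constructor
    · intro h
      rw [← M.pts_invariant] at h
      obtain ⟨q, hq, he⟩ := h
      rwa [← f.injective he]
    · intro h
      rw [← M.pts_invariant]
      exact ⟨p, h, rfl⟩
  cases k
  · exact h1 p
  · rw [← h1 (M.contr .unstable p)]
    change f (f.symm p) ∈ M.pts ↔ _
    rw [f.apply_symm_apply]

theorem prong_eq_two {x : S} (hx : x ∉ M.pts) : M.prong x = 2 := by
  by_contra h
  exact hx (M.mem_pts x h)

/-- The disc of radius `R` around `p`, with respect to the natural coordinate. -/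
def disc (R : ℝ) (p : S) : Set S :=
  {x | x ∈ (M.chart p).source ∧ ‖M.chart p x‖ < R ^ (2 / M.prong p : ℝ)}

/-- The discs of radius `R` around the marked points are disjoint, and `f` and its inverse act
on them in the standard way. -/
structure IsRadius (R : ℝ) : Prop where
  pos : 0 < R
  mem_target : ∀ p ∈ M.pts, ∀ z : ℂ, ‖z‖ < R ^ (2 / M.prong p : ℝ) → z ∈ (M.chart p).target
  disjoint : ∀ p ∈ M.pts, ∀ q ∈ M.pts, ∀ x ∈ M.disc R p, x ∈ M.disc R q → p = q
  contr_mem : ∀ p ∈ M.pts, ∀ x ∈ M.disc R p, ∀ k,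
    M.contr k x ∈ (M.chart (M.contr k p)).source
  hgt_contr : ∀ p ∈ M.pts, ∀ x ∈ M.disc R p, ∀ k : LeafKind,
    k.hgt (M.quad (M.contr k p) (M.contr k x)) = M.stretch ^ 2 * k.hgt (M.quad p x) ∧
    k.other.hgt (M.quad (M.contr k p) (M.contr k x)) =
      (M.stretch⁻¹) ^ 2 * k.other.hgt (M.quad p x)

/-- Standard discs exist, since there are finitely many marked points. -/
theorem exists_isRadius [T2Space S] : ∃ R, M.IsRadius R := by
  obtain ⟨U, hU, hdis⟩ := M.pts_finite.t2_separation
  -- every condition holds for all small radii, one marked point at a time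
  have key : ∀ p ∈ M.pts, ∀ᶠ R : ℝ in 𝓝[>] 0,
      (∀ z : ℂ, ‖z‖ < R ^ (2 / M.prong p : ℝ) → z ∈ (M.chart p).target) ∧
      ∀ x ∈ M.disc R p, x ∈ U p ∧ ∀ k : LeafKind,
        M.contr k x ∈ (M.chart (M.contr k p)).source ∧
        (k.hgt (M.quad (M.contr k p) (M.contr k x)) = M.stretch ^ 2 * k.hgt (M.quad p x) ∧
        k.other.hgt (M.quad (M.contr k p) (M.contr k x)) =
          (M.stretch⁻¹) ^ 2 * k.other.hgt (M.quad p x)) := by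
    intro p hp
    have h1 : ∀ k : LeafKind, ∀ᶠ x in 𝓝 p, M.contr k x ∈ (M.chart (M.contr k p)).source ∧
        (k.hgt (M.quad (M.contr k p) (M.contr k x)) = M.stretch ^ 2 * k.hgt (M.quad p x) ∧
        k.other.hgt (M.quad (M.contr k p) (M.contr k x)) =
          (M.stretch⁻¹) ^ 2 * k.other.hgt (M.quad p x)) := fun k =>
      ((M.contr k).continuous.continuousAt.eventually_mem
        ((M.chart _).open_source.mem_nhds (M.mem_source _))).and (M.hgt_contr k p)
    have h2 : ∀ᶠ x in 𝓝 p, x ∈ U p ∧ ∀ k : LeafKind,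
        M.contr k x ∈ (M.chart (M.contr k p)).source ∧
        (k.hgt (M.quad (M.contr k p) (M.contr k x)) = M.stretch ^ 2 * k.hgt (M.quad p x) ∧
        k.other.hgt (M.quad (M.contr k p) (M.contr k x)) =
          (M.stretch⁻¹) ^ 2 * k.other.hgt (M.quad p x)) := by
      filter_upwards [(hU p).2.mem_nhds (hU p).1, h1 .stable, h1 .unstable] with x hx hs hu
      exact ⟨hx, fun k => by cases k; exacts [hs, hu]⟩
    have h3 := ((M.chart p).continuousAt_symm (M.zero_mem_target p)).tendsto
    rw [M.chart_symm_zero] at h3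
    obtain ⟨ρ, hρ, hball⟩ := Metric.eventually_nhds_iff.1
      (((M.chart p).open_target.eventually_mem (M.zero_mem_target p)).and (h3.eventually h2))
    have h4 : Tendsto (fun R : ℝ => R ^ (2 / M.prong p : ℝ)) (𝓝[>] 0) (𝓝 0) := by
      have := (Real.continuousAt_rpow_const 0 (2 / M.prong p : ℝ)
        (Or.inr (M.two_div_prong_pos p).le)).tendsto.mono_left
          (nhdsWithin_le_nhds (s := Ioi (0 : ℝ)))
      rwa [Real.zero_rpow (M.two_div_prong_pos p).ne'] at this
    filter_upwards [h4.eventually_lt_const hρ] with R hR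
    refine ⟨fun z hz => (hball (by rw [dist_zero_right]; exact hz.trans hR)).1,
      fun x hx => ?_⟩
    have := (hball (y := M.chart p x) (by rw [dist_zero_right]; exact hx.2.trans hR)).2
    rwa [(M.chart p).left_inv hx.1] at this
  obtain ⟨R, hR, hpos⟩ := (((eventually_all_finite M.pts_finite).2 key).and
    self_mem_nhdsWithin).exists
  refine ⟨R, hpos, fun p hp => (hR p hp).1, fun p hp q hq x hxp hxq => ?_,
    fun p hp x hx k => (((hR p hp).2 x hx).2 k).1, fun p hp x hx k => (((hR p hp).2 x hx).2 k).2⟩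
  by_contra hne
  exact (hdis hp hq hne).le_bot ⟨((hR p hp).2 x hxp).1, ((hR q hq).2 x hxq).1⟩

/-- A common radius of standard discs around the marked points. -/
noncomputable def radius [T2Space S] : ℝ := M.exists_isRadius.choose

theorem isRadius [T2Space S] : M.IsRadius M.radius := M.exists_isRadius.choose_spec

theorem disc_mem_nhds {R : ℝ} (hR : 0 < R) (p : S) : M.disc R p ∈ 𝓝 p := by
  have hch : Tendsto (fun x => ‖M.chart p x‖) (𝓝 p) (𝓝 0) := by
    have := ((M.chart p).continuousAt (M.mem_source _)).norm.tendsto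
    rwa [M.chart_self, norm_zero] at this
  filter_upwards [hch.eventually_lt_const (Real.rpow_pos_of_pos hR _),
    (M.chart p).open_source.mem_nhds (M.mem_source p)] with x h1 h2
  exact ⟨h2, h1⟩

/-- The prongs of kind `k` at the marked points: pairs of a marked point `p` and a direction `ζ`
of a prong in `chart p`. -/
def Prong (k : LeafKind) : Type _ := {i : S × ℂ // i.1 ∈ M.pts ∧ i.2 ^ M.prong i.1 = k.sgn}

variable {M} {k : LeafKind}

/-- The marked point at which a prong is based. -/
def Prong.base (i : M.Prong k) : S := i.1.1

/-- The direction of a prong in the chart at its base point. -/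
def Prong.angle (i : M.Prong k) : ℂ := i.1.2

theorem Prong.base_mem (i : M.Prong k) : i.base ∈ M.pts := i.2.1

theorem Prong.angle_pow (i : M.Prong k) : i.angle ^ M.prong i.base = k.sgn := i.2.2

theorem Prong.ext {i j : M.Prong k} (h1 : i.base = j.base) (h2 : i.angle = j.angle) : i = j :=
  Subtype.ext (Prod.ext h1 h2)

theorem Prong.norm_angle (i : M.Prong k) : ‖i.angle‖ = 1 := by
  have h := congrArg norm i.angle_pow
  have h1 : ‖(k.sgn : ℂ)‖ = 1 := by cases k <;> simp [LeafKind.sgn]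
  rw [norm_pow, h1] at h
  exact (pow_eq_one_iff_of_nonneg (norm_nonneg _) (M.prong_ne_zero _)).1 h

theorem Prong.angle_ne_zero (i : M.Prong k) : i.angle ≠ 0 := by
  intro h
  have := i.norm_angle
  simp [h] at this

theorem finite_pow_eq {n : ℕ} (hn : n ≠ 0) (c : ℂ) : {ζ : ℂ | ζ ^ n = c}.Finite := by
  refine (Polynomial.nthRootsFinset n c).finite_toSet.subset fun ζ hζ => ?_
  simpa [Polynomial.mem_nthRootsFinset (Nat.pos_of_ne_zero hn)] using hζ

instance : Finite (M.Prong k) := by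
  have h : {i : S × ℂ | i.1 ∈ M.pts ∧ i.2 ^ M.prong i.1 = k.sgn}.Finite := by
    have : {i : S × ℂ | i.1 ∈ M.pts ∧ i.2 ^ M.prong i.1 = k.sgn} ⊆
        ⋃ p ∈ M.pts, (fun ζ => (p, ζ)) '' {ζ : ℂ | ζ ^ M.prong p = k.sgn} := by
      rintro ⟨p, ζ⟩ ⟨hp, hζ⟩
      simp only [mem_iUnion]
      exact ⟨p, hp, ζ, hζ, rfl⟩
    exact (M.pts_finite.biUnion fun p _ =>
      (finite_pow_eq (M.prong_ne_zero p) _).image _).subset this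
  exact h.to_subtype

theorem exists_prong (k : LeafKind) {p : S} (hp : p ∈ M.pts) : ∃ i : M.Prong k, i.base = p := by
  obtain ⟨ζ, hζ⟩ : ∃ ζ : ℂ, ζ ^ M.prong p = k.sgn :=
    IsAlgClosed.exists_pow_nat_eq _ (Nat.pos_of_ne_zero (M.prong_ne_zero p))
  exact ⟨⟨(p, ζ), hp, hζ⟩, rfl⟩

instance : Nonempty (M.Prong k) := by
  obtain ⟨p, hp⟩ := M.pts_nonempty
  exact ⟨(exists_prong k hp).choose⟩

/-- The initial part of a separatrix, parametrized by arc length. -/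
noncomputable def loc (i : M.Prong k) (t : ℝ) : S := M.sector i.base i.angle t

theorem norm_loc_arg (i : M.Prong k) {t : ℝ} (ht : 0 ≤ t) :
    ‖(t : ℂ) ^ ((2 / M.prong i.base : ℝ) : ℂ) * i.angle‖ = t ^ (2 / M.prong i.base : ℝ) := by
  rw [M.norm_cpow_mul _ i.norm_angle, Complex.norm_real, Real.norm_of_nonneg ht]

theorem loc_zero (i : M.Prong k) : loc i 0 = i.base := by
  rw [loc, Complex.ofReal_zero, M.sector_zero]

variable (M) in
theorem exists_div_pow_lt (t : ℝ) {r : ℝ} (hr : 0 < r) : ∃ N : ℕ, t / M.stretch ^ N < r := by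
  obtain ⟨N, hN⟩ := pow_unbounded_of_one_lt (t / r) M.one_lt_stretch
  refine ⟨N, ?_⟩
  rw [div_lt_iff₀ (pow_pos M.stretch_pos N)]
  rw [div_lt_iff₀ hr] at hN
  linarith

variable [T2Space S]

theorem loc_arg_mem (i : M.Prong k) {t : ℝ} (h0 : 0 ≤ t) (ht : t < M.radius) :
    (t : ℂ) ^ ((2 / M.prong i.base : ℝ) : ℂ) * i.angle ∈ (M.chart i.base).target := by
  apply M.isRadius.mem_target _ i.base_mem
  rw [norm_loc_arg i h0]
  exact Real.rpow_lt_rpow h0 ht (M.two_div_prong_pos _)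

theorem chart_loc (i : M.Prong k) {t : ℝ} (h0 : 0 ≤ t) (ht : t < M.radius) :
    M.chart i.base (loc i t) = ((t ^ (2 / M.prong i.base : ℝ) : ℝ) : ℂ) * i.angle := by
  rw [loc, TransverseMeasuredFoliations.sector, (M.chart _).right_inv (loc_arg_mem i h0 ht),
    Complex.ofReal_cpow h0]

theorem loc_mem_disc (i : M.Prong k) {t : ℝ} (h0 : 0 ≤ t) (ht : t < M.radius) :
    loc i t ∈ M.disc M.radius i.base := by
  refine ⟨(M.chart _).map_target (loc_arg_mem i h0 ht), ?_⟩
  rw [chart_loc i h0 ht, norm_mul, i.norm_angle, mul_one, Complex.norm_real,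
    Real.norm_of_nonneg (Real.rpow_nonneg h0 _)]
  exact Real.rpow_lt_rpow h0 ht (M.two_div_prong_pos _)

theorem quad_loc (i : M.Prong k) {t : ℝ} (h0 : 0 ≤ t) (ht : t < M.radius) :
    M.quad i.base (loc i t) = k.sgn * ((t ^ 2 : ℝ) : ℂ) := by
  rw [loc, M.quad_sector (loc_arg_mem i h0 ht), i.angle_pow]; push_cast; rfl

theorem loc_mem_localLeaf (i : M.Prong k) {t : ℝ} (h0 : 0 ≤ t) (ht : t < M.radius) :
    loc i t ∈ M.localLeaf k i.base := by
  rw [M.mem_localLeaf_iff, quad_loc i h0 ht]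
  exact ⟨(loc_mem_disc i h0 ht).1, k.hgt_sgn_mul (sq_nonneg t)⟩

theorem lineAt_loc (i : M.Prong k) {t : ℝ} (h0 : 0 < t) (ht : t < M.radius) :
    M.LineAt k.sgn (loc i) t := by
  have h1 : M.IsoAt (i.angle ^ M.prong i.base) (M.sector i.base i.angle) (0 + (t : ℂ) * 1) := by
    rw [zero_add, mul_one]
    exact M.isoAt_sector i.angle_ne_zero (by simpa using h0) (loc_arg_mem i h0.le ht)
  have h2 := h1.lineAt
  rw [i.angle_pow] at h2
  have e : (fun s : ℝ => M.sector i.base i.angle (0 + (s : ℂ) * 1)) = loc i := by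
    ext s; rw [zero_add, mul_one]; rfl
  rwa [e, one_pow, mul_one] at h2

theorem loc_inj {i j : M.Prong k} {s t : ℝ} (hs : 0 ≤ s) (hs' : s < M.radius) (ht : 0 < t)
    (ht' : t < M.radius) (h : loc i s = loc j t) : i = j ∧ s = t := by
  have hb : i.base = j.base := M.isRadius.disjoint _ i.base_mem _ j.base_mem _
    (loc_mem_disc i hs hs') (h ▸ loc_mem_disc j ht.le ht')
  have hq := quad_loc i hs hs'
  rw [h, hb, quad_loc j ht.le ht'] at hq
  have h2 : t ^ 2 = s ^ 2 := by exact_mod_cast mul_left_cancel₀ k.sgn_ne_zero hq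
  have hst : t = s := (sq_eq_sq₀ ht.le hs).1 h2
  subst hst
  have hc := chart_loc i hs hs'
  rw [h, hb, chart_loc j ht.le ht'] at hc
  have : ((t ^ (2 / M.prong j.base : ℝ) : ℝ) : ℂ) ≠ 0 :=
    Complex.ofReal_ne_zero.2 (Real.rpow_pos_of_pos ht _).ne'
  exact ⟨Prong.ext hb (mul_left_cancel₀ this hc).symm, rfl⟩

/-- Around a marked point, the local leaf is the union of the initial parts of separatrices. -/
theorem exists_eq_loc {p x : S} (hp : p ∈ M.pts) (hx : x ∈ M.disc M.radius p)
    (h : k.hgt (M.quad p x) = 0) :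
    ∃ i : M.Prong k, i.base = p ∧ ∃ t, 0 ≤ t ∧ t < M.radius ∧ x = loc i t ∧
      t ^ 2 = ‖M.quad p x‖ ∧ (x ≠ p → i.angle = M.chart p x / ‖M.chart p x‖) := by
  by_cases hxp : x = p
  · subst hxp
    obtain ⟨i, hi⟩ := exists_prong k hp
    refine ⟨i, hi, 0, le_rfl, M.isRadius.pos, by rw [loc_zero, hi], by simp [M.quad_self],
      fun h => absurd rfl h⟩
  have hz : M.chart p x ≠ 0 := fun h => hxp (M.eq_of_chart_eq_zero hx.1 h)
  have hz' : 0 < ‖M.chart p x‖ := norm_pos_iff.2 hz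
  have hzc : (‖M.chart p x‖ : ℂ) ≠ 0 := Complex.ofReal_ne_zero.2 hz'.ne'
  have hq : ‖M.quad p x‖ = ‖M.chart p x‖ ^ M.prong p := norm_pow _ _
  have hn : (0 : ℝ) < M.prong p := Nat.cast_pos.2 (M.prong_pos p)
  refine ⟨⟨(p, M.chart p x / ‖M.chart p x‖), hp, ?_⟩, rfl,
    ‖M.chart p x‖ ^ (M.prong p / 2 : ℝ), by positivity, ?_, ?_, ?_, fun _ => rfl⟩
  · simp only
    rw [div_pow, div_eq_iff (pow_ne_zero _ hzc)]
    rw [LeafKind.hgt_eq_zero_iff, hq] at h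
    rw [← Complex.ofReal_pow]
    exact h
  · have := Real.rpow_lt_rpow (norm_nonneg _) hx.2 (z := (M.prong p / 2 : ℝ)) (by positivity)
    rw [← Real.rpow_mul M.isRadius.pos.le] at this
    have e : (2 / M.prong p : ℝ) * (M.prong p / 2) = 1 := by field_simp
    rwa [e, Real.rpow_one] at this
  · change x = (M.chart p).symm _
    change x = (M.chart p).symm (_ ^ ((2 / M.prong p : ℝ) : ℂ) * (M.chart p x / ‖M.chart p x‖))
    rw [← Complex.ofReal_cpow (by positivity), ← Real.rpow_mul hz'.le]
    have e : (M.prong p / 2 : ℝ) * (2 / M.prong p) = 1 := by field_simp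
    rw [e, Real.rpow_one, mul_div_cancel₀ _ hzc, (M.chart p).left_inv hx.1]
  · rw [hq, ← Real.rpow_natCast, ← Real.rpow_mul hz'.le, ← Real.rpow_natCast]
    congr 1
    push_cast; field_simp

/-- The initial part of a separatrix is mapped by `contr k` into the initial part of a
separatrix. -/
theorem exists_step (i : M.Prong k) : ∃ j : M.Prong k, j.base = M.contr k i.base ∧
    ∀ t, 0 ≤ t → t < M.radius → M.contr k (loc i t) = loc j (t / M.stretch) := by
  have hq : M.contr k i.base ∈ M.pts := M.contr_mem_pts.2 i.base_mem
  have hR := M.isRadius.pos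
  have hsrc : ∀ t, 0 ≤ t → t < M.radius →
      M.contr k (loc i t) ∈ (M.chart (M.contr k i.base)).source := fun t h0 ht =>
    M.isRadius.contr_mem _ i.base_mem _ (loc_mem_disc i h0 ht) k
  -- the image of the prong lies on a prong, at distance `t / λ` from its origin
  have h1 : ∀ t, 0 ≤ t → t < M.radius →
      k.hgt (M.quad (M.contr k i.base) (M.contr k (loc i t))) = 0 ∧
      ‖M.quad (M.contr k i.base) (M.contr k (loc i t))‖ = (t / M.stretch) ^ 2 := by
    intro t h0 ht
    obtain ⟨h2, h3⟩ := M.isRadius.hgt_contr _ i.base_mem _ (loc_mem_disc i h0 ht) k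
    rw [quad_loc i h0 ht] at h2 h3
    rw [k.hgt_sgn_mul (sq_nonneg t), mul_zero] at h2
    rw [k.hgt_other_sgn_mul (sq_nonneg t)] at h3
    refine ⟨h2, ?_⟩
    rw [← k.hgt_add_hgt, h2, h3]
    ring
  have h4 : ∀ t, 0 ≤ t → t < M.radius →
      M.contr k (loc i t) ∈ M.disc M.radius (M.contr k i.base) := by
    intro t h0 ht
    refine ⟨hsrc t h0 ht, ?_⟩
    have h5 := (h1 t h0 ht).2
    have hn : (0 : ℝ) < M.prong (M.contr k i.base) := Nat.cast_pos.2 (M.prong_pos _)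
    rw [TransverseMeasuredFoliations.quad, norm_pow] at h5
    have h6 : t / M.stretch < M.radius :=
      (div_le_self h0 M.one_lt_stretch.le).trans_lt ht
    rw [← Real.rpow_natCast] at h5
    have h7 : ‖M.chart (M.contr k i.base) (M.contr k (loc i t))‖ =
        (t / M.stretch) ^ (2 / M.prong (M.contr k i.base) : ℝ) := by
      have h8 := congrArg (fun r : ℝ => r ^ (1 / M.prong (M.contr k i.base) : ℝ)) h5
      rw [← Real.rpow_natCast, ← Real.rpow_mul (norm_nonneg _),
        ← Real.rpow_mul (div_nonneg h0 M.stretch_pos.le)] at h8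
      have e : (M.prong (M.contr k i.base) : ℝ) * (1 / M.prong (M.contr k i.base)) = 1 := by
        field_simp
      rw [e, Real.rpow_one] at h8
      rw [h8]; congr 1; push_cast; ring
    rw [h7]
    exact Real.rpow_lt_rpow (div_nonneg h0 M.stretch_pos.le) h6 (M.two_div_prong_pos _)
  -- the direction of the image is a continuous function with finitely many values
  have hdir : ∀ t ∈ Ioo 0 M.radius, ∃ j : M.Prong k, j.base = M.contr k i.base ∧
      M.contr k (loc i t) = loc j (t / M.stretch) ∧
      j.angle = M.chart (M.contr k i.base) (M.contr k (loc i t)) /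
        ‖M.chart (M.contr k i.base) (M.contr k (loc i t))‖ := by
    intro t ht
    obtain ⟨j, hj, s, hs0, hs, hx, hs2, ha⟩ :=
      exists_eq_loc hq (h4 t ht.1.le ht.2) (h1 t ht.1.le ht.2).1
    rw [(h1 t ht.1.le ht.2).2, sq_eq_sq₀ hs0 (div_nonneg ht.1.le M.stretch_pos.le)] at hs2
    refine ⟨j, hj, hs2 ▸ hx, ha fun he => ?_⟩
    have h5 := (M.contr k).injective he
    have h6 := quad_loc i ht.1.le ht.2
    rw [h5, M.quad_self] at h6
    have h7 := (mul_eq_zero.1 h6.symm).resolve_left k.sgn_ne_zero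
    exact (pow_pos ht.1 2).ne' (by exact_mod_cast h7)
  have hcont : ContinuousOn (fun t => M.chart (M.contr k i.base) (M.contr k (loc i t)) /
        ‖M.chart (M.contr k i.base) (M.contr k (loc i t))‖) (Ioo 0 M.radius) := by
    intro t ht
    have hc : ContinuousAt (fun t => M.chart (M.contr k i.base) (M.contr k (loc i t))) t :=
      ContinuousAt.comp (f := fun t => M.contr k (loc i t))
        ((M.chart _).continuousAt (hsrc t ht.1.le ht.2))
        ((M.contr k).continuous.continuousAt.comp (lineAt_loc i ht.1 ht.2).1)
    refine (hc.div (Complex.continuous_ofReal.continuousAt.comp hc.norm) ?_).continuousWithinAt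
    obtain ⟨j, -, -, h⟩ := hdir t ht
    intro h0
    simp only [Function.comp] at h0
    rw [h0, div_zero] at h
    exact j.angle_ne_zero h
  have hfin : {ζ : ℂ | ζ ^ M.prong (M.contr k i.base) = k.sgn}.Finite :=
    finite_pow_eq (M.prong_ne_zero _) _
  have hmid : M.radius / 2 ∈ Ioo 0 M.radius := ⟨by linarith, by linarith⟩
  obtain ⟨j, hj, hj1, hj2⟩ := hdir _ hmid
  refine ⟨j, hj, fun t h0 ht => ?_⟩
  rcases h0.eq_or_lt with rfl | h0
  · rw [zero_div, loc_zero, loc_zero, hj]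
  obtain ⟨j', hj', h5, h6⟩ := hdir t ⟨h0, ht⟩
  have hc := isPreconnected_Ioo.constant_of_mapsTo
    (T := {ζ : ℂ | ζ ^ M.prong (M.contr k i.base) = k.sgn}) hfin.isDiscrete hcont (fun t ht => by
      obtain ⟨j, hj, -, h⟩ := hdir t ht
      beta_reduce
      rw [← h, mem_ofPred_eq, ← hj]
      exact j.angle_pow) ⟨h0, ht⟩ hmid
  have : j' = j := Prong.ext (hj'.trans hj.symm) (by rw [h6, hj2]; exact hc)
  rw [h5, this]

/-- The action of `contr k` on prongs. -/
noncomputable def step (i : M.Prong k) : M.Prong k := (exists_step i).choose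

theorem contr_loc (i : M.Prong k) {t : ℝ} (h0 : 0 ≤ t) (ht : t < M.radius) :
    M.contr k (loc i t) = loc (step i) (t / M.stretch) :=
  (exists_step i).choose_spec.2 t h0 ht

theorem step_injective : Function.Injective (step : M.Prong k → M.Prong k) := by
  intro i j h
  have hR := M.isRadius.pos
  have h1 := contr_loc i (t := M.radius / 2) (by linarith) (by linarith)
  rw [h, ← contr_loc j (by linarith) (by linarith)] at h1
  exact (loc_inj (by linarith) (by linarith) (by linarith) (by linarith)
    ((M.contr k).injective h1)).1

theorem step_bijective : Function.Bijective (step : M.Prong k → M.Prong k) :=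
  Finite.injective_iff_bijective.1 step_injective

variable (M) in
/-- A number of iterations after which `t` is contracted below the standard radius. -/
noncomputable def level (t : ℝ) : ℕ := sInf {N | t / M.stretch ^ N < M.radius}

/-- The separatrix that starts with a given prong, parametrized by arc length on `[0, ∞)`: its
initial part is extended by the expanding map. -/
noncomputable def ray (i : M.Prong k) (t : ℝ) : S :=
  (M.contr k).symm^[M.level t] (loc (step^[M.level t] i) (t / M.stretch ^ M.level t))

theorem ray_eq (i : M.Prong k) {t : ℝ} (h0 : 0 ≤ t) {N : ℕ} (hN : t / M.stretch ^ N < M.radius) :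
    ray i t = (M.contr k).symm^[N] (loc (step^[N] i) (t / M.stretch ^ N)) := by
  have hl : t / M.stretch ^ M.level t < M.radius :=
    Nat.sInf_mem (s := {N | t / M.stretch ^ N < M.radius}) ⟨N, hN⟩
  have hle : M.level t ≤ N := Nat.sInf_le hN
  clear hN
  -- the formula does not depend on `N`, as long as the contracted parameter is below the radius
  induction N, hle using Nat.le_induction with
  | base => rfl
  | succ n hn ih =>
    have h1 : t / M.stretch ^ n < M.radius := by
      refine lt_of_le_of_lt ?_ hl
      exact div_le_div_of_nonneg_left h0 (pow_pos M.stretch_pos _)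
        (pow_le_pow_right₀ M.one_lt_stretch.le hn)
    rw [ih, Function.iterate_succ_apply, Function.iterate_succ_apply' step]
    congr 1
    rw [Homeomorph.eq_symm_apply, contr_loc _ (div_nonneg h0 (pow_pos M.stretch_pos _).le) h1,
      div_div, pow_succ]

theorem ray_eq_loc (i : M.Prong k) {t : ℝ} (h0 : 0 ≤ t) (ht : t < M.radius) :
    ray i t = loc i t := by
  have := ray_eq i h0 (N := 0) (by simpa using ht)
  simpa using this

@[simp] theorem ray_zero (i : M.Prong k) : ray i 0 = i.base := by
  rw [ray_eq_loc i le_rfl M.isRadius.pos, loc_zero]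

theorem contr_ray (i : M.Prong k) {t : ℝ} (h0 : 0 ≤ t) :
    M.contr k (ray i t) = ray (step i) (t / M.stretch) := by
  obtain ⟨N, hN⟩ := M.exists_div_pow_lt (t / M.stretch) M.isRadius.pos
  have hN' : t / M.stretch ^ (N + 1) < M.radius := by
    rwa [pow_succ', ← div_div]
  rw [ray_eq i h0 hN', ray_eq (step i) (div_nonneg h0 M.stretch_pos.le) hN,
    Function.iterate_succ_apply', Homeomorph.apply_symm_apply, Function.iterate_succ_apply,
    div_div, pow_succ']

theorem contr_iterate_ray (i : M.Prong k) {t : ℝ} (h0 : 0 ≤ t) (n : ℕ) :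
    (M.contr k)^[n] (ray i t) = ray (step^[n] i) (t / M.stretch ^ n) := by
  induction n generalizing i t with
  | zero => simp
  | succ n ih =>
    rw [Function.iterate_succ_apply, contr_ray i h0, ih _ (div_nonneg h0 M.stretch_pos.le),
      Function.iterate_succ_apply, div_div, pow_succ']

/-- A point of a separatrix other than its origin determines the separatrix and the parameter. -/
theorem ray_inj {i j : M.Prong k} {s t : ℝ} (hs : 0 ≤ s) (ht : 0 < t) (h : ray i s = ray j t) :
    i = j ∧ s = t := by
  obtain ⟨N, hN⟩ := M.exists_div_pow_lt (max s t) M.isRadius.pos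
  have hp := pow_pos M.stretch_pos N
  have h1 : s / M.stretch ^ N < M.radius :=
    (div_le_div_of_nonneg_right (le_max_left _ _) hp.le).trans_lt hN
  have h2 : t / M.stretch ^ N < M.radius :=
    (div_le_div_of_nonneg_right (le_max_right _ _) hp.le).trans_lt hN
  have h3 := congrArg (M.contr k)^[N] h
  rw [contr_iterate_ray i hs, contr_iterate_ray j ht.le,
    ray_eq_loc _ (by positivity) h1, ray_eq_loc _ (by positivity) h2] at h3
  obtain ⟨h4, h5⟩ := loc_inj (by positivity) h1 (by positivity) h2 h3
  refine ⟨step_injective.iterate N h4, ?_⟩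
  field_simp at h5
  exact h5

theorem ray_notMem_pts (i : M.Prong k) {t : ℝ} (ht : 0 < t) : ray i t ∉ M.pts := by
  intro h
  obtain ⟨j, hj⟩ := exists_prong k h
  have := (ray_inj (i := j) le_rfl ht (by rw [ray_zero, hj])).2
  exact ht.ne this

theorem lineAt_ray (i : M.Prong k) {t : ℝ} (ht : 0 < t) : M.LineAt k.sgn (ray i) t := by
  obtain ⟨N, hN⟩ := M.exists_div_pow_lt t M.isRadius.pos
  have hp := pow_pos M.stretch_pos N
  have key : ∀ n : ℕ, ∀ (j : M.Prong k) (r : ℝ), 0 < r → r < M.radius →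
      M.LineAt k.sgn (fun s => (M.contr k).symm^[n] (loc j (s / M.stretch ^ n)))
        (M.stretch ^ n * r) := by
    intro n j r h0 hr
    induction n with
    | zero => simpa using lineAt_loc j h0 hr
    | succ n ih =>
      have := ih.contr_symm
      rw [pow_succ', mul_assoc]
      refine this.congr (Eventually.of_forall fun s => ?_)
      simp only
      rw [Function.iterate_succ_apply', div_div, ← pow_succ']
  have h1 := key N (step^[N] i) (t / M.stretch ^ N) (by positivity) hN
  rw [mul_div_cancel₀ _ hp.ne'] at h1
  refine h1.congr ?_
  have h2 : ∀ᶠ s in 𝓝 t, s / M.stretch ^ N < M.radius :=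
    (continuous_id.div_const _).continuousAt.eventually_lt_const hN
  filter_upwards [h2, lt_mem_nhds ht] with s h3 h4
  exact (ray_eq i h4.le h3).symm

theorem continuousOn_ray (i : M.Prong k) : ContinuousOn (ray i) (Ici 0) := by
  intro t ht
  rcases (mem_Ici.1 ht).eq_or_lt with rfl | h0
  · have h1 : Tendsto (fun s : ℝ => loc i s) (𝓝[≥] 0) (𝓝 i.base) :=
      (M.tendsto_sector_zero i.base i.norm_angle).comp
        ((Complex.continuous_ofReal.tendsto' 0 0 rfl).mono_left nhdsWithin_le_nhds)
    rw [ContinuousWithinAt, ray_zero]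
    refine h1.congr' ?_
    filter_upwards [self_mem_nhdsWithin, nhdsWithin_le_nhds (gt_mem_nhds M.isRadius.pos)] with s h2 h3
    exact (ray_eq_loc i h2 h3).symm
  · exact (lineAt_ray i h0).1.continuousWithinAt

theorem injOn_ray (i : M.Prong k) : InjOn (ray i) (Ici 0) := by
  intro s hs t ht h
  rcases (mem_Ici.1 ht).eq_or_lt with rfl | h0
  · rcases (mem_Ici.1 hs).eq_or_lt with rfl | h1
    · rfl
    · exact (ray_inj le_rfl h1 h.symm).2.symm
  · exact (ray_inj hs h0 h).2

theorem ray_eq_base_iff (i : M.Prong k) {t : ℝ} (ht : 0 ≤ t) : ray i t = i.base ↔ t = 0 := by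
  rw [← ray_zero i]
  exact ⟨fun h => injOn_ray i ht (mem_Ici.2 le_rfl) h, fun h => by rw [h]⟩

/-- Near a marked point, the local leaf consists of the initial parts of its separatrices. -/
theorem eventually_localLeaf_pts {p : S} (hp : p ∈ M.pts) (k : LeafKind) {ε : ℝ} (hε : 0 < ε) :
    ∀ᶠ x in 𝓝 p, x ∈ M.localLeaf k p →
      ∃ i : M.Prong k, i.base = p ∧ ∃ t, 0 ≤ t ∧ t < ε ∧ x = ray i t := by
  have hq : Tendsto (fun x => ‖M.quad p x‖) (𝓝 p) (𝓝 0) := by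
    have := (M.continuousAt_quad (M.mem_source p)).norm.tendsto
    rwa [M.quad_self, norm_zero] at this
  filter_upwards [M.disc_mem_nhds M.isRadius.pos p, hq.eventually_lt_const (pow_pos hε 2)]
    with x h1 h2 h3
  rw [M.mem_localLeaf_iff] at h3
  obtain ⟨i, hi, t, h4, h5, h6, h7, -⟩ := exists_eq_loc hp h1 h3.2
  refine ⟨i, hi, t, h4, ?_, by rw [h6, ray_eq_loc i h4 h5]⟩
  rw [← h7] at h2
  exact (sq_lt_sq₀ h4 hε.le).1 h2

theorem ray_mem_localLeaf_base (i : M.Prong k) {t : ℝ} (h0 : 0 ≤ t) (ht : t < M.radius) :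
    ray i t ∈ M.localLeaf k i.base := by
  rw [ray_eq_loc i h0 ht]
  exact loc_mem_localLeaf i h0 ht

variable (M) in
/-- A power of `f` that fixes all separatrices. -/
theorem exists_period : ∃ m : ℕ, 0 < m ∧ ∀ (k : LeafKind) (i : M.Prong k), step^[m] i = i := by
  have h : ∀ k, ∃ m : ℕ, 0 < m ∧ ∀ i : M.Prong k, step^[m] i = i := by
    intro k
    let σ : Equiv.Perm (M.Prong k) := Equiv.ofBijective step step_bijective
    refine ⟨orderOf σ, orderOf_pos σ, fun i => ?_⟩
    have h1 : (σ ^ orderOf σ) i = i := by rw [pow_orderOf_eq_one]; rfl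
    rwa [Equiv.Perm.coe_pow] at h1
  obtain ⟨a, ha, ha'⟩ := h .stable
  obtain ⟨b, hb, hb'⟩ := h .unstable
  refine ⟨a * b, Nat.mul_pos ha hb, fun k i => ?_⟩
  cases k
  · rw [Function.iterate_mul]
    exact Function.iterate_fixed (ha' i) b
  · rw [mul_comm, Function.iterate_mul]
    exact Function.iterate_fixed (hb' i) a

end Marked

/-! ### Intervals in the leaves of marked points -/

section Topological

variable {S : Type*} [TopologicalSpace S]

/-- On a compact set of parameters, a continuous injective path is an embedding. -/
theorem nhdsWithin_image_le [T2Space S] {γ : ℝ → S} {K : Set ℝ} (hK : IsCompact K)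
    (hc : ContinuousOn γ K) (hi : InjOn γ K) {t : ℝ} (ht : t ∈ K) :
    𝓝[γ '' K] (γ t) ≤ map γ (𝓝[K] t) := by
  intro V hV
  rw [mem_map, mem_nhdsWithin] at hV
  obtain ⟨U, hU, htU, hsub⟩ := hV
  have hcl : IsClosed (γ '' (K \ U)) :=
    ((hK.diff hU).image_of_continuousOn (hc.mono sdiff_subset)).isClosed
  have hmem : γ t ∈ (γ '' (K \ U))ᶜ := by
    rintro ⟨s, ⟨hs, hsU⟩, he⟩
    exact hsU (hi hs ht he ▸ htU)
  rw [mem_nhdsWithin]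
  refine ⟨_, hcl.isOpen_compl, hmem, ?_⟩
  rintro x ⟨hx, s, hs, rfl⟩
  refine hsub ⟨?_, hs⟩
  by_contra hsU
  exact hx ⟨s, ⟨hs, hsU⟩, rfl⟩

theorem image_Icc_eq_uIcc {φ : ℝ → ℝ} {a b : ℝ} (hab : a ≤ b) (hc : ContinuousOn φ (Icc a b))
    (hi : InjOn φ (Icc a b)) : φ '' Icc a b = uIcc (φ a) (φ b) := by
  apply Subset.antisymm
  · rintro _ ⟨t, ht, rfl⟩
    rcases hc.strictMonoOn_of_injOn_Icc' hab hi with h | h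
    · exact Icc_subset_uIcc ⟨h.monotoneOn (left_mem_Icc.2 hab) ht ht.1,
        h.monotoneOn ht (right_mem_Icc.2 hab) ht.2⟩
    · exact Icc_subset_uIcc' ⟨h.antitoneOn ht (right_mem_Icc.2 hab) ht.2,
        h.antitoneOn (left_mem_Icc.2 hab) ht ht.1⟩
  · rw [← uIcc_of_le hab] at hc ⊢
    exact intermediate_value_uIcc hc

/-- On its parameter interval, the path of a leaf arc lies near every parameter in the local
leaf. -/
theorem TransverseMeasuredFoliations.IsLeafArc.exists_real {F : TransverseMeasuredFoliations S}
    {k : LeafKind} {A : Set S} {a b : S} (h : F.IsLeafArc k A a b) :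
    ∃ α : ℝ → S, Continuous α ∧ InjOn α (Icc 0 1) ∧ α '' Icc 0 1 = A ∧ α 0 = a ∧ α 1 = b ∧
      ∀ t ∈ Icc (0 : ℝ) 1, ∀ P : S → Prop, (∀ᶠ x in 𝓝 (α t), x ∈ F.localLeaf k (α t) → P x) →
        ∀ᶠ s in 𝓝[Icc 0 1] t, P (α s) := by
  obtain ⟨α, hc, hi, hA, h0, h1⟩ := h.1.exists_real
  refine ⟨α, hc, hi, hA, h0, h1, fun t ht P hP => ?_⟩
  have hmem : α t ∈ A := hA ▸ mem_image_of_mem α ht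
  have htend : Tendsto α (𝓝[Icc 0 1] t) (𝓝[A] (α t)) := by
    rw [← hA]
    exact hc.continuousWithinAt.tendsto_nhdsWithin (mapsTo_image α _)
  filter_upwards [htend.eventually (h.2 _ hmem),
    (htend.mono_right nhdsWithin_le_nhds).eventually hP] with s h2 h3
  exact h3 h2

theorem TransverseMeasuredFoliations.IsLeafArc.symm {F : TransverseMeasuredFoliations S}
    {k : LeafKind} {A : Set S} {a b : S} (h : F.IsLeafArc k A a b) : F.IsLeafArc k A b a :=
  ⟨h.1.symm, h.2⟩

end Topological

namespace Marked

variable {S : Type*} [TopologicalSpace S] {f : S ≃ₜ S} {M : Marked f} {k : LeafKind}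

/-- Horizontal and vertical segments in a natural chart around a regular point. -/
theorem lineAt_chart_symm {y : S} (hy : M.prong y = 2) {a : ℂ} {t : ℝ}
    (h : a + t * k.dir ∈ (M.chart y).target) :
    M.LineAt k.sgn (fun s : ℝ => (M.chart y).symm (a + s * k.dir)) t := by
  have := (TransverseMeasuredFoliations.isoAt_chart_symm hy h).lineAt
  rwa [k.dir_sq, one_mul] at this

variable [T2Space S]

theorem isClosed_pts : IsClosed M.pts := M.pts_finite.isClosed

/-- Small boxes around an unmarked point. -/
theorem exists_box {y : S} (hy : y ∉ M.pts) {U : Set S} (hU : U ∈ 𝓝 y) :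
    ∃ r > 0, ∀ w : ℂ, |w.re| < r → |w.im| < r → w ∈ (M.chart y).target ∧
      (M.chart y).symm w ∉ M.pts ∧ (M.chart y).symm w ∈ U := by
  have h3 := ((M.chart y).continuousAt_symm (M.zero_mem_target y)).tendsto
  rw [M.chart_symm_zero] at h3
  have h4 : ∀ᶠ x in 𝓝 y, x ∉ M.pts := isClosed_pts.isOpen_compl.mem_nhds hy
  have h5 : ∀ᶠ x in 𝓝 y, x ∈ U := hU
  obtain ⟨ρ, hρ, hball⟩ := Metric.eventually_nhds_iff.1
    (((M.chart y).open_target.eventually_mem (M.zero_mem_target y)).and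
      (h3.eventually (h4.and h5)))
  refine ⟨ρ / 2, half_pos hρ, fun w h1 h2 => ?_⟩
  have := hball (y := w) (by
    rw [dist_zero_right]
    exact (Complex.norm_le_abs_re_add_abs_im w).trans_lt (by linarith))
  exact ⟨this.1, this.2.1, this.2.2⟩

/-- A segment of a leaf without marked points that meets a separatrix lies in it. -/
theorem subset_ray {β : ℝ → S} {I : Set ℝ} (hI : I.OrdConnected)
    (hβ : ∀ s ∈ I, M.LineAt k.sgn β s) (hpts : ∀ s ∈ I, β s ∉ M.pts) {s₀ : ℝ} (hs₀ : s₀ ∈ I)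
    {i : M.Prong k} {T : ℝ} (hT : 0 < T) (h : β s₀ = ray i T) :
    ∃ η : ℝ, (η = 1 ∨ η = -1) ∧
      ∀ s ∈ I, 0 < η * (s - s₀) + T ∧ β s = ray i (η * (s - s₀) + T) := by
  obtain ⟨η, hη, hev⟩ := (hβ s₀ hs₀).eq_or_flip (lineAt_ray i hT) h
  have hη2 : η * η = 1 := by rcases hη with rfl | rfl <;> norm_num
  have hord : (I ∩ {s | 0 < η * (s - s₀) + T}).OrdConnected := by
    refine hI.inter ⟨?_⟩
    intro x hx y hy z hz
    simp only [mem_ofPred_eq] at *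
    rcases hη with rfl | rfl <;> linarith [hz.1, hz.2]
  have heq : EqOn β (fun s => ray i (η * s + (T - η * s₀)))
      (I ∩ {s | 0 < η * (s - s₀) + T}) := by
    refine TransverseMeasuredFoliations.LineAt.eqOn hord.isPreconnected
      (fun t ht => hβ t ht.1) (fun t ht => ?_) ⟨hs₀, by simpa using hT⟩ ?_
    · apply TransverseMeasuredFoliations.LineAt.reflect hη
      apply lineAt_ray
      have := ht.2
      simp only [mem_ofPred_eq] at this
      linarith
    · filter_upwards [hev] with s hs
      rw [hs]; congr 1; ring
  refine ⟨η, hη, ?_⟩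
  have hpos : ∀ s ∈ I, 0 < η * (s - s₀) + T := by
    intro s hs
    by_contra hneg
    push Not at hneg
    -- the segment would reach the marked point at the origin of the separatrix
    have hmem : ∀ v ∈ Icc 0 T, s₀ - η * T + η * v ∈ I := by
      intro v hv
      have := hv.1
      have := hv.2
      rcases hη with rfl | rfl
      · exact hI.out hs hs₀ ⟨by linarith, by linarith⟩
      · exact hI.out hs₀ hs ⟨by linarith, by linarith⟩
    have hmem0 := hmem 0 ⟨le_rfl, hT.le⟩
    rw [mul_zero, add_zero] at hmem0
    have h1 : Tendsto (fun v : ℝ => β (s₀ - η * T + η * v)) (𝓝[>] 0) (𝓝 (β (s₀ - η * T))) := by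
      have : Continuous fun v : ℝ => s₀ - η * T + η * v := by fun_prop
      have h2 := this.tendsto 0
      rw [mul_zero, add_zero] at h2
      exact ((hβ _ hmem0).1.tendsto.comp h2).mono_left nhdsWithin_le_nhds
    have h2 : Tendsto (ray i) (𝓝[>] 0) (𝓝 (ray i 0)) :=
      ((continuousOn_ray i) 0 (mem_Ici.2 le_rfl)).mono Ioi_subset_Ici_self
    have h3 : (fun v : ℝ => β (s₀ - η * T + η * v)) =ᶠ[𝓝[>] 0] ray i := by
      filter_upwards [Ioo_mem_nhdsGT hT] with v hv
      have e : η * (s₀ - η * T + η * v - s₀) + T = v := by linear_combination (v - T) * hη2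
      rw [heq ⟨hmem v ⟨hv.1.le, hv.2.le⟩, by rw [mem_ofPred_eq, e]; exact hv.1⟩]
      simp only
      congr 1
      linear_combination e
    have h4 := tendsto_nhds_unique (h1.congr' h3) h2
    apply hpts _ hmem0
    rw [h4, ray_zero]
    exact i.base_mem
  intro s hs
  refine ⟨hpos s hs, ?_⟩
  rw [heq ⟨hs, hpos s hs⟩]
  simp only
  congr 1
  ring

/-- Local leaves at points outside a separatrix are disjoint from it. -/
theorem eventually_notMem_ray {y : S} {i : M.Prong k} (hy : y ∉ ray i '' Ici 0) :
    ∀ᶠ x in 𝓝 y, x ∈ M.localLeaf k y → x ∉ ray i '' Ioi 0 := by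
  by_cases hyp : y ∈ M.pts
  · filter_upwards [eventually_localLeaf_pts hyp k one_pos] with x hx hmem
    rintro ⟨s, hs, rfl⟩
    obtain ⟨j, hj, t, ht, -, he⟩ := hx hmem
    obtain ⟨rfl, -⟩ := ray_inj ht hs he.symm
    exact hy ⟨0, mem_Ici.2 le_rfl, by rw [ray_zero, hj]⟩
  -- near an unmarked point `y` the local leaf is a plaque through `y`; if it met the separatrix, it
  -- would be contained in it
  · obtain ⟨r, hr, hbox⟩ := exists_box hyp univ_mem
    have h2 := M.prong_eq_two hyp
    have hdir : ∀ s ∈ Ioo (-r) r, (M.chart y).symm ((0 : ℂ) + s * k.dir) ∉ M.pts ∧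
        M.LineAt k.sgn (fun s : ℝ => (M.chart y).symm (0 + s * k.dir)) s := by
      intro s hs
      have hs' := abs_lt.2 hs
      have := hbox (0 + s * k.dir) (by cases k <;> simp [LeafKind.dir, hr, hs'])
        (by cases k <;> simp [LeafKind.dir, hr, hs'])
      exact ⟨this.2.1, lineAt_chart_symm h2 this.1⟩
    have hch : Tendsto (fun x => ‖M.chart y x‖) (𝓝 y) (𝓝 0) := by
      have := ((M.chart y).continuousAt (M.mem_source _)).norm.tendsto
      rwa [M.chart_self, norm_zero] at this
    filter_upwards [hch.eventually_lt_const hr] with x hx hmem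
    rintro ⟨T, hT, hxT⟩
    rw [M.mem_localLeaf_iff, TransverseMeasuredFoliations.quad, h2, k.hgt_sq] at hmem
    obtain ⟨v, hv⟩ := LeafKind.exists_real_mul_dir (pow_eq_zero_iff two_ne_zero |>.1 hmem.2)
    rw [hv, norm_mul, k.norm_dir, mul_one, Complex.norm_real] at hx
    have he : (M.chart y).symm ((0 : ℂ) + v * k.dir) = ray i T := by
      rw [zero_add, ← hv, (M.chart y).left_inv hmem.1, hxT]
    obtain ⟨η, -, hη⟩ := subset_ray ordConnected_Ioo (fun s hs => (hdir s hs).2)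
      (fun s hs => (hdir s hs).1) (abs_lt.1 hx) hT he
    obtain ⟨h3, h4⟩ := hη 0 ⟨by linarith, hr⟩
    refine hy ⟨_, h3.le, ?_⟩
    rw [← h4]
    simp [M.chart_symm_zero]

/-- An interval in a leaf that starts on a separatrix of `p`, or in `p`, and otherwise avoids `p`,
is a segment of a separatrix of `p`. -/
theorem exists_eq_image_ray {A : Set S} {a b p : S} (h : M.IsLeafArc k A a b) (hp : p ∈ M.pts)
    (ha : ∃ i : M.Prong k, i.base = p ∧ ∃ t, 0 ≤ t ∧ a = ray i t) (hA : ∀ x ∈ A, x ≠ a → x ≠ p) :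
    ∃ i : M.Prong k, i.base = p ∧ ∃ T₁ T₂, 0 ≤ T₁ ∧ 0 ≤ T₂ ∧ T₁ ≠ T₂ ∧ a = ray i T₁ ∧
      b = ray i T₂ ∧ A = ray i '' uIcc T₁ T₂ := by
  obtain ⟨α, hc, hi, hαA, h0, h1, hloc⟩ := h.exists_real
  have hz : (0 : ℝ) ∈ Icc (0 : ℝ) 1 := ⟨le_rfl, zero_le_one⟩
  have hne : ∀ t ∈ Ioc (0 : ℝ) 1, α t ≠ p := by
    intro t ht
    refine hA _ (hαA ▸ mem_image_of_mem α ⟨ht.1.le, ht.2⟩) ?_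
    rw [← h0]
    intro he
    exact ht.1.ne' (hi ⟨ht.1.le, ht.2⟩ hz he)
  have hnb : (𝓝[Ioc (0 : ℝ) 1] 0).NeBot := by
    rw [nhdsWithin_Ioc_eq_nhdsGT zero_lt_one]; infer_instance
  have hle : 𝓝[Ioc (0 : ℝ) 1] 0 ≤ 𝓝[Icc 0 1] 0 := nhdsWithin_mono _ Ioc_subset_Icc_self
  -- the separatrix on which the interval lies near its start
  obtain ⟨i, hib, T₁, hT₁, haT, t₁, ht₁, hray⟩ : ∃ i : M.Prong k, i.base = p ∧ ∃ T₁, 0 ≤ T₁ ∧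
      a = ray i T₁ ∧ ∃ t ∈ Ioc (0 : ℝ) 1, α t ∈ ray i '' Ioi 0 := by
    obtain ⟨i, hib, T, hT, haT⟩ := ha
    rcases hT.eq_or_lt with rfl | hT
    · rw [ray_zero, hib] at haT
      have := hloc 0 hz _ (by rw [h0, haT]; exact eventually_localLeaf_pts hp k one_pos)
      obtain ⟨s, ⟨j, hj, t, ht, -, hs⟩, hs1⟩ :=
        ((this.filter_mono hle).and self_mem_nhdsWithin).exists
      refine ⟨j, hj, 0, le_rfl, by rw [haT, ray_zero, hj], s, hs1, t, ?_, hs.symm⟩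
      refine lt_of_le_of_ne ht ?_
      rintro rfl
      exact hne s hs1 (by rw [hs, ray_zero, hj])
    · have := hloc 0 hz _ (by rw [h0, haT]; exact (lineAt_ray i hT).eventually_localLeaf hT)
      obtain ⟨s, ⟨t, ht, hs⟩, hs1⟩ := ((this.filter_mono hle).and self_mem_nhdsWithin).exists
      exact ⟨i, hib, T, hT.le, haT, s, hs1, t, by
        rw [mem_Ioi]; linarith [(abs_lt.1 ht).1], hs.symm⟩
  -- lying on this separatrix is an open and closed condition along the interval
  have hall : ∀ t ∈ Ioc (0 : ℝ) 1, α t ∈ ray i '' Ioi 0 := by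
    intro t ht
    refine (isPreconnected_Ioc.induction₂ (fun s t => (α s ∈ ray i '' Ioi 0 ↔ α t ∈ ray i '' Ioi 0))
      (fun t ht => ?_) (fun _ _ _ _ _ _ h1 h2 => h1.trans h2) (fun _ _ _ _ h => h.symm) ht₁ ht).1
      hray
    refine Eventually.filter_mono (nhdsWithin_mono _ Ioc_subset_Icc_self) ?_
    by_cases hmem : α t ∈ ray i '' Ioi 0
    · obtain ⟨T, hT, he⟩ := hmem
      have := hloc t (Ioc_subset_Icc_self ht) _
        (by rw [← he]; exact (lineAt_ray i hT).eventually_localLeaf hT)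
      filter_upwards [this] with s ⟨s', hs', hs⟩
      exact iff_of_true ⟨T, hT, he⟩ ⟨s', by
        rw [mem_Ioi]; linarith [(abs_lt.1 hs').1], hs.symm⟩
    · have hmem' : α t ∉ ray i '' Ici 0 := by
        rintro ⟨T, hT, he⟩
        rcases (mem_Ici.1 hT).eq_or_lt with rfl | hT
        · exact hne t ht (by rw [← he, ray_zero, hib])
        · exact hmem ⟨T, hT, he⟩
      filter_upwards [hloc t (Ioc_subset_Icc_self ht) _ (eventually_notMem_ray hmem')] with s hs
      exact iff_of_false hmem hs
  -- the interval, read in the arc length parameter of the separatrix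
  have hφ : ∀ t, ∃ T, t ∈ Icc (0 : ℝ) 1 → 0 ≤ T ∧ α t = ray i T := by
    intro t
    by_cases ht : t ∈ Icc (0 : ℝ) 1
    · rcases ht.1.eq_or_lt with rfl | h2
      · exact ⟨T₁, fun _ => ⟨hT₁, h0.trans haT⟩⟩
      · obtain ⟨T, hT, he⟩ := hall t ⟨h2, ht.2⟩
        exact ⟨T, fun _ => ⟨le_of_lt hT, he.symm⟩⟩
    · exact ⟨0, fun h => absurd h ht⟩
  choose φ hφ using hφ
  have hφc : ContinuousOn φ (Icc 0 1) := by
    intro t ht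
    rw [ContinuousWithinAt, Metric.tendsto_nhds]
    intro ε hε
    obtain ⟨hT, he⟩ := hφ t ht
    rcases hT.eq_or_lt with hT | hT
    · have := hloc t ht _ (by
        rw [he, ← hT, ray_zero, hib]; exact eventually_localLeaf_pts hp k hε)
      filter_upwards [this, self_mem_nhdsWithin] with s ⟨j, hj, t', ht', htε, hs⟩ hs1
      obtain ⟨h2, h3⟩ := hφ s hs1
      rw [Real.dist_eq, ← hT, sub_zero, abs_of_nonneg h2]
      rcases h2.eq_or_lt with h4 | h4
      · rwa [← h4]
      · rwa [← (ray_inj ht' h4 (hs.symm.trans h3)).2]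
    · have := hloc t ht _ (by
        rw [he]; exact (lineAt_ray i hT).eventually_localLeaf (lt_min hε hT))
      filter_upwards [this, self_mem_nhdsWithin] with s ⟨s', hs', hs⟩ hs1
      obtain ⟨h2, h3⟩ := hφ s hs1
      have h4 : 0 ≤ s' := by
        linarith [(abs_lt.1 (hs'.trans_le (min_le_right _ _))).1]
      rw [injOn_ray i h2 h4 (h3.symm.trans hs), Real.dist_eq]
      exact hs'.trans_le (min_le_left _ _)
  have hφi : InjOn φ (Icc 0 1) := by
    intro s hs t ht he
    apply hi hs ht
    rw [(hφ s hs).2, (hφ t ht).2, he]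
  have ho : (1 : ℝ) ∈ Icc (0 : ℝ) 1 := ⟨zero_le_one, le_rfl⟩
  refine ⟨i, hib, φ 0, φ 1, (hφ 0 hz).1, (hφ 1 ho).1, fun he => zero_ne_one (hφi hz ho he),
    h0 ▸ (hφ 0 hz).2, h1 ▸ (hφ 1 ho).2, ?_⟩
  rw [← image_Icc_eq_uIcc zero_le_one hφc hφi, ← hαA, ← image_comp]
  exact image_congr fun t ht => (hφ t ht).2

/-- Segments of separatrices are intervals in leaves. -/
theorem isLeafArc_ray_uIcc (i : M.Prong k) {T₁ T₂ : ℝ} (h1 : 0 ≤ T₁) (h2 : 0 ≤ T₂) (h : T₁ ≠ T₂) :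
    M.IsLeafArc k (ray i '' uIcc T₁ T₂) (ray i T₁) (ray i T₂) := by
  have hsub : uIcc T₁ T₂ ⊆ Ici 0 := fun t ht => (le_min h1 h2).trans ht.1
  have hc := (continuousOn_ray i).mono hsub
  have hi := (injOn_ray i).mono hsub
  refine ⟨isArc_image_uIcc h hc hi, ?_⟩
  rintro _ ⟨t, ht, rfl⟩
  refine nhdsWithin_image_le isCompact_uIcc hc hi ht ?_
  rw [mem_map]
  rcases (mem_Ici.1 (hsub ht)).eq_or_lt with rfl | h0
  · rw [ray_zero]
    filter_upwards [self_mem_nhdsWithin, nhdsWithin_le_nhds (gt_mem_nhds M.isRadius.pos)]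
      with s h3 h4
    exact ray_mem_localLeaf_base i (hsub h3) h4
  · exact nhdsWithin_le_nhds (lineAt_ray i h0).eventually_mem_localLeaf

theorem isLeafArc_ray (i : M.Prong k) {T : ℝ} (h : 0 < T) :
    M.IsLeafArc k (ray i '' Icc 0 T) i.base (ray i T) := by
  have := isLeafArc_ray_uIcc i le_rfl h.le h.ne
  rwa [uIcc_of_le h.le, ray_zero] at this

/-- The intervals that start at a marked point are the initial segments of its separatrices. -/
theorem exists_eq_image_ray_Icc {A : Set S} {p b : S} (h : M.IsLeafArc k A p b)
    (hp : p ∈ M.pts) :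
    ∃ i : M.Prong k, i.base = p ∧ ∃ T, 0 < T ∧ b = ray i T ∧ A = ray i '' Icc 0 T := by
  obtain ⟨i, hi⟩ := exists_prong k hp
  obtain ⟨j, hj, T₁, T₂, h1, h2, h3, h4, h5, h6⟩ := exists_eq_image_ray h hp
    ⟨i, hi, 0, le_rfl, by rw [ray_zero, hi]⟩ (fun _ _ h => h)
  have : T₁ = 0 := (ray_eq_base_iff j h1).1 (by rw [← h4, hj])
  subst this
  rw [uIcc_of_le h2] at h6
  exact ⟨j, hj, T₂, lt_of_le_of_ne h2 h3, h5, h6⟩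

theorem mem_leaf_iff {p x : S} (hp : p ∈ M.pts) :
    x ∈ M.leaf k p ↔ ∃ i : M.Prong k, i.base = p ∧ ∃ t, 0 ≤ t ∧ x = ray i t := by
  constructor
  · rintro (rfl | ⟨A, hA⟩)
    · obtain ⟨i, hi⟩ := exists_prong k hp
      exact ⟨i, hi, 0, le_rfl, by rw [ray_zero, hi]⟩
    · obtain ⟨i, hi, T, hT, hx, -⟩ := exists_eq_image_ray_Icc hA hp
      exact ⟨i, hi, T, hT.le, hx⟩
  · rintro ⟨i, rfl, t, ht, rfl⟩
    rcases ht.eq_or_lt with rfl | h0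
    · exact Or.inl (ray_zero i)
    · exact Or.inr ⟨_, isLeafArc_ray i h0⟩

theorem ray_mem_leaf (i : M.Prong k) {t : ℝ} (ht : 0 ≤ t) : ray i t ∈ M.leaf k i.base :=
  (mem_leaf_iff i.base_mem).2 ⟨i, rfl, t, ht, rfl⟩

/-- The separatrices of a marked point are its rays. -/
theorem exists_eq_of_isSeparatrix {p : S} {σ : Set S} (hp : p ∈ M.pts)
    (h : M.IsSeparatrix k p σ) : ∃ i : M.Prong k, i.base = p ∧ σ = ray i '' Ioi 0 := by
  obtain ⟨x, hx, hxp, rfl⟩ := h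
  obtain ⟨i, rfl, t, ht, rfl⟩ := (mem_leaf_iff hp).1 hx
  have ht0 : 0 < t := by
    refine lt_of_le_of_ne ht ?_
    rintro rfl
    exact hxp (ray_zero i)
  refine ⟨i, rfl, ?_⟩
  ext y
  constructor
  · rintro (rfl | ⟨A, hA, hpA⟩)
    · exact ⟨t, ht0, rfl⟩
    · obtain ⟨j, hj, T₁, T₂, h1, h2, h3, h4, h5, h6⟩ := exists_eq_image_ray hA hp
        ⟨i, rfl, t, ht, rfl⟩ (fun x hx _ he => hpA (he ▸ hx))
      obtain ⟨rfl, rfl⟩ := ray_inj h1 ht0 h4.symm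
      refine ⟨T₂, lt_of_le_of_ne h2 ?_, h5.symm⟩
      rintro rfl
      exact hpA (by rw [h6, ← ray_zero j]; exact mem_image_of_mem _ right_mem_uIcc)
  · rintro ⟨s, hs, rfl⟩
    by_cases hst : s = t
    · exact Or.inl (by rw [hst])
    · refine Or.inr ⟨_, isLeafArc_ray_uIcc i ht (le_of_lt hs) (Ne.symm hst), ?_⟩
      rintro ⟨u, hu, he⟩
      have hu0 : 0 < u := (lt_min ht0 hs).trans_le hu.1
      exact hu0.ne' ((ray_eq_base_iff i hu0.le).1 he)

end Marked

/-! ### Area and recurrence -/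

theorem det_stretch {μ : ℝ} (hμ : μ ≠ 0) {A : ℂ →L[ℝ] ℂ} (hA : ∀ w, A w = stretchMap μ w) :
    A.det = 1 := by
  rw [ContinuousLinearMap.det, ← LinearMap.det_toMatrix Complex.basisOneI, Matrix.det_fin_two]
  simp [LinearMap.toMatrix_apply, hA, stretchMap, hμ]

theorem abs_det_mul {u : ℂ} (hu : ‖u‖ = 1) {A : ℂ →L[ℝ] ℂ} (hA : ∀ w, A w = u * w) :
    |A.det| = 1 := by
  rw [ContinuousLinearMap.det, ← LinearMap.det_toMatrix Complex.basisOneI, Matrix.det_fin_two]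
  have h := Complex.normSq_eq_norm_sq u
  rw [hu, Complex.normSq_apply] at h
  simp only [LinearMap.toMatrix_apply, ContinuousLinearMap.coe_coe, hA, Complex.coe_basisOneI,
    Complex.coe_basisOneI_repr]
  simp
  rw [h]; norm_num

namespace TransverseMeasuredFoliations

variable {S : Type*} [TopologicalSpace S] (F : TransverseMeasuredFoliations S)

/-- An isometrically parametrized piece of the surface. -/
structure Patch where
  map : ℂ → S
  dom : Set ℂ
  isOpen : IsOpen dom
  volume_lt_top : MeasureTheory.volume dom < ⊤
  slope : ℂ
  norm_slope : ‖slope‖ = 1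
  isoAt : ∀ w ∈ dom, F.IsoAt slope map w
  injOn : InjOn map dom

variable {F}

/-- In isometric parameters, an affine map is area preserving. -/
theorem Patch.exists_hasFDerivAt {g : S → S} {μ : ℝ} (hμ : μ ≠ 0) (hg : F.IsAffine g μ)
    (P Q : F.Patch) {w₀ : ℂ} (hw : w₀ ∈ P.dom) (h : g (P.map w₀) ∈ Q.map '' Q.dom) :
    (∀ᶠ w in 𝓝 w₀, g (P.map w) ∈ Q.map '' Q.dom) ∧ ∃ A : ℂ →L[ℝ] ℂ, |A.det| = 1 ∧
      HasFDerivAt (fun w => Function.invFunOn Q.map Q.dom (g (P.map w))) A w₀ := by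
  obtain ⟨w₁, hw₁, he⟩ := h
  obtain ⟨hc, h2, u, hu, hev⟩ := P.isoAt w₀ hw
  obtain ⟨hc', h2', u', hu', hev'⟩ := Q.isoAt w₁ hw₁
  obtain ⟨ε, hε, hgev⟩ := hg.map_chart _ h2
  have hnu : ‖u‖ = 1 := by
    have := congrArg norm hu
    rw [norm_pow, P.norm_slope] at this
    exact (pow_eq_one_iff_of_nonneg (norm_nonneg _) two_ne_zero).1 this
  have hnu' : ‖u'‖ = 1 := by
    have := congrArg norm hu'
    rw [norm_pow, Q.norm_slope] at this
    exact (pow_eq_one_iff_of_nonneg (norm_nonneg _) two_ne_zero).1 this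
  have hnε : ‖ε‖ = 1 := by
    have := congrArg norm hε
    rw [norm_pow, norm_one] at this
    exact (pow_eq_one_iff_of_nonneg (norm_nonneg _) two_ne_zero).1 this
  have hu0 : u' ≠ 0 := by rintro rfl; simp at hnu'
  obtain ⟨B, hB⟩ : ∃ B : ℂ →L[ℝ] ℂ, ∀ w, B w = stretchMap μ w := by
    refine ⟨LinearMap.toContinuousLinearMap
      { toFun := stretchMap μ, map_add' := fun x y => ?_, map_smul' := fun r x => ?_ },
        fun _ => rfl⟩
    · apply Complex.ext <;> simp [stretchMap] <;> ring
    · rw [Complex.real_smul, stretchMap_real_mul, RingHom.id_apply, Complex.real_smul]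
  obtain ⟨C, hC⟩ : ∃ C : ℂ →L[ℝ] ℂ, ∀ w, C w = u * w :=
    ⟨(ContinuousLinearMap.mul ℝ ℂ) u, fun _ => rfl⟩
  obtain ⟨D, hD⟩ : ∃ D : ℂ →L[ℝ] ℂ, ∀ w, D w = (u'⁻¹ * ε) * w :=
    ⟨(ContinuousLinearMap.mul ℝ ℂ) (u'⁻¹ * ε), fun _ => rfl⟩
  -- in the parameters of `P` and `Q`, the map is `D ∘ B ∘ C` up to translations: the stretching
  -- map `B` between two rotations
  have hdet : |(D ∘L B ∘L C).det| = 1 := by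
    have e : (D ∘L B ∘L C).det = D.det * (B.det * C.det) := by
      change LinearMap.det ((D : ℂ →ₗ[ℝ] ℂ) ∘ₗ ((B : ℂ →ₗ[ℝ] ℂ) ∘ₗ (C : ℂ →ₗ[ℝ] ℂ))) = _
      rw [LinearMap.det_comp, LinearMap.det_comp]
    rw [e, det_stretch hμ hB, one_mul, abs_mul, abs_det_mul hnu hC,
      abs_det_mul (by rw [norm_mul, norm_inv, hnu', hnε]; norm_num) hD, one_mul]
  have haff : ContinuousAt (fun w => w₁ + (D ∘L B ∘L C) (w - w₀)) w₀ := by fun_prop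
  have haff0 : w₁ + (D ∘L B ∘L C) (w₀ - w₀) = w₁ := by simp
  rw [ContinuousAt, haff0] at haff
  have hsrc : ∀ᶠ w in 𝓝 w₁, Q.map w ∈ (F.chart (g (P.map w₀))).source ∧ w ∈ Q.dom ∧
      F.chart (Q.map w₁) (Q.map w) = u' * (w - w₁) :=
    (hc'.eventually_mem ((F.chart _).open_source.mem_nhds (by rw [he]; exact F.mem_source _))).and
      ((Q.isOpen.eventually_mem hw₁).and hev')
  have hsrc2 : ∀ᶠ w in 𝓝 w₀, g (P.map w) ∈ (F.chart (g (P.map w₀))).source :=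
    (hg.continuous.continuousAt.comp hc).eventually_mem
      ((F.chart _).open_source.mem_nhds (F.mem_source _))
  have key : ∀ᶠ w in 𝓝 w₀, w₁ + (D ∘L B ∘L C) (w - w₀) ∈ Q.dom ∧
      g (P.map w) = Q.map (w₁ + (D ∘L B ∘L C) (w - w₀)) := by
    filter_upwards [haff.eventually hsrc, hsrc2, hev, hc.eventually hgev] with w ⟨h3, h4, h5⟩ h6 h7 h8
    refine ⟨h4, (F.chart _).injOn h6 h3 ?_⟩
    rw [h8, h7]
    rw [he] at h5
    rw [h5, add_sub_cancel_left]
    simp only [ContinuousLinearMap.comp_apply, hB, hC, hD]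
    field_simp
  refine ⟨key.mono fun w hw => ⟨_, hw.1, hw.2.symm⟩, D ∘L B ∘L C, hdet, ?_⟩
  have hfd : HasFDerivAt (fun w => w₁ + (D ∘L B ∘L C) (w - w₀)) (D ∘L B ∘L C) w₀ := by
    have h0 : HasFDerivAt (fun w : ℂ => w - w₀) (ContinuousLinearMap.id ℝ ℂ) w₀ :=
      (hasFDerivAt_id w₀).sub_const w₀
    have h1 := (D ∘L B ∘L C).hasFDerivAt.comp w₀ h0
    rw [ContinuousLinearMap.comp_id] at h1
    exact h1.const_add w₁
  refine hfd.congr_of_eventuallyEq ?_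
  filter_upwards [key] with w ⟨h3, h4⟩
  rw [h4]
  exact Q.injOn.leftInvOn_invFunOn h3

/-- Area preservation, from the change of variables formula. -/
theorem Patch.volume_le {g : S → S} {μ : ℝ} (hμ : μ ≠ 0) (hg : F.IsAffine g μ)
    (P Q : F.Patch) {s : Set ℂ} (hs : MeasurableSet s) (hsP : s ⊆ P.dom)
    (h : ∀ w ∈ s, g (P.map w) ∈ Q.map '' Q.dom) :
    MeasureTheory.volume s ≤
      MeasureTheory.volume {w | w ∈ Q.dom ∧ Q.map w ∈ g '' (P.map '' s)} := by
  have hA : ∀ w, ∃ A : ℂ →L[ℝ] ℂ, w ∈ s → |A.det| = 1 ∧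
      HasFDerivAt (fun w => Function.invFunOn Q.map Q.dom (g (P.map w))) A w := by
    intro w
    by_cases hw : w ∈ s
    · obtain ⟨-, A, hA⟩ := P.exists_hasFDerivAt hμ hg Q (hsP hw) (h w hw)
      exact ⟨A, fun _ => hA⟩
    · exact ⟨0, fun h => absurd h hw⟩
  choose A hA using hA
  have hinv : ∀ w ∈ s, Function.invFunOn Q.map Q.dom (g (P.map w)) ∈ Q.dom ∧
      Q.map (Function.invFunOn Q.map Q.dom (g (P.map w))) = g (P.map w) := fun w hw =>
    ⟨Function.invFunOn_mem (h w hw), Function.invFunOn_eq (h w hw)⟩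
  have hinj : InjOn (fun w => Function.invFunOn Q.map Q.dom (g (P.map w))) s := by
    intro w hw v hv he
    have := congrArg Q.map he
    simp only [(hinv w hw).2, (hinv v hv).2] at this
    exact P.injOn (hsP hw) (hsP hv) (hg.injective this)
  have h1 := MeasureTheory.lintegral_abs_det_fderiv_eq_addHaar_image MeasureTheory.volume hs
    (fun w hw => (hA w hw).2.hasFDerivWithinAt) hinj
  have h2 : ∫⁻ w in s, ENNReal.ofReal |(A w).det| = MeasureTheory.volume s := by
    rw [← MeasureTheory.setLIntegral_one]
    refine MeasureTheory.setLIntegral_congr_fun hs fun w hw => ?_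
    simp only [(hA w hw).1, ENNReal.ofReal_one]
  rw [← h2, h1]
  refine MeasureTheory.measure_mono ?_
  rintro _ ⟨w, hw, rfl⟩
  exact ⟨(hinv w hw).1, by
    simp only [(hinv w hw).2]
    exact mem_image_of_mem _ (mem_image_of_mem _ hw)⟩

/-- Every point of a punctured disc is covered by a sector of angle less than `π`, in the natural
coordinate, around one of finitely many directions. -/
theorem exists_cpow_mul_eq {n : ℕ} (hn : n ≠ 0) {z : ℂ} (hz : z ≠ 0) :
    ∃ ζ w : ℂ, ζ ^ (2 * n) = 1 ∧ 0 < w.re ∧ w ^ ((2 / n : ℝ) : ℂ) * ζ = z := by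
  have hn0 : (0 : ℝ) < n := Nat.cast_pos.2 (Nat.pos_of_ne_zero hn)
  have hnc : (n : ℂ) ≠ 0 := Nat.cast_ne_zero.2 hn
  -- the direction `exp (π i j / n)` closest to that of `z`; the natural coordinate multiplies
  -- angles by `n / 2`
  obtain ⟨j, hj⟩ : ∃ j : ℤ, |z.arg * n / Real.pi - j| ≤ 1 / 2 := ⟨round _, abs_sub_round _⟩
  have hpi := Real.pi_pos
  set L : ℂ := (n / 2) * (Complex.log z - Real.pi * j / n * Complex.I) with hL
  have him : L.im = Real.pi / 2 * (z.arg * n / Real.pi - j) := by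
    have : L = ((n / 2 : ℝ) : ℂ) * (Complex.log z - ((Real.pi * j / n : ℝ) : ℂ) * Complex.I) := by
      rw [hL]; push_cast; ring
    rw [this, Complex.im_ofReal_mul, Complex.sub_im, Complex.im_ofReal_mul, Complex.log_im,
      Complex.I_im]
    field_simp
  refine ⟨Complex.exp (Real.pi * j / n * Complex.I), Complex.exp L, ?_, ?_, ?_⟩
  · rw [← Complex.exp_nat_mul, Complex.exp_eq_one_iff]
    refine ⟨j, ?_⟩
    push_cast; field_simp
  · rw [Complex.exp_re]
    refine mul_pos (Real.exp_pos _) (Real.cos_pos_of_mem_Ioo ?_)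
    rw [him]
    rw [abs_le] at hj
    constructor <;> nlinarith [hj.1, hj.2]
  · rw [Complex.cpow_def_of_ne_zero (Complex.exp_ne_zero _), Complex.log_exp, ← Complex.exp_add]
    · have : L * ((2 / n : ℝ) : ℂ) + Real.pi * j / n * Complex.I = Complex.log z := by
        rw [hL]; push_cast; field_simp; ring
      rw [this, Complex.exp_log hz]
    · rw [him]; rw [abs_le] at hj; nlinarith [hj.1, hj.2]
    · rw [him]; rw [abs_le] at hj; nlinarith [hj.1, hj.2]

variable (F) in
/-- A compact surface is covered by finitely many isometric pieces, except for finitely many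
points. -/
theorem exists_patches [CompactSpace S] : ∃ (ι : Type) (_ : Fintype ι) (P : ι → F.Patch)
    (C : Set S), C.Finite ∧ ∀ x, x ∉ C → ∃ i, x ∈ (P i).map '' (P i).dom := by
  have hR : ∀ p, ∃ R : ℝ, 0 < R ∧ ∀ z : ℂ, ‖z‖ < R ^ (2 / F.prong p : ℝ) →
      z ∈ (F.chart p).target := by
    intro p
    obtain ⟨ρ, hρ, hball⟩ := Metric.eventually_nhds_iff.1
      ((F.chart p).open_target.eventually_mem (F.zero_mem_target p))
    have hn : (0 : ℝ) < F.prong p := Nat.cast_pos.2 (F.prong_pos p)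
    refine ⟨ρ ^ (F.prong p / 2 : ℝ), Real.rpow_pos_of_pos hρ _, fun z hz => hball ?_⟩
    rw [← Real.rpow_mul hρ.le] at hz
    have e : (F.prong p / 2 : ℝ) * (2 / F.prong p) = 1 := by field_simp
    rw [e, Real.rpow_one] at hz
    rwa [dist_zero_right]
  choose R hR0 hR using hR
  obtain ⟨t, ht⟩ := CompactSpace.elim_nhds_subcover
    (fun p => {x | x ∈ (F.chart p).source ∧ ‖F.chart p x‖ < R p ^ (2 / F.prong p : ℝ)})
    (fun p => by
      have hch : Tendsto (fun x => ‖F.chart p x‖) (𝓝 p) (𝓝 0) := by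
        have := ((F.chart p).continuousAt (F.mem_source _)).norm.tendsto
        rwa [F.chart_self, norm_zero] at this
      filter_upwards [hch.eventually_lt_const (Real.rpow_pos_of_pos (hR0 p) _),
        (F.chart p).open_source.mem_nhds (F.mem_source p)] with x h1 h2
      exact ⟨h2, h1⟩)
  -- each disc of the subcover, without its centre, is covered by the sectors around `2 * prong` many
  -- directions
  have hfin : {i : S × ℂ | i.1 ∈ t ∧ i.2 ^ (2 * F.prong i.1) = 1}.Finite := by
    have : {i : S × ℂ | i.1 ∈ t ∧ i.2 ^ (2 * F.prong i.1) = 1} ⊆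
        ⋃ p ∈ (t : Set S), (fun ζ => (p, ζ)) '' {ζ : ℂ | ζ ^ (2 * F.prong p) = 1} := by
      rintro ⟨p, ζ⟩ ⟨hp, hζ⟩
      simp only [mem_iUnion]
      exact ⟨p, hp, ζ, hζ, rfl⟩
    exact (t.finite_toSet.biUnion fun p _ => (Marked.finite_pow_eq
      (mul_ne_zero two_ne_zero (F.prong_ne_zero p)) _).image _).subset this
  have hnorm : ∀ i : {i : S × ℂ | i.1 ∈ t ∧ i.2 ^ (2 * F.prong i.1) = 1}, ‖i.1.2‖ = 1 := by
    intro i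
    have := congrArg norm i.2.2
    rw [norm_pow, norm_one] at this
    exact (pow_eq_one_iff_of_nonneg (norm_nonneg _)
      (mul_ne_zero two_ne_zero (F.prong_ne_zero _))).1 this
  have htgt : ∀ i : {i : S × ℂ | i.1 ∈ t ∧ i.2 ^ (2 * F.prong i.1) = 1}, ∀ w : ℂ,
      ‖w‖ < R i.1.1 → w ^ ((2 / F.prong i.1.1 : ℝ) : ℂ) * i.1.2 ∈ (F.chart i.1.1).target := by
    intro i w hw
    apply hR
    rw [F.norm_cpow_mul _ (hnorm i)]
    exact Real.rpow_lt_rpow (norm_nonneg _) hw (F.two_div_prong_pos _)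
  let P : {i : S × ℂ | i.1 ∈ t ∧ i.2 ^ (2 * F.prong i.1) = 1} → F.Patch := fun i =>
    { map := F.sector i.1.1 i.1.2
      dom := {w | 0 < w.re ∧ ‖w‖ < R i.1.1}
      isOpen := (isOpen_lt continuous_const Complex.continuous_re).inter
        (isOpen_lt continuous_norm continuous_const)
      volume_lt_top := by
        refine (MeasureTheory.measure_mono fun w hw => ?_).trans_lt
          (MeasureTheory.measure_ball_lt_top (x := (0 : ℂ)) (r := R i.1.1))
        rw [Metric.mem_ball, dist_zero_right]
        exact hw.2
      slope := i.1.2 ^ F.prong i.1.1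
      norm_slope := by rw [norm_pow, hnorm, one_pow]
      isoAt := fun w hw => F.isoAt_sector (norm_ne_zero_iff.1 (by rw [hnorm]; exact one_ne_zero))
        hw.1 (htgt i w hw.2)
      injOn := by
        intro w hw v hv he
        have h1 := congrArg (F.quad i.1.1) he
        rw [F.quad_sector (htgt i w hw.2), F.quad_sector (htgt i v hv.2)] at h1
        have hζ : i.1.2 ^ F.prong i.1.1 ≠ 0 :=
          pow_ne_zero _ (norm_ne_zero_iff.1 (by rw [hnorm]; exact one_ne_zero))
        rcases sq_eq_sq_iff_eq_or_eq_neg.1 (mul_left_cancel₀ hζ h1) with h | h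
        · exact h
        · exfalso
          have h2 := hw.1
          rw [h, Complex.neg_re] at h2
          linarith [hv.1] }
  have := hfin.to_subtype
  obtain ⟨n, ⟨e⟩⟩ := Finite.exists_equiv_fin {i : S × ℂ | i.1 ∈ t ∧ i.2 ^ (2 * F.prong i.1) = 1}
  refine ⟨Fin n, inferInstance, fun j => P (e.symm j), (t : Set S), t.finite_toSet,
    fun x hx => ?_⟩
  have hxu : x ∈ ⋃ p ∈ t, {x | x ∈ (F.chart p).source ∧
      ‖F.chart p x‖ < R p ^ (2 / F.prong p : ℝ)} := by rw [ht]; trivial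
  simp only [mem_iUnion] at hxu
  obtain ⟨p, hp, hxs, hxn⟩ := hxu
  have hz : F.chart p x ≠ 0 := fun h => hx (by rw [F.eq_of_chart_eq_zero hxs h]; exact hp)
  obtain ⟨ζ, w, hζ, hw, he⟩ := exists_cpow_mul_eq (F.prong_ne_zero p) hz
  refine ⟨e ⟨(p, ζ), hp, hζ⟩, w, ?_, ?_⟩
  · beta_reduce
    rw [e.symm_apply_apply]
    refine ⟨hw, ?_⟩
    rw [← he, F.norm_cpow_mul p (hnorm ⟨(p, ζ), hp, hζ⟩)] at hxn
    exact (Real.rpow_lt_rpow_iff (norm_nonneg _) (hR0 p).le (F.two_div_prong_pos p)).1 hxn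
  · beta_reduce
    rw [e.symm_apply_apply]
    change (F.chart p).symm (w ^ ((2 / F.prong p : ℝ) : ℂ) * ζ) = x
    rw [he, (F.chart p).left_inv hxs]

/-- A nonempty open subset of the surface is infinite. -/
theorem infinite_of_isOpen (F : TransverseMeasuredFoliations S) {E : Set S} (hE : IsOpen E) (hne : E.Nonempty) : E.Infinite := by
  obtain ⟨x, hx⟩ := hne
  have h := (F.chart x).image_mem_nhds (F.mem_source x) (hE.mem_nhds hx)
  exact (infinite_of_mem_nhds _ h).of_image _

/-- Recurrence: because an affine map preserves the finite area of the surface, no nonempty open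
set is disjoint from all its images. -/
theorem IsAffine.exists_iterate_mem [CompactSpace S] {g : S → S} {μ : ℝ} (hμ : μ ≠ 0)
    (hg : F.IsAffine g μ) (hopen : IsOpenMap g) {E : Set S} (hE : IsOpen E) (hne : E.Nonempty) :
    ∃ n, 0 < n ∧ ∃ x ∈ E, g^[n] x ∈ E := by
  by_contra hcon
  push Not at hcon
  obtain ⟨ι, _, P, C, hC, hcov⟩ := F.exists_patches
  obtain ⟨x, hxE, hxC⟩ : ∃ x ∈ E, x ∉ C := by
    by_contra h
    push Not at h
    exact F.infinite_of_isOpen hE hne (hC.subset h)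
  obtain ⟨i, w₀, hw₀, rfl⟩ := hcov x hxC
  let s : Set ℂ := {w | w ∈ (P i).dom ∧ (P i).map w ∈ E}
  have hs : IsOpen s := by
    rw [isOpen_iff_mem_nhds]
    rintro w ⟨h1, h2⟩
    exact ((P i).isOpen.eventually_mem h1).and
      (((P i).isoAt w h1).1.eventually_mem (hE.mem_nhds h2))
  have hspos : 0 < MeasureTheory.volume s := hs.measure_pos _ ⟨w₀, hw₀, hxE⟩
  let A : ℕ → ι → Set ℂ := fun n j => {w | w ∈ (P j).dom ∧ (P j).map w ∈ g^[n] '' E}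
  have hgE : ∀ n, IsOpen (g^[n] '' E) := by
    intro n
    induction n with
    | zero => simpa using hE
    | succ n ih => rw [Function.iterate_succ', image_comp]; exact hopen _ ih
  have hA : ∀ n j, MeasurableSet (A n j) := by
    intro n j
    refine IsOpen.measurableSet ?_
    rw [isOpen_iff_mem_nhds]
    rintro w ⟨h1, h2⟩
    exact ((P j).isOpen.eventually_mem h1).and
      (((P j).isoAt w h1).1.eventually_mem ((hgE n).mem_nhds h2))
  -- the images `gⁿ E` of a wandering set are pairwise disjoint, and each of them has at least the
  -- area of the part `s` of `E`
  have hdisj : ∀ j, Pairwise (Function.onFun Disjoint fun n => A n j) := by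
    have key : ∀ j n d, 0 < d → Disjoint (A n j) (A (n + d) j) := by
      intro j n d hd
      rw [Set.disjoint_left]
      rintro w ⟨-, a, ha, hwa⟩ ⟨-, b, hb, hwb⟩
      rw [← hwa, Function.iterate_add_apply] at hwb
      rw [hg.injective.iterate n hwb.symm] at ha
      exact hcon d hd b hb ha
    intro j n m hnm
    rcases lt_or_gt_of_ne hnm with h | h
    · have := key j n (m - n) (by omega)
      rwa [Nat.add_sub_cancel' h.le] at this
    · have := (key j m (n - m) (by omega)).symm
      rwa [Nat.add_sub_cancel' h.le] at this
  have hle : ∀ n, MeasureTheory.volume s ≤ ∑ j, MeasureTheory.volume (A n j) := by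
    intro n
    have hgn := hg.iterate n
    have hμn := pow_ne_zero n hμ
    let sj : ι → Set ℂ := fun j => {w | w ∈ s ∧ g^[n] ((P i).map w) ∈ (P j).map '' (P j).dom}
    have hsj : ∀ j, MeasurableSet (sj j) := by
      intro j
      refine IsOpen.measurableSet ?_
      rw [isOpen_iff_mem_nhds]
      rintro w ⟨h1, h2⟩
      exact (hs.eventually_mem h1).and ((P i).exists_hasFDerivAt hμn hgn (P j) h1.1 h2).1
    have hbad : {w | w ∈ s ∧ g^[n] ((P i).map w) ∈ C}.Finite := by
      refine Finite.of_finite_image (hC.subset ?_) (f := fun w => g^[n] ((P i).map w)) ?_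
      · rintro _ ⟨w, hw, rfl⟩
        exact hw.2
      · intro w hw v hv he
        exact (P i).injOn hw.1.1 hv.1.1 (hgn.injective he)
    have hsub : s ⊆ {w | w ∈ s ∧ g^[n] ((P i).map w) ∈ C} ∪ ⋃ j, sj j := by
      intro w hw
      by_cases h : g^[n] ((P i).map w) ∈ C
      · exact Or.inl ⟨hw, h⟩
      · obtain ⟨j, hj⟩ := hcov _ h
        exact Or.inr (mem_iUnion.2 ⟨j, hw, hj⟩)
    calc MeasureTheory.volume s ≤ MeasureTheory.volume {w | w ∈ s ∧ g^[n] ((P i).map w) ∈ C} +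
          MeasureTheory.volume (⋃ j, sj j) :=
          (MeasureTheory.measure_mono hsub).trans (MeasureTheory.measure_union_le _ _)
      _ = MeasureTheory.volume (⋃ j, sj j) := by
          rw [hbad.measure_zero, zero_add]
      _ ≤ ∑ j, MeasureTheory.volume (sj j) := by
          exact MeasureTheory.measure_iUnion_fintype_le _ _
      _ ≤ ∑ j, MeasureTheory.volume (A n j) := by
          refine Finset.sum_le_sum fun j _ => ?_
          refine ((P i).volume_le hμn hgn (P j) (hsj j) (fun w hw => hw.1.1)
            (fun w hw => hw.2)).trans (MeasureTheory.measure_mono ?_)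
          rintro w ⟨h1, h2⟩
          refine ⟨h1, image_mono ?_ h2⟩
          rintro _ ⟨v, hv, rfl⟩
          exact hv.1.2
  have h1 : ∑' _n : ℕ, MeasureTheory.volume s = ⊤ :=
    ENNReal.tsum_const_eq_top_of_ne_zero hspos.ne'
  have h2 : ∑' n : ℕ, ∑ j, MeasureTheory.volume (A n j) ≤
      ∑ j, MeasureTheory.volume (P j).dom := by
    rw [Summable.tsum_finsetSum fun _ _ => ENNReal.summable]
    refine Finset.sum_le_sum fun j _ => ?_
    rw [← MeasureTheory.measure_iUnion (hdisj j) fun n => hA n j]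
    exact MeasureTheory.measure_mono (iUnion_subset fun n w hw => hw.1)
  have h3 : ∑ j, MeasureTheory.volume (P j).dom < ⊤ :=
    ENNReal.sum_lt_top.2 fun j _ => (P j).volume_lt_top
  exact absurd ((ENNReal.tsum_le_tsum hle).trans h2) (by rw [h1]; exact not_le.2 h3)

end TransverseMeasuredFoliations

/-! ### Density of separatrices -/

namespace LeafKind

theorem eq_cross_add (k : LeafKind) (w : ℂ) :
    w = k.other.cross w * k.dir + k.cross w * k.other.dir := by
  cases k
  · apply Complex.ext <;> simp [cross, dir, other]
  · apply Complex.ext <;> simp [cross, dir, other]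

theorem cross_mk (k : LeafKind) (s v : ℝ) : k.cross (s * k.dir + v * k.other.dir) = v := by
  cases k <;> simp [cross, dir, other]

theorem other_cross_mk (k : LeafKind) (s v : ℝ) :
    k.other.cross (s * k.dir + v * k.other.dir) = s := by
  cases k <;> simp [cross, dir, other]

theorem abs_re_im_lt (k : LeafKind) {s v r : ℝ} (hs : |s| < r) (hv : |v| < r) :
    |(s * k.dir + v * k.other.dir : ℂ).re| < r ∧ |(s * k.dir + v * k.other.dir : ℂ).im| < r := by
  cases k <;> simp [dir, other, hs, hv]

theorem abs_cross_lt (k : LeafKind) {w : ℂ} {r : ℝ} (h : ‖w‖ < r) : |k.cross w| < r := by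
  cases k
  · exact (Complex.abs_im_le_norm w).trans_lt h
  · exact (Complex.abs_re_le_norm w).trans_lt h

end LeafKind

theorem isPreconnected_punctured_ball (ρ : ℝ) : IsPreconnected {z : ℂ | z ≠ 0 ∧ ‖z‖ < ρ} := by
  have h : {z : ℂ | z ≠ 0 ∧ ‖z‖ < ρ} =
      (fun q : ℝ × ℝ => (q.1 : ℂ) * Complex.exp (q.2 * Complex.I)) '' (Ioo 0 ρ ×ˢ univ) := by
    ext z
    constructor
    · rintro ⟨h0, h1⟩
      exact ⟨(‖z‖, z.arg), ⟨⟨norm_pos_iff.2 h0, h1⟩, mem_univ _⟩, Complex.norm_mul_exp_arg_mul_I z⟩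
    · rintro ⟨⟨r, θ⟩, ⟨hr, -⟩, rfl⟩
      refine ⟨mul_ne_zero (Complex.ofReal_ne_zero.2 hr.1.ne') (Complex.exp_ne_zero _), ?_⟩
      rw [norm_mul, Complex.norm_exp_ofReal_mul_I, mul_one, Complex.norm_real,
        Real.norm_of_nonneg hr.1.le]
      exact hr.2
  rw [h]
  refine (isPreconnected_Ioo.prod isPreconnected_univ).image _ ?_
  apply Continuous.continuousOn
  fun_prop

namespace Marked

variable {S : Type*} [TopologicalSpace S] {f : S ≃ₜ S} {M : Marked f} {k : LeafKind}

theorem _root_.TransverseMeasuredFoliations.LineAt.contr_iterate {γ : ℝ → S} {t : ℝ}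
    (h : M.LineAt k.sgn γ t) (n : ℕ) :
    M.LineAt k.sgn (fun s => (M.contr k)^[n] (γ (M.stretch ^ n * s))) (t / M.stretch ^ n) := by
  induction n with
  | zero => simpa using h
  | succ n ih =>
    have := ih.contr
    rw [div_div, ← pow_succ] at this
    refine this.congr (Eventually.of_forall fun s => ?_)
    simp only
    rw [Function.iterate_succ_apply', ← mul_assoc, ← pow_succ]

theorem contr_contr_other_iterate (n : ℕ) (x : S) :
    (M.contr k)^[n] ((M.contr k.other)^[n] x) = x := by
  rw [M.contr_other]
  exact (Function.LeftInverse.iterate (M.contr k).apply_symm_apply n) x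

theorem contr_other_contr_iterate (n : ℕ) (x : S) :
    (M.contr k.other)^[n] ((M.contr k)^[n] x) = x := by
  rw [M.contr_other]
  exact (Function.LeftInverse.iterate (M.contr k).symm_apply_apply n) x

variable [T2Space S]

/-- The part of a leaf of kind `k` in a box in a natural chart lies in a separatrix as soon as
it meets it. -/
theorem box_mem_ray {y : S} (hy : M.prong y = 2) {r : ℝ}
    (hbox : ∀ w : ℂ, |w.re| < r → |w.im| < r → w ∈ (M.chart y).target ∧
      (M.chart y).symm w ∉ M.pts) {i : M.Prong k} {s s' v : ℝ} (hs : |s| < r) (hs' : |s'| < r)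
    (hv : |v| < r) (h : (M.chart y).symm (s * k.dir + v * k.other.dir) ∈ ray i '' Ici 0) :
    (M.chart y).symm (s' * k.dir + v * k.other.dir) ∈ ray i '' Ioi 0 := by
  have hmem : ∀ t ∈ Ioo (-r) r, v * k.other.dir + t * k.dir ∈ (M.chart y).target ∧
      (M.chart y).symm (v * k.other.dir + t * k.dir) ∉ M.pts := by
    intro t ht
    obtain ⟨h1, h2⟩ := k.abs_re_im_lt (abs_lt.2 ht) hv
    rw [add_comm]
    exact hbox _ h1 h2
  obtain ⟨T, hT, he⟩ := h
  have hT0 : 0 < T := by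
    refine lt_of_le_of_ne hT ?_
    rintro rfl
    apply (hmem s (abs_lt.1 hs)).2
    rw [add_comm, ← he, ray_zero]
    exact i.base_mem
  obtain ⟨η, -, h1⟩ := subset_ray (β := fun t : ℝ => (M.chart y).symm (v * k.other.dir + t * k.dir))
    ordConnected_Ioo (fun t ht => lineAt_chart_symm hy (hmem t ht).1)
    (fun t ht => (hmem t ht).2) (abs_lt.1 hs) hT0 (by rw [add_comm, ← he])
  obtain ⟨h2, h3⟩ := h1 s' (abs_lt.1 hs')
  rw [add_comm]
  exact ⟨_, h2, h3.symm⟩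

/-- The closure of a separatrix is saturated by the leaves in boxes. -/
theorem box_mem_closure_ray {y : S} (hy : M.prong y = 2) {r : ℝ}
    (hbox : ∀ w : ℂ, |w.re| < r → |w.im| < r → w ∈ (M.chart y).target ∧
      (M.chart y).symm w ∉ M.pts) {i : M.Prong k} {s s' v : ℝ} (hs : |s| < r) (hs' : |s'| < r)
    (hv : |v| < r)
    (h : (M.chart y).symm (s * k.dir + v * k.other.dir) ∈ closure (ray i '' Ici 0)) :
    (M.chart y).symm (s' * k.dir + v * k.other.dir) ∈ closure (ray i '' Ici 0) := by
  have h1 := k.abs_re_im_lt hs hv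
  have h2 := k.abs_re_im_lt hs' hv
  have ht := (hbox _ h1.1 h1.2).1
  have ht' := (hbox _ h2.1 h2.2).1
  rw [mem_closure_iff_frequently] at h ⊢
  have hmap : 𝓝 ((M.chart y).symm (s * k.dir + v * k.other.dir)) =
      map (M.chart y).symm (𝓝 (s * k.dir + v * k.other.dir)) :=
    ((M.chart y).symm.map_nhds_eq ht).symm
  rw [hmap, frequently_map] at h
  have htend : Tendsto (fun w : ℂ => (M.chart y).symm (s' * k.dir + k.cross w * k.other.dir))
      (𝓝 (s * k.dir + v * k.other.dir))
      (𝓝 ((M.chart y).symm (s' * k.dir + v * k.other.dir))) := by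
    have h3 : Continuous fun w : ℂ => (s' * k.dir + k.cross w * k.other.dir : ℂ) := by
      have := k.continuous_cross
      fun_prop
    have h4 := h3.tendsto (s * k.dir + v * k.other.dir)
    rw [k.cross_mk] at h4
    exact ((M.chart y).continuousAt_symm ht').tendsto.comp h4
  refine htend.frequently ?_
  have hev : ∀ᶠ w in 𝓝 (s * k.dir + v * k.other.dir : ℂ),
      |k.other.cross w| < r ∧ |k.cross w| < r := by
    have e1 := (k.other.continuous_cross.abs.tendsto (s * k.dir + v * k.other.dir))
    have e2 := (k.continuous_cross.abs.tendsto (s * k.dir + v * k.other.dir))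
    rw [k.other_cross_mk] at e1
    rw [k.cross_mk] at e2
    exact (e1.eventually_lt_const hs).and (e2.eventually_lt_const hv)
  refine (h.and_eventually hev).mono fun w hw => ?_
  have h5 := hw.1
  rw [k.eq_cross_add w] at h5
  exact image_mono Ioi_subset_Ici_self (box_mem_ray hy hbox hw.2.1 hs' hw.2.2 h5)

variable (M) in
/-- A punctured disc around a marked point is connected and contains no marked points. -/
theorem isPreconnected_disc_sdiff {p : S} (hp : p ∈ M.pts) :
    IsPreconnected (M.disc M.radius p \ {p}) ∧ Disjoint (M.disc M.radius p \ {p}) M.pts := by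
  constructor
  · have h : M.disc M.radius p \ {p} = (M.chart p).symm ''
        {z : ℂ | z ≠ 0 ∧ ‖z‖ < M.radius ^ (2 / M.prong p : ℝ)} := by
      ext x
      constructor
      · rintro ⟨h1, h2⟩
        exact ⟨M.chart p x, ⟨fun h0 => h2 (M.eq_of_chart_eq_zero h1.1 h0), h1.2⟩,
          (M.chart p).left_inv h1.1⟩
      · rintro ⟨z, ⟨h0, h1⟩, rfl⟩
        have ht := M.isRadius.mem_target p hp z h1
        refine ⟨⟨(M.chart p).map_target ht, by rwa [(M.chart p).right_inv ht]⟩, fun he => h0 ?_⟩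
        rw [← (M.chart p).right_inv ht, mem_singleton_iff.1 he, M.chart_self]
    rw [h]
    refine (isPreconnected_punctured_ball _).image _ fun z hz => ?_
    exact ((M.chart p).continuousAt_symm
      (M.isRadius.mem_target p hp z hz.2)).continuousWithinAt
  · rw [Set.disjoint_left]
    rintro q ⟨h1, h2⟩ hq
    exact h2 (M.isRadius.disjoint p hp q hq q h1
      (mem_of_mem_nhds (M.disc_mem_nhds M.isRadius.pos q))).symm

theorem _root_.IsPreconnected.inter_frontier_nonempty {X : Type*} [TopologicalSpace X] {s t : Set X}
    (hs : IsPreconnected s) (h1 : (s ∩ t).Nonempty) (h2 : (s ∩ tᶜ).Nonempty) :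
    (s ∩ frontier t).Nonempty := by
  by_contra h
  rw [not_nonempty_iff_eq_empty, ← disjoint_iff_inter_eq_empty, Set.disjoint_left] at h
  have hi : ∀ x ∈ s, x ∈ t → x ∈ interior t := fun x hx hxt => by
    by_contra hn
    exact h hx ⟨subset_closure hxt, hn⟩
  have hc : ∀ x ∈ s, x ∉ t → x ∈ (closure t)ᶜ := fun x hx hxt hn =>
    h hx ⟨hn, fun hn' => hxt (interior_subset hn')⟩
  obtain ⟨x, hx, hxt⟩ := h1
  obtain ⟨y, hy, hyt⟩ := h2
  obtain ⟨w, -, hw1, hw2⟩ := hs _ _ isOpen_interior isClosed_closure.isOpen_compl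
    (fun w hw => (em (w ∈ t)).imp (hi w hw) (hc w hw)) ⟨x, hx, hi x hx hxt⟩ ⟨y, hy, hc y hy hyt⟩
  exact hw2 (subset_closure (interior_subset hw1))

/-- If a separatrix is not dense, then its closure has an unmarked boundary point. -/
theorem exists_mem_frontier [ConnectedSpace S] (i : M.Prong k)
    (h : closure (ray i '' Ici 0) ≠ univ) :
    ∃ y ∈ frontier (closure (ray i '' Ici 0)), y ∉ M.pts := by
  have hne : (closure (ray i '' Ici 0)).Nonempty :=
    ⟨ray i 0, subset_closure ⟨0, mem_Ici.2 le_rfl, rfl⟩⟩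
  obtain ⟨x, hx⟩ := nonempty_frontier_iff.2 ⟨hne, h⟩
  by_cases hxp : x ∈ M.pts
  · obtain ⟨hpre, hdis⟩ := M.isPreconnected_disc_sdiff hxp
    have hD := M.disc_mem_nhds M.isRadius.pos x
    have hxX : x ∈ closure (ray i '' Ici 0) := isClosed_closure.frontier_subset hx
    have h1 : ((M.disc M.radius x \ {x}) ∩ closure (ray i '' Ici 0)).Nonempty := by
      have hxX' : x ∈ closure (ray i '' Ioi 0) := by
        have h1 : ray i '' Ici 0 ⊆ closure (ray i '' Ioi 0) := by
          rw [← closure_Ioi]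
          exact ((continuousOn_ray i).mono (by rw [closure_Ioi])).image_closure
        exact closure_minimal h1 isClosed_closure hxX
      obtain ⟨y, hy, t, ht, rfl⟩ := mem_closure_iff_nhds.1 hxX' _ hD
      refine ⟨ray i t, ⟨hy, ?_⟩, subset_closure ⟨t, mem_Ici.2 (le_of_lt ht), rfl⟩⟩
      intro he
      exact ray_notMem_pts i ht (mem_singleton_iff.1 he ▸ hxp)
    have h2 : ((M.disc M.radius x \ {x}) ∩ (closure (ray i '' Ici 0))ᶜ).Nonempty := by
      have hxc : x ∈ closure (closure (ray i '' Ici 0))ᶜ := by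
        rw [← frontier_compl] at hx
        exact frontier_subset_closure hx
      obtain ⟨y, hy, hyc⟩ := mem_closure_iff_nhds.1 hxc _ hD
      exact ⟨y, ⟨hy, fun he => hyc (mem_singleton_iff.1 he ▸ hxX)⟩, hyc⟩
    obtain ⟨y, hy1, hy2⟩ := hpre.inter_frontier_nonempty h1 h2
    exact ⟨y, hy2, Set.disjoint_left.1 hdis hy1⟩
  · exact ⟨x, hx, hxp⟩

/-- Every separatrix is dense. Otherwise there is a gap next to its closure `X`, in the transverse
direction. The points of the gap at a height above `X` in a fundamental domain `(a, c a)` form a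
wandering open set, as the height is multiplied by `c`; this contradicts recurrence. -/
theorem closure_ray [CompactSpace S] [ConnectedSpace S] (i : M.Prong k) :
    closure (ray i '' Ici 0) = univ := by
  by_contra hX
  obtain ⟨y, hyf, hyp⟩ := exists_mem_frontier i hX
  have hy2 := M.prong_eq_two hyp
  obtain ⟨r, hr, hbox'⟩ := exists_box hyp univ_mem
  have hbox : ∀ w : ℂ, |w.re| < r → |w.im| < r → w ∈ (M.chart y).target ∧
      (M.chart y).symm w ∉ M.pts := fun w h1 h2 => ⟨(hbox' w h1 h2).1, (hbox' w h1 h2).2.1⟩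
  obtain ⟨pt, hpt⟩ : ∃ pt : ℝ → ℝ → ℂ, ∀ s v, pt s v = s * k.dir + v * k.other.dir :=
    ⟨_, fun _ _ => rfl⟩
  have hptt : ∀ {s v : ℝ}, |s| < r → |v| < r → pt s v ∈ (M.chart y).target := fun hs hv => by
    rw [hpt]
    exact (hbox _ (k.abs_re_im_lt hs hv).1 (k.abs_re_im_lt hs hv).2).1
  obtain ⟨X, hXdef⟩ : ∃ X, X = closure (ray i '' Ici 0) := ⟨_, rfl⟩
  have hsat : ∀ {s s' v : ℝ}, |s| < r → |s'| < r → |v| < r →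
      (M.chart y).symm (pt s v) ∈ X → (M.chart y).symm (pt s' v) ∈ X := by
    intro s s' v hs hs' hv h
    rw [hpt, hXdef] at *
    exact box_mem_closure_ray hy2 hbox hs hs' hv h
  have h0r : |(0 : ℝ)| < r := by rwa [abs_zero]
  have hXc : IsClosed X := hXdef ▸ isClosed_closure
  -- a gap next to `X` in the transverse direction
  obtain ⟨v₁, η, d, hη, hd, hv₁, hgap⟩ : ∃ v₁ η d : ℝ, (η = 1 ∨ η = -1) ∧ 0 < d ∧
      (|v₁| < r ∧ (M.chart y).symm (pt 0 v₁) ∈ X) ∧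
      ∀ h, 0 < h → h ≤ d → |v₁ + η * h| < r ∧ (M.chart y).symm (pt 0 (v₁ + η * h)) ∉ X := by
    have hyX : y ∈ X := hXc.frontier_subset (hXdef ▸ hyf)
    obtain ⟨v₀, hv₀, hv₀X⟩ : ∃ v₀, |v₀| < r ∧ (M.chart y).symm (pt 0 v₀) ∉ X := by
      have hyc : y ∈ closure Xᶜ := by
        rw [hXdef]
        rw [← frontier_compl] at hyf
        exact frontier_subset_closure hyf
      have hch : Tendsto (fun x => ‖M.chart y x‖) (𝓝 y) (𝓝 0) := by
        have := ((M.chart y).continuousAt (M.mem_source _)).norm.tendsto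
        rwa [M.chart_self, norm_zero] at this
      obtain ⟨x, hxX, hxs, hxr⟩ := ((mem_closure_iff_frequently.1 hyc).and_eventually
        (((M.chart y).open_source.eventually_mem (M.mem_source y)).and
          (hch.eventually_lt_const hr))).exists
      refine ⟨k.cross (M.chart y x), k.abs_cross_lt hxr, fun h => hxX ?_⟩
      have := hsat (s' := k.other.cross (M.chart y x)) h0r (k.other.abs_cross_lt hxr)
        (k.abs_cross_lt hxr) h
      rwa [hpt, ← k.eq_cross_add, (M.chart y).left_inv hxs] at this
    have hpt0 : pt 0 0 = 0 := by rw [hpt]; simp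
    have hv₀0 : v₀ ≠ 0 := by
      rintro rfl
      rw [hpt0, M.chart_symm_zero] at hv₀X
      exact hv₀X hyX
    obtain ⟨η, hη, hηv⟩ : ∃ η : ℝ, (η = 1 ∨ η = -1) ∧ v₀ = η * |v₀| := by
      rcases lt_or_gt_of_ne hv₀0 with h | h
      · exact ⟨-1, Or.inr rfl, by rw [abs_of_neg h]; ring⟩
      · exact ⟨1, Or.inl rfl, by rw [abs_of_pos h]; ring⟩
    have habs : ∀ u ∈ Icc 0 |v₀|, |η * u| < r := by
      intro u hu
      have : |η| = 1 := by rcases hη with rfl | rfl <;> simp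
      rw [abs_mul, this, one_mul, abs_of_nonneg hu.1]
      exact hu.2.trans_lt hv₀
    have hcont : ContinuousOn (fun u : ℝ => (M.chart y).symm (pt 0 (η * u))) (Icc 0 |v₀|) := by
      intro u hu
      have h3 : Continuous fun u : ℝ => pt 0 (η * u) := by simp only [hpt]; fun_prop
      exact (ContinuousAt.comp (f := fun u : ℝ => pt 0 (η * u))
        ((M.chart y).continuousAt_symm (hptt h0r (habs u hu))) h3.continuousAt).continuousWithinAt
    have hKc : IsCompact (Icc 0 |v₀| ∩ (fun u : ℝ => (M.chart y).symm (pt 0 (η * u))) ⁻¹' X) :=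
      isCompact_Icc.of_isClosed_subset (hcont.preimage_isClosed_of_isClosed isClosed_Icc hXc)
        inter_subset_left
    -- the last point of `X` on the transverse segment from `y` to a point outside of `X`
    obtain ⟨u₁, ⟨hu₁, hu₁X⟩, hmax⟩ := hKc.exists_isGreatest ⟨0, ⟨le_rfl, abs_nonneg _⟩, by
      rw [mem_preimage, mul_zero, hpt0, M.chart_symm_zero]; exact hyX⟩
    have hlt : u₁ < |v₀| := by
      refine lt_of_le_of_ne hu₁.2 ?_
      rintro rfl
      rw [mem_preimage, ← hηv] at hu₁X
      exact hv₀X hu₁X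
    refine ⟨η * u₁, η, |v₀| - u₁, hη, by linarith, ⟨habs _ hu₁, hu₁X⟩, fun h h1 h2 => ?_⟩
    have hmem : u₁ + h ∈ Icc 0 |v₀| := ⟨by linarith [hu₁.1], by linarith⟩
    rw [← mul_add]
    refine ⟨habs _ hmem, fun hin => ?_⟩
    have := hmax ⟨hmem, hin⟩
    linarith
  have hη2 : η * η = 1 := by rcases hη with rfl | rfl <;> norm_num
  obtain ⟨m, hm, hper⟩ := M.exists_period
  obtain ⟨c, hc⟩ : ∃ c, c = M.stretch ^ m := ⟨_, rfl⟩
  have hc1 : 1 < c := hc ▸ one_lt_pow₀ M.one_lt_stretch hm.ne'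
  have hc0 : 0 < c := one_pos.trans hc1
  -- so that both the domain `(a, c * a)` and its double lie in the gap
  obtain ⟨a, ha⟩ : ∃ a, a = d / (2 * c) := ⟨_, rfl⟩
  have ha0 : 0 < a := by rw [ha]; positivity
  have had : 2 * (c * a) = d := by rw [ha]; field_simp
  have hac : a < c * a := lt_mul_of_one_lt_left ha0 hc1
  -- `X` is invariant under a power of the contraction
  have hinv : ∀ N, (M.contr k)^[m * N] '' X = X := by
    have h1 : (M.contr k)^[m] '' (ray i '' Ici 0) = ray i '' Ici 0 := by
      ext x
      constructor
      · rintro ⟨_, ⟨t, ht, rfl⟩, rfl⟩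
        rw [contr_iterate_ray i ht, hper]
        exact ⟨_, div_nonneg ht (pow_pos M.stretch_pos m).le, rfl⟩
      · rintro ⟨t, ht, rfl⟩
        have ht' : 0 ≤ M.stretch ^ m * t := mul_nonneg (pow_pos M.stretch_pos m).le ht
        refine ⟨_, ⟨M.stretch ^ m * t, ht', rfl⟩, ?_⟩
        rw [contr_iterate_ray i ht', hper, mul_div_cancel_left₀ _ (pow_pos M.stretch_pos m).ne']
    have h2 : ∀ n, ∀ A : Set S, (M.contr k)^[n] '' closure A = closure ((M.contr k)^[n] '' A) := by
      intro n
      induction n with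
      | zero => simp
      | succ n ih =>
        intro A
        rw [Function.iterate_succ', image_comp, ih, image_comp, Homeomorph.image_closure]
    have h3 : (M.contr k)^[m] '' X = X := by rw [hXdef, h2, h1]
    intro N
    rw [Function.iterate_mul]
    induction N with
    | zero => simp
    | succ N ih => rw [Function.iterate_succ, image_comp, h3, ih]
  have hinv' : ∀ N x, x ∈ X → (M.contr k.other)^[m * N] x ∈ X := by
    intro N x hx
    rw [← hinv N] at hx
    obtain ⟨z, hz, rfl⟩ := hx
    rwa [contr_other_contr_iterate]
  -- the wandering open set
  let E : Set S := (M.chart y).source ∩ M.chart y ⁻¹'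
    {w | |k.other.cross w| < r ∧ a < η * (k.cross w - v₁) ∧ η * (k.cross w - v₁) < c * a}
  have hEo : IsOpen E := by
    refine (M.chart y).continuousOn.isOpen_inter_preimage (M.chart y).open_source ?_
    have h1 := k.continuous_cross
    have h2 := k.other.continuous_cross
    have h3 : Continuous fun w => η * (k.cross w - v₁) :=
      continuous_const.mul (h1.sub continuous_const)
    exact (isOpen_lt h2.abs continuous_const).inter
      ((isOpen_lt continuous_const h3).inter (isOpen_lt h3 continuous_const))
  have hEmem : ∀ x ∈ E, ∃ s h, |s| < r ∧ a < h ∧ h < c * a ∧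
      x = (M.chart y).symm (pt s (v₁ + η * h)) := by
    rintro x ⟨hxs, h1, h2, h3⟩
    refine ⟨_, _, h1, h2, h3, ?_⟩
    rw [← mul_assoc, hη2, one_mul, add_sub_cancel, hpt, ← k.eq_cross_add, (M.chart y).left_inv hxs]
  have hEne : E.Nonempty := by
    have h1 := (hgap ((a + c * a) / 2) (by linarith) (by linarith)).1
    refine ⟨(M.chart y).symm (pt 0 (v₁ + η * ((a + c * a) / 2))),
      (M.chart y).map_target (hptt h0r h1), ?_⟩
    rw [mem_preimage, (M.chart y).right_inv (hptt h0r h1), mem_ofPred_eq, hpt, k.other_cross_mk,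
      k.cross_mk, add_sub_cancel_left, ← mul_assoc, hη2, one_mul]
    exact ⟨h0r, by linarith, by linarith⟩
  obtain ⟨n, hn, x, hxE, hxE'⟩ :=
    ((M.isAffine_contr k).iterate m).exists_iterate_mem (pow_ne_zero m (M.rate_ne_zero k))
      (by
        have : ∀ n, IsOpenMap (M.contr k)^[n] := by
          intro n
          induction n with
          | zero => exact IsOpenMap.id
          | succ n ih => rw [Function.iterate_succ']; exact (M.contr k).isOpenMap.comp ih
        exact this m) hEo hEne
  rw [← Function.iterate_mul] at hxE'
  obtain ⟨s, h, hs, hh1, hh2, rfl⟩ := hEmem x hxE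
  obtain ⟨s', h', hs', hh1', hh2', he'⟩ := hEmem _ hxE'
  have hline : ∀ s, |s| < r → ∀ v, |v| < r → M.LineAt k.other.sgn
      (fun v : ℝ => (M.chart y).symm (s * k.dir + v * k.other.dir)) v := by
    intro s hs v hv
    have h3 := hptt hs hv
    rw [hpt] at h3
    exact lineAt_chart_symm hy2 h3
  have hrange : ∀ u, 0 ≤ u → u < d → |v₁ + η * u| < r := by
    intro u hu hud
    rcases hu.eq_or_lt with rfl | hu
    · rw [mul_zero, add_zero]; exact hv₁.1
    · exact (hgap u hu hud.le).1
  -- the transverse segment from the returning point to `X`, pulled back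
  have hcN : M.stretch ^ (m * n) = c ^ n := by rw [hc, pow_mul]
  have hcn : c ≤ c ^ n := le_self_pow₀ hc1.le hn.ne'
  have hcn0 : 0 < c ^ n := pow_pos hc0 n
  have hlen : h' / c ^ n < a := by
    rw [div_lt_iff₀ hcn0]
    calc h' < c * a := hh2'
      _ ≤ a * c ^ n := by rw [mul_comm]; exact mul_le_mul_of_nonneg_left hcn ha0.le
  have hlen0 : 0 ≤ h' / c ^ n := div_nonneg (ha0.trans hh1').le hcn0.le
  let π : ℝ → S := fun u => (M.contr k.other)^[m * n]
    ((M.chart y).symm (s' * k.dir + ((-η * (c ^ n * u) + (v₁ + η * h') : ℝ) : ℂ) * k.other.dir))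
  have hπ : ∀ u ∈ Icc 0 (h' / c ^ n), M.LineAt k.other.sgn π u := by
    intro u hu
    have h1 : c ^ n * u ≤ h' := by
      have := hu.2
      rw [le_div_iff₀ hcn0] at this
      linarith
    have h2 : 0 ≤ c ^ n * u := mul_nonneg hcn0.le hu.1
    have h3 : M.LineAt k.other.sgn (fun v : ℝ => (M.chart y).symm (s' * k.dir + v * k.other.dir))
        (-η * (c ^ n * u) + (v₁ + η * h')) := by
      apply hline s' hs'
      have := hrange (h' - c ^ n * u) (by linarith) (by linarith)
      rwa [show v₁ + η * (h' - c ^ n * u) = -η * (c ^ n * u) + (v₁ + η * h') by ring] at this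
    have h4 := (h3.reflect (by rcases hη with rfl | rfl <;> simp)).contr_iterate (m * n)
    rw [hcN, mul_div_cancel_left₀ _ hcn0.ne'] at h4
    exact h4
  have hπ0 : π 0 = (M.chart y).symm (pt s (v₁ + η * h)) := by
    have : π 0 = (M.contr k.other)^[m * n] ((M.chart y).symm (pt s' (v₁ + η * h'))) := by
      simp only [π, mul_zero, zero_add, hpt]
    rw [this, ← he', contr_other_contr_iterate]
  have hπ1 : π (h' / c ^ n) ∈ X := by
    have e : -η * (c ^ n * (h' / c ^ n)) + (v₁ + η * h') = v₁ := by field_simp; ring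
    simp only [π, e]
    apply hinv'
    rw [← hpt]
    exact hsat h0r hs' hv₁.1 hv₁.2
  have hL := hline s hs (v₁ + η * h) (hrange h (by linarith) (by linarith))
  obtain ⟨η', hη', hev⟩ := (hπ 0 ⟨le_rfl, hlen0⟩).eq_or_flip hL (by rw [hπ0, hpt])
  have hrange' : ∀ u ∈ Icc 0 (h' / c ^ n), 0 < h + η * η' * u ∧ h + η * η' * u < d := by
    intro u hu
    have h1 := hu.1
    have h2 := hu.2
    rcases hη with rfl | rfl <;> rcases hη' with rfl | rfl <;> constructor <;> linarith
  -- the pulled back segment runs in the transverse leaf through the starting point, and it is shorter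
  -- than the height `h` of this point, so it ends in the gap, although its end belongs to `X`
  have heq := TransverseMeasuredFoliations.LineAt.eqOn
    (γ' := fun u : ℝ => (M.chart y).symm
      (s * k.dir + ((η' * u + (v₁ + η * h) : ℝ) : ℂ) * k.other.dir))
    isPreconnected_Icc hπ (fun u hu => ?_) ⟨le_rfl, hlen0⟩ (by
      filter_upwards [hev] with u hu
      rw [hu, sub_zero]) ⟨hlen0, le_rfl⟩
  · have e : η' * (h' / c ^ n) + (v₁ + η * h) = v₁ + η * (h + η * η' * (h' / c ^ n)) := by
      linear_combination (-(η' * (h' / c ^ n))) * hη2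
    obtain ⟨h1, h2⟩ := hrange' _ ⟨hlen0, le_rfl⟩
    obtain ⟨h3, h4⟩ := hgap _ h1 h2.le
    apply h4
    rw [heq] at hπ1
    beta_reduce at hπ1
    rw [e, ← hpt] at hπ1
    exact hsat hs h0r h3 hπ1
  · have h1 := hrange' u hu
    have h3 : M.LineAt k.other.sgn (fun v : ℝ => (M.chart y).symm (s * k.dir + v * k.other.dir))
        (η' * u + (v₁ + η * h)) := by
      apply hline s hs
      have := hrange _ h1.1.le h1.2
      rwa [show v₁ + η * (h + η * η' * u) = η' * u + (v₁ + η * h) by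
        linear_combination (η' * u) * hη2] at this
    exact h3.reflect hη'

/-- Every separatrix meets every transverse separatrix. -/
theorem exists_ray_eq_ray [CompactSpace S] [ConnectedSpace S] (i : M.Prong k)
    (j : M.Prong k.other) : ∃ s t, 0 < s ∧ 0 < t ∧ ray i s = ray j t := by
  have hyp : ray j 1 ∉ M.pts := ray_notMem_pts j one_pos
  have hy2 := M.prong_eq_two hyp
  obtain ⟨r, hr, hbox'⟩ := exists_box hyp univ_mem
  have hbox : ∀ w : ℂ, |w.re| < r → |w.im| < r → w ∈ (M.chart (ray j 1)).target ∧
      (M.chart (ray j 1)).symm w ∉ M.pts :=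
    fun w h1 h2 => ⟨(hbox' w h1 h2).1, (hbox' w h1 h2).2.1⟩
  have h0r : |(0 : ℝ)| < r := by rwa [abs_zero]
  have hch : Tendsto (fun x => ‖M.chart (ray j 1) x‖) (𝓝 (ray j 1)) (𝓝 0) := by
    have := ((M.chart (ray j 1)).continuousAt (M.mem_source _)).norm.tendsto
    rwa [M.chart_self, norm_zero] at this
  have hmem : ray j 1 ∈ closure (ray i '' Ici 0) := by rw [closure_ray i]; trivial
  obtain ⟨x, hxσ, hxs, hxr⟩ := ((mem_closure_iff_frequently.1 hmem).and_eventually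
    (((M.chart _).open_source.eventually_mem (M.mem_source _)).and
      (hch.eventually_lt_const hr))).exists
  obtain ⟨v, hv⟩ : ∃ v, v = k.cross (M.chart (ray j 1) x) := ⟨_, rfl⟩
  have hvr : |v| < r := hv ▸ k.abs_cross_lt hxr
  obtain ⟨s, hs, h1⟩ := box_mem_ray hy2 hbox (i := i) (s := k.other.cross (M.chart (ray j 1) x))
    (s' := 0) (v := v) (k.other.abs_cross_lt hxr) h0r hvr
    (by rwa [hv, ← k.eq_cross_add, (M.chart _).left_inv hxs])
  obtain ⟨t, ht, h2⟩ := box_mem_ray hy2 hbox (i := j) (s := 0) (s' := v) (v := 0) h0r hvr h0r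
    (by
      refine ⟨1, mem_Ici.2 zero_le_one, ?_⟩
      simp [M.chart_symm_zero])
  refine ⟨s, t, hs, ht, ?_⟩
  rw [h1, h2, k.other_other, add_comm]

theorem contr_iterate_ray_other {m : ℕ} (hm : ∀ (k : LeafKind) (i : M.Prong k), step^[m] i = i)
    (j : M.Prong k.other) {t : ℝ} (ht : 0 ≤ t) (N : ℕ) :
    (M.contr k)^[m * N] (ray j t) = ray j (M.stretch ^ (m * N) * t) := by
  have hp := pow_pos M.stretch_pos (m * N)
  have h := contr_iterate_ray j (mul_nonneg hp.le ht) (m * N)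
  have hstep : step^[m * N] j = j := by
    rw [Function.iterate_mul]; exact Function.iterate_fixed (hm _ j) N
  rw [mul_div_cancel_left₀ _ hp.ne', hstep] at h
  rw [← h, contr_contr_other_iterate]

/-- Transverse separatrices meet arbitrarily close to the origin of the first and arbitrarily far
on the second. -/
theorem exists_ray_eq_ray_lt [CompactSpace S] [ConnectedSpace S] (i : M.Prong k)
    (j : M.Prong k.other) {ε : ℝ} (hε : 0 < ε) (L : ℝ) :
    ∃ s t, 0 < s ∧ s < ε ∧ L < t ∧ 0 < t ∧ ray i s = ray j t := by
  obtain ⟨s, t, hs, ht, he⟩ := exists_ray_eq_ray i j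
  obtain ⟨m, hm, hper⟩ := M.exists_period
  have htend : Tendsto (fun N => M.stretch ^ (m * N)) atTop atTop :=
    (tendsto_pow_atTop_atTop_of_one_lt M.one_lt_stretch).comp
      (tendsto_id.const_mul_atTop' hm)
  obtain ⟨N, hN1, hN2⟩ := ((htend.eventually_gt_atTop (s / ε)).and
    (htend.eventually_gt_atTop (L / t))).exists
  have hp := pow_pos M.stretch_pos (m * N)
  refine ⟨s / M.stretch ^ (m * N), M.stretch ^ (m * N) * t, by positivity, ?_, ?_, by positivity, ?_⟩
  · rw [div_lt_iff₀ hp]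
    rw [div_lt_iff₀ hε] at hN1
    linarith
  · rwa [div_lt_iff₀ ht] at hN2
  · rw [← contr_iterate_ray_other hper j ht.le, ← he, contr_iterate_ray i hs.le]
    congr 1
    rw [Function.iterate_mul]; exact (Function.iterate_fixed (hper _ i) N).symm

end Marked

/-! ### Graphs made of initial segments of separatrices -/

namespace Marked

variable {S : Type*} [TopologicalSpace S] {f : S ≃ₜ S} {M : Marked f} {k : LeafKind} [T2Space S]

/-- The initial segments of length `T i` of all separatrices. -/
noncomputable def rayGraph (T : M.Prong k → ℝ) : Set (Set S) :=
  range fun i => ray i '' Icc 0 (T i)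

/-- The union of a family of initial segments, of lengths `b n`, of separatrices `J n`. -/
noncomputable def segments {ι : Type*} (J : ι → M.Prong k) (b : ι → ℝ) : Set S :=
  ⋃ n, ray (J n) '' Icc 0 (b n)

theorem mem_segments {ι : Type*} {J : ι → M.Prong k} {b : ι → ℝ} {x : S} :
    x ∈ segments J b ↔ ∃ n t, 0 ≤ t ∧ t ≤ b n ∧ x = ray (J n) t := by
  simp only [segments, mem_iUnion]
  constructor
  · rintro ⟨n, t, ht, rfl⟩
    exact ⟨n, t, ht.1, ht.2, rfl⟩
  · rintro ⟨n, t, h1, h2, rfl⟩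
    exact ⟨n, t, ⟨h1, h2⟩, rfl⟩

theorem sUnion_rayGraph (T : M.Prong k → ℝ) : ⋃₀ rayGraph T = segments id T := by
  rw [rayGraph, sUnion_range]
  rfl

theorem mem_sUnion_rayGraph {T : M.Prong k → ℝ} {x : S} :
    x ∈ ⋃₀ rayGraph T ↔ ∃ i t, 0 ≤ t ∧ t ≤ T i ∧ x = ray i t := by
  rw [sUnion_rayGraph, mem_segments]
  rfl

theorem pts_subset_sUnion_rayGraph {T : M.Prong k → ℝ} (hT : ∀ i, 0 < T i) {p : S}
    (hp : p ∈ M.pts) : p ∈ ⋃₀ rayGraph T := by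
  obtain ⟨i, rfl⟩ := exists_prong k hp
  exact mem_sUnion_rayGraph.2 ⟨i, 0, le_rfl, (hT i).le, (ray_zero i).symm⟩

theorem isCompact_segments {ι : Type*} [Finite ι] (J : ι → M.Prong k) (b : ι → ℝ) :
    IsCompact (segments J b) :=
  isCompact_iUnion fun _ => isCompact_Icc.image_of_continuousOn
    ((continuousOn_ray _).mono Icc_subset_Ici_self)

/-- Near a marked point, a union of segments of kind `k` lies in the local leaf. -/
theorem eventually_mem_localLeaf_of_mem_segments {ι : Type*} [Finite ι] (J : ι → M.Prong k)
    (b : ι → ℝ) {p : S} (hp : p ∈ M.pts) :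
    ∀ᶠ x in 𝓝 p, x ∈ segments J b → x ∈ M.localLeaf k p := by
  have h : ∀ n, ∀ᶠ x in 𝓝 p, x ∈ ray (J n) '' Icc 0 (b n) → x ∈ M.localLeaf k p := by
    intro n
    by_cases hm : p ∈ ray (J n) '' Icc 0 (b n)
    · obtain ⟨t, ht, he⟩ := hm
      have ht0 : t = 0 := by
        by_contra hne
        exact ray_notMem_pts (J n) (lt_of_le_of_ne ht.1 (Ne.symm hne)) (he ▸ hp)
      rw [ht0, ray_zero] at he
      rcases eq_or_lt_of_le (ht.1.trans ht.2) with h0 | h0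
      · rw [← h0, Icc_self, image_singleton, ray_zero, he]
        refine Eventually.of_forall fun x hx => ?_
        rw [mem_singleton_iff.1 hx]
        exact M.self_mem_localLeaf k p
      · have := (isLeafArc_ray (J n) h0).2 p ⟨0, ⟨le_rfl, h0.le⟩, by rw [ray_zero, he]⟩
        exact eventually_nhdsWithin_iff.1 this
    · have hcl : IsClosed (ray (J n) '' Icc 0 (b n)) :=
        (isCompact_Icc.image_of_continuousOn
          ((continuousOn_ray _).mono Icc_subset_Ici_self)).isClosed
      filter_upwards [hcl.isOpen_compl.mem_nhds hm] with x hx hx'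
      exact absurd hx' hx
  filter_upwards [eventually_all.2 h] with x hx hxs
  obtain ⟨n, hn⟩ := mem_iUnion.1 hxs
  exact hx n hn

/-- `T` is the first positive parameter at which the separatrix `i` meets `K`. -/
structure IsFirstHit (K : Set S) (i : M.Prong k) (T : ℝ) : Prop where
  pos : 0 < T
  mem : ray i T ∈ K
  notMem : ∀ t, 0 < t → t < T → ray i t ∉ K

theorem IsFirstHit.le {K : Set S} {i : M.Prong k} {T t : ℝ} (h : IsFirstHit K i T) (ht : 0 < t)
    (hK : ray i t ∈ K) : T ≤ t :=
  not_lt.1 fun h' => h.notMem t ht h' hK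

/-- A separatrix does not meet transverse segments near its base point. -/
theorem exists_pos_forall_notMem_segments {ι : Type*} [Finite ι] (J : ι → M.Prong k.other)
    (b : ι → ℝ) (i : M.Prong k) : ∃ ε > 0, ∀ t, 0 < t → t < ε → ray i t ∉ segments J b := by
  have hc : Tendsto (ray i) (𝓝[>] 0) (𝓝 i.base) := by
    have := ((continuousOn_ray i) 0 (mem_Ici.2 le_rfl)).tendsto
    rw [ray_zero] at this
    exact this.mono_left (nhdsWithin_mono _ Ioi_subset_Ici_self)
  have h := hc.eventually (eventually_mem_localLeaf_of_mem_segments J b i.base_mem)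
  obtain ⟨ε, hε, hε'⟩ := mem_nhdsGT_iff_exists_Ioo_subset.1 h
  refine ⟨min ε M.radius, lt_min hε M.isRadius.pos, fun t h0 ht hm => ?_⟩
  have h1 : ray i t ∈ M.localLeaf k.other i.base :=
    hε' ⟨h0, ht.trans_le (min_le_left _ _)⟩ hm
  -- the two local leaves at the base point have only this point in common
  have h2 := M.eq_of_mem_localLeaf
    (ray_mem_localLeaf_base i h0.le (ht.trans_le (min_le_right _ _))) h1
  exact h0.ne' ((ray_eq_base_iff i h0.le).1 h2)

theorem exists_isFirstHit {ι : Type*} [Finite ι] (J : ι → M.Prong k.other)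
    (b : ι → ℝ) (i : M.Prong k) {t : ℝ} (ht : 0 < t) (h : ray i t ∈ segments J b) :
    ∃ T ≤ t, IsFirstHit (segments J b) i T := by
  obtain ⟨ε, hε, hn⟩ := exists_pos_forall_notMem_segments J b i
  have hεt : ε ≤ t := not_lt.1 fun h' => hn t ht h' h
  have hcl : IsCompact (Icc ε t ∩ ray i ⁻¹' segments J b) := by
    have := ContinuousOn.preimage_isClosed_of_isClosed
      ((continuousOn_ray i).mono (t := Icc ε t) fun s hs => mem_Ici.2 (hε.le.trans hs.1))
      isClosed_Icc (isCompact_segments J b).isClosed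
    exact isCompact_Icc.of_isClosed_subset this inter_subset_left
  obtain ⟨T, ⟨hT, hTm⟩, hmin⟩ := hcl.exists_isLeast ⟨t, ⟨hεt, le_rfl⟩, h⟩
  refine ⟨T, hT.2, hε.trans_le hT.1, hTm, fun s h0 hs hm => ?_⟩
  have hεs : ε ≤ s := not_lt.1 fun h' => hn s h0 h' hm
  exact absurd (hmin ⟨⟨hεs, hs.le.trans hT.2⟩, hm⟩) (not_le.2 hs)

/-- The counterpart of `exists_ray_eq_ray_lt` for the transverse kind, which avoids `k.other.other`. -/
theorem exists_ray_other_eq_ray_lt [CompactSpace S] [ConnectedSpace S] (i : M.Prong k)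
    (j : M.Prong k.other) {ε : ℝ} (hε : 0 < ε) (L : ℝ) :
    ∃ s t, 0 < s ∧ s < ε ∧ L < t ∧ 0 < t ∧ ray j s = ray i t := by
  cases k
  · exact exists_ray_eq_ray_lt (k := .unstable) j i hε L
  · exact exists_ray_eq_ray_lt (k := .stable) j i hε L

theorem exists_forall_isFirstHit [CompactSpace S] [ConnectedSpace S] {ι : Type*} [Finite ι]
    (J : ι → M.Prong k.other) (b : ι → ℝ) (hb : ∃ n, 0 < b n) :
    ∃ T : M.Prong k → ℝ, ∀ i, IsFirstHit (segments J b) i (T i) := by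
  obtain ⟨n, hn⟩ := hb
  have h : ∀ i : M.Prong k, ∃ T, IsFirstHit (segments J b) i T := by
    intro i
    obtain ⟨s, t, hs, hsb, -, ht, he⟩ := exists_ray_other_eq_ray_lt i (J n) hn 0
    obtain ⟨T, -, hT⟩ := exists_isFirstHit J b i ht
      (he ▸ mem_segments.2 ⟨n, s, hs.le, hsb.le, rfl⟩)
    exact ⟨T, hT⟩
  choose T hT using h
  exact ⟨T, hT⟩

/-- First hits of a set that is invariant under expansion along the separatrices. -/
theorem IsFirstHit.div_le {K : Set S} {T : M.Prong k → ℝ} (hT : ∀ i, IsFirstHit K i (T i))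
    (hK : ∀ x ∈ K, (M.contr k).symm x ∈ K) (i : M.Prong k) : T i / M.stretch ≤ T (step i) := by
  have hs := M.stretch_pos
  have h1 : 0 < M.stretch * T (step i) := mul_pos hs (hT (step i)).pos
  have h2 : ray i (M.stretch * T (step i)) ∈ K := by
    have := hK _ (hT (step i)).mem
    rwa [(by rw [contr_ray i h1.le, mul_div_cancel_left₀ _ hs.ne'] :
      ray (step i) (T (step i)) = M.contr k (ray i (M.stretch * T (step i)))),
      Homeomorph.symm_apply_apply] at this
  rw [div_le_iff₀' hs]
  exact (hT i).le h1 h2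

theorem arcEnds_ray (i : M.Prong k) {T : ℝ} (hT : 0 < T) :
    arcEnds (ray i '' Icc 0 T) = {i.base, ray i T} :=
  (isLeafArc_ray i hT).1.arcEnds_eq

theorem step_iterate_bijective (n : ℕ) : Function.Bijective (step : M.Prong k → M.Prong k)^[n] :=
  step_bijective.iterate n

theorem contr_symm_iterate_ray (i : M.Prong k) {t : ℝ} (h0 : 0 ≤ t) (n : ℕ) :
    (M.contr k).symm^[n] (ray (step^[n] i) t) = ray i (M.stretch ^ n * t) := by
  have hs : 0 < M.stretch ^ n := pow_pos M.stretch_pos n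
  have h := contr_iterate_ray i (mul_nonneg hs.le h0) n
  rw [mul_div_cancel_left₀ _ hs.ne'] at h
  rw [← h]
  exact (M.contr k).toEquiv.left_inv.iterate n _

/-- The expanding iterates lengthen the edges of a graph by powers of the stretch factor. -/
theorem image_rayGraph (T : M.Prong k → ℝ) (n : ℕ) :
    (fun J => (M.contr k).symm^[n] '' J) '' rayGraph T =
      rayGraph fun i => M.stretch ^ n * T (step^[n] i) := by
  have hs : 0 < M.stretch ^ n := pow_pos M.stretch_pos n
  have h : ∀ i : M.Prong k, (M.contr k).symm^[n] '' (ray (step^[n] i) '' Icc 0 (T (step^[n] i))) =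
      ray i '' Icc 0 (M.stretch ^ n * T (step^[n] i)) := by
    intro i
    apply Subset.antisymm
    · rintro _ ⟨_, ⟨t, ht, rfl⟩, rfl⟩
      exact ⟨_, ⟨mul_nonneg hs.le ht.1, mul_le_mul_of_nonneg_left ht.2 hs.le⟩,
        (contr_symm_iterate_ray i ht.1 n).symm⟩
    · rintro _ ⟨t, ht, rfl⟩
      refine ⟨_, ⟨t / M.stretch ^ n, ⟨div_nonneg ht.1 hs.le, (div_le_iff₀' hs).2 ht.2⟩, rfl⟩, ?_⟩
      rw [contr_symm_iterate_ray i (div_nonneg ht.1 hs.le), mul_div_cancel₀ _ hs.ne']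
  apply Subset.antisymm
  · rintro _ ⟨_, ⟨i, rfl⟩, rfl⟩
    obtain ⟨i, rfl⟩ := (step_iterate_bijective n).2 i
    exact ⟨i, (h i).symm⟩
  · rintro _ ⟨i, rfl⟩
    exact ⟨_, ⟨step^[n] i, rfl⟩, h i⟩

end Marked

namespace PseudoAnosov

open Marked

variable {S : Type*} [TopologicalSpace S] {f : S ≃ₜ S} (F : PseudoAnosov f) {k : LeafKind}

/-- A pseudo-Anosov homeomorphism with a finite invariant set of marked points containing
`Sing(f)`. -/
abbrev mark (P : Set S) (hP : P.Finite) (hinv : f '' P = P) (hsub : F.sing ⊆ P) : Marked f where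
  toTransverseMeasuredFoliations := F.toTransverseMeasuredFoliations
  stretch := F.stretch
  one_lt_stretch := F.one_lt_stretch
  prong_map := F.prong_map
  map_chart := F.map_chart
  pts := P
  pts_finite := hP
  pts_nonempty := F.sing_nonempty.mono hsub
  pts_invariant := hinv
  mem_pts p hp := hsub <| by
    rw [F.sing_eq ⟨p, hp⟩]
    exact hp

/-- A pseudo-Anosov homeomorphism, with the points of `Sing(f)` as marked points. -/
abbrev marked : Marked f := F.mark F.sing F.sing_finite F.sing_invariant Subset.rfl

variable {F}

theorem symm_mem_backwardSegments {z x : S} (hx : x ∈ F.backwardSegments z) :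
    f.symm x ∈ F.backwardSegments z := by
  obtain ⟨n, hn⟩ := mem_iUnion.1 hx
  refine mem_iUnion.2 ⟨n + 1, ?_⟩
  rw [mem_preimage, Function.iterate_succ_apply, f.apply_symm_apply]
  exact hn

variable [T2Space S]

/-- The graph generated by `K` consists of one edge per separatrix, up to its first hit of `K`. -/
theorem generatedGraph_eq {K : Set S} {T : F.marked.Prong k → ℝ}
    (hT : ∀ i, IsFirstHit K i (T i)) : F.generatedGraph k K = rayGraph T := by
  ext I
  constructor
  · rintro ⟨p, hp, x, hx, hI, hdis⟩
    obtain ⟨i, rfl, t, ht, rfl, rfl⟩ := exists_eq_image_ray_Icc (M := F.marked) hI hp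
    refine ⟨i, ?_⟩
    rcases eq_or_lt_of_le ((hT i).le ht hx) with h | h
    · rw [← h]
    · refine absurd (hT i).mem (Set.disjoint_left.1 hdis ⟨⟨_, ⟨(hT i).pos.le, h.le⟩, rfl⟩, ?_⟩)
      rintro (h' | h')
      · exact (hT i).pos.ne' ((ray_eq_base_iff i (hT i).pos.le).1 h')
      · exact h.ne (ray_inj (hT i).pos.le ht h').2
  · rintro ⟨i, rfl⟩
    refine ⟨i.base, i.base_mem, ray i (T i), (hT i).mem, isLeafArc_ray i (hT i).pos,
      Set.disjoint_left.2 ?_⟩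
    rintro _ ⟨⟨t, ht, rfl⟩, hn⟩
    refine (hT i).notMem t (lt_of_le_of_ne ht.1 ?_) (lt_of_le_of_ne ht.2 ?_)
    · rintro rfl
      exact hn (Or.inl (ray_zero i))
    · rintro rfl
      exact hn (Or.inr rfl)

theorem contr_image_sUnion_rayGraph {T : F.marked.Prong k → ℝ}
    (hstep : ∀ i, T i / F.stretch ≤ T (step i)) {x : S} (hx : x ∈ ⋃₀ rayGraph T) :
    F.marked.contr k x ∈ ⋃₀ rayGraph T := by
  obtain ⟨i, t, h0, ht, rfl⟩ := mem_sUnion_rayGraph.1 hx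
  rw [contr_ray i h0]
  exact mem_sUnion_rayGraph.2 ⟨_, _, div_nonneg h0 F.marked.stretch_pos.le,
    (div_le_div_of_nonneg_right ht F.marked.stretch_pos.le).trans (hstep i), rfl⟩

/-- The inequality `hstep` on the lengths expresses the invariance of the graph. -/
theorem isAdapted_rayGraph {T : F.marked.Prong k → ℝ} (hT : ∀ i, 0 < T i)
    (hstep : ∀ i, T i / F.stretch ≤ T (step i))
    (hend : ∀ i, ∃ q ∈ F.sing, ray i (T i) ∈ F.leaf k.other q) : F.IsAdapted k (rayGraph T) where
  finite := finite_range _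
  isLeafArc := by
    rintro _ ⟨i, rfl⟩
    exact ⟨_, _, isLeafArc_ray i (hT i)⟩
  invariant := by
    have h := fun x => contr_image_sUnion_rayGraph (x := x) hstep
    cases k
    · exact image_subset_iff.2 h
    · exact image_subset_iff.2 h
  subset_leaf := by
    rintro _ ⟨i, rfl⟩
    refine ⟨i.base, i.base_mem, ?_⟩
    rintro _ ⟨t, ht, rfl⟩
    exact ray_mem_leaf i ht.1
  separatrix := by
    intro p hp σ hσ
    obtain ⟨i, rfl, rfl⟩ := exists_eq_of_isSeparatrix (M := F.marked) hp hσ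
    refine ⟨_, ⟨i, rfl⟩, ⟨_, (isLeafArc_ray i (hT i)).1⟩, ?_⟩
    rintro _ ⟨⟨t, ht, rfl⟩, hn⟩
    refine ⟨t, lt_of_le_of_ne ht.1 ?_, rfl⟩
    rintro rfl
    exact hn (ray_zero i)
  ends := by
    rintro _ ⟨i, rfl⟩ a ha
    simp only [arcEnds_ray i (hT i)] at ha
    rcases ha with rfl | rfl
    · exact ⟨_, i.base_mem, Or.inl rfl⟩
    · exact hend i

/-- A point of a separatrix of kind `k` has primitive segment the initial segment of the
separatrix. -/
theorem primitiveSegment_ray (τ : F.marked.Prong .unstable) {b : ℝ} (hb : 0 < b) :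
    F.primitiveSegment (ray τ b) = ray τ '' Icc 0 b := by
  ext x
  constructor
  · rintro ⟨q, hq, J, hJ, hx⟩
    obtain ⟨j, rfl, t, ht, he, rfl⟩ := exists_eq_image_ray_Icc (M := F.marked) hJ hq
    obtain ⟨rfl, rfl⟩ := ray_inj hb.le ht he
    exact hx
  · exact fun hx => ⟨_, τ.base_mem, _, isLeafArc_ray τ hb, hx⟩

/-- The backward iterates of a primitive segment form a finite union of segments of separatrices, one
for each separatrix in the orbit. -/
theorem backwardSegments_ray (τ : F.marked.Prong .unstable) {b : ℝ} (hb : 0 < b) {m : ℕ}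
    (hm0 : 0 < m) (hm : step^[m] τ = τ) :
    F.backwardSegments (ray τ b) =
      segments (fun n : Fin m => step^[n] τ) (fun n : Fin m => b / F.stretch ^ (n : ℕ)) := by
  have hs : 0 < F.stretch := F.marked.stretch_pos
  ext x
  simp only [backwardSegments, primitiveSegment_ray τ hb, mem_iUnion, mem_segments]
  constructor
  · rintro ⟨n, t, ht, he⟩
    have h1 : x = ray (step^[n] τ) (t / F.stretch ^ n) := by
      have h2 := contr_iterate_ray τ ht.1 n
      rw [he] at h2
      exact (f.toEquiv.left_inv.iterate n x).symm.trans h2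
    -- among the segments on the same separatrix, the one with the least number of iterations contains
    -- the others
    refine ⟨⟨n % m, Nat.mod_lt _ hm0⟩, _, div_nonneg ht.1 (pow_pos hs n).le, ?_, ?_⟩
    · calc t / F.stretch ^ n ≤ b / F.stretch ^ n := div_le_div_of_nonneg_right ht.2 (pow_pos hs n).le
        _ ≤ b / F.stretch ^ (n % m) := div_le_div_of_nonneg_left hb.le (pow_pos hs _)
          (pow_le_pow_right₀ F.one_lt_stretch.le (Nat.mod_le n m))
    · rw [h1]
      congr 1
      exact (Function.IsPeriodicPt.iterate_mod_apply hm n).symm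
  · rintro ⟨n, t, h0, ht, rfl⟩
    have hp := pow_pos hs (n : ℕ)
    refine ⟨n, F.stretch ^ (n : ℕ) * t, ⟨mul_nonneg hp.le h0, ?_⟩, ?_⟩
    · rwa [le_div_iff₀' hp] at ht
    · exact (contr_symm_iterate_ray τ h0 n).symm

/-- The separatrix data of a first intersection point. -/
theorem IsFirstIntersection.exists_ray {z : S} (h : F.IsFirstIntersection z) :
    ∃ (σ : F.marked.Prong .stable) (τ : F.marked.Prong .unstable) (a b : ℝ), 0 < a ∧ 0 < b ∧
      z = ray σ a ∧ z = ray τ b ∧ ∀ s t, 0 < s → s ≤ a → 0 < t → t ≤ b → ray σ s = ray τ t →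
        s = a ∧ t = b := by
  obtain ⟨-, p, hp, q, hq, I, J, hI, hJ, hIJ⟩ := h
  obtain ⟨σ, rfl, a, ha, hza, rfl⟩ := exists_eq_image_ray_Icc (M := F.marked) hI hp
  obtain ⟨τ, rfl, b, hb, hzb, rfl⟩ := exists_eq_image_ray_Icc (M := F.marked) hJ hq
  refine ⟨σ, τ, a, b, ha, hb, hza, hzb, fun s t hs hsa ht htb he => ?_⟩
  have h1 : ray σ s ∈ ({z} : Set S) := by
    rw [← hIJ]
    refine ⟨⟨⟨s, ⟨hs.le, hsa⟩, rfl⟩, fun h' => hs.ne' ((ray_eq_base_iff σ hs.le).1 h')⟩, ?_⟩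
    rw [he]
    exact ⟨⟨t, ⟨ht.le, htb⟩, rfl⟩, fun h' => ht.ne' ((ray_eq_base_iff τ ht.le).1 h')⟩
  have h2 : ray σ s = z := h1
  exact ⟨(ray_inj hs.le ha (h2.trans hza)).2, (ray_inj ht.le hb (he.symm.trans (h2.trans hzb))).2⟩

theorem isFirstIntersection_ray {σ : F.marked.Prong .stable} {τ : F.marked.Prong .unstable}
    {a b : ℝ} (ha : 0 < a) (hb : 0 < b) (hab : ray σ a = ray τ b)
    (h : ∀ s t, 0 < s → s ≤ a → 0 < t → t ≤ b → ray σ s = ray τ t → s = a ∧ t = b) :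
    F.IsFirstIntersection (ray σ a) := by
  refine ⟨ray_notMem_pts σ ha, σ.base, σ.base_mem, τ.base, τ.base_mem, _, _,
    isLeafArc_ray σ ha, hab ▸ isLeafArc_ray τ hb, ?_⟩
  apply Subset.antisymm
  · rintro _ ⟨⟨⟨s, hs, rfl⟩, hsn⟩, ⟨t, ht, hst⟩, htn⟩
    have hs0 : 0 < s := lt_of_le_of_ne hs.1 fun h0 => hsn (by rw [← h0, ray_zero]; rfl)
    have ht0 : 0 < t := lt_of_le_of_ne ht.1 fun h0 => htn (by rw [← hst, ← h0, ray_zero]; rfl)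
    rw [(h s t hs0 hs.2 ht0 ht.2 hst.symm).1]
    rfl
  · rintro _ rfl
    refine ⟨⟨⟨a, ⟨ha.le, le_rfl⟩, rfl⟩, fun h' => ha.ne' ((ray_eq_base_iff σ ha.le).1 h')⟩, ?_⟩
    rw [hab]
    exact ⟨⟨b, ⟨hb.le, le_rfl⟩, rfl⟩, fun h' => hb.ne' ((ray_eq_base_iff τ hb.le).1 h')⟩

end PseudoAnosov

/-! ### Naturality -/

section Naturality

variable {S T : Type*} [TopologicalSpace S] [TopologicalSpace T]

/-- A homeomorphism that maps stable and unstable intervals to stable and unstable intervals. -/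
structure PreservesLeaves (F : TransverseMeasuredFoliations S) (G : TransverseMeasuredFoliations T)
    (h : S ≃ₜ T) : Prop where
  isLeafArc_iff : ∀ k A a b, F.IsLeafArc k A a b ↔ G.IsLeafArc k (h '' A) (h a) (h b)

variable {F : TransverseMeasuredFoliations S} {G : TransverseMeasuredFoliations T} {h : S ≃ₜ T}
  {k : LeafKind} {δ : Set (Set S)}

theorem preservesLeaves_of_localLeaf
    (H : ∀ k p, ∀ᶠ x in 𝓝 p, x ∈ F.localLeaf k p ↔ h x ∈ G.localLeaf k (h p)) :
    PreservesLeaves F G h where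
  isLeafArc_iff k A a b := by
    have h1 : IsArc A a b ↔ IsArc (h '' A) (h a) (h b) := by
      refine ⟨fun h' => h'.image h.continuous h.injective, fun h' => ?_⟩
      simpa [image_image] using h'.image h.symm.continuous h.symm.injective
    refine and_congr h1 ?_
    rw [forall_mem_image]
    refine forall₂_congr fun p _ => ?_
    rw [← h.isEmbedding.map_nhdsWithin_eq, eventually_map]
    exact eventually_congr ((H k p).filter_mono nhdsWithin_le_nhds)

theorem PreservesLeaves.symm (H : PreservesLeaves F G h) : PreservesLeaves G F h.symm where
  isLeafArc_iff k A a b := by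
    rw [H.isLeafArc_iff, image_image]
    simp

theorem Homeomorph.mem_image_image_sUnion {x : S} :
    h x ∈ ⋃₀ ((fun A => h '' A) '' δ) ↔ x ∈ ⋃₀ δ := by
  simp only [mem_sUnion, mem_image, exists_exists_and_eq_and, h.injective.eq_iff, exists_eq_right]

theorem Homeomorph.coe_symm_image_coe_image (h : S ≃ₜ T) (A : Set S) : h.symm '' (h '' A) = A := by
  simp [image_image]

theorem Homeomorph.coe_image_coe_symm_image (h : S ≃ₜ T) (A : Set T) : h '' (h.symm '' A) = A := by
  simp [image_image]

theorem Homeomorph.image_image_symm_image (h : S ≃ₜ T) (δ : Set (Set T)) :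
    (fun A => h '' A) '' ((fun A => h.symm '' A) '' δ) = δ := by
  simp [image_image]

theorem PreservesLeaves.isRegularRail (H : PreservesLeaves F G h) {J : Set S}
    (hJ : F.IsRegularRail k δ J) : G.IsRegularRail k ((fun A => h '' A) '' δ) (h '' J) := by
  obtain ⟨a, b, h1, h2, h3, h4⟩ := hJ
  refine ⟨h a, h b, (H.isLeafArc_iff _ _ _ _).1 h1, ?_, ?_, ?_⟩
  · rw [regularPart_image]
    exact mem_image_of_mem h h2
  · rw [regularPart_image]
    exact mem_image_of_mem h h3
  · rw [Set.disjoint_left]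
    rintro _ ⟨⟨x, hx, rfl⟩, hn⟩ hm
    rw [Homeomorph.mem_image_image_sUnion] at hm
    refine Set.disjoint_left.1 h4 ⟨hx, fun hx' => hn ?_⟩ hm
    rcases hx' with rfl | rfl
    exacts [Or.inl rfl, Or.inr rfl]

theorem PreservesLeaves.isExtremeRail (H : PreservesLeaves F G h) {J : Set S}
    (hJ : F.IsExtremeRail k δ J) : G.IsExtremeRail k ((fun A => h '' A) '' δ) (h '' J) := by
  obtain ⟨⟨a, b, h1, h2⟩, ρ, ⟨hc, hi, hv, hh⟩, h3, h4, s₀, hs₀, rfl, hr⟩ := hJ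
  have hrange : ∀ α : unitInterval → S, (range fun t => h (α t)) = h '' range α := fun α =>
    range_comp h α
  refine ⟨⟨h a, h b, (H.isLeafArc_iff _ _ _ _).1 h1, ?_⟩, fun x => h (ρ x),
    ⟨h.continuous.comp hc, h.injective.comp hi, fun s => ?_, fun t => ?_⟩, fun s => ?_, fun s => ?_,
    s₀, hs₀, ?_, fun s hs => ?_⟩
  · rwa [regularPart_image, h.injective.mem_set_image, h.injective.mem_set_image]
  · rw [hrange fun t => ρ (s, t)]
    exact (H.isLeafArc_iff _ _ _ _).1 (hv s)
  · rw [hrange fun s => ρ (s, t)]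
    exact (H.isLeafArc_iff _ _ _ _).1 (hh t)
  · exact Homeomorph.mem_image_image_sUnion.2 (h3 s)
  · exact Homeomorph.mem_image_image_sUnion.2 (h4 s)
  · rw [hrange fun t => ρ (s₀, t)]
  · rw [hrange fun t => ρ (s, t)]
    exact H.isRegularRail (hr s hs)

theorem PreservesLeaves.mem_leaf_iff (H : PreservesLeaves F G h) {x y : S} :
    y ∈ F.leaf k x ↔ h y ∈ G.leaf k (h x) := by
  refine or_congr h.injective.eq_iff.symm ⟨?_, ?_⟩
  · rintro ⟨A, hA⟩
    exact ⟨_, (H.isLeafArc_iff _ _ _ _).1 hA⟩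
  · rintro ⟨A, hA⟩
    have := (H.symm.isLeafArc_iff _ _ _ _).1 hA
    rw [h.symm_apply_apply, h.symm_apply_apply] at this
    exact ⟨_, this⟩

theorem PreservesLeaves.isSeparatrix (H : PreservesLeaves F G h) {p : S} {σ : Set S}
    (hσ : F.IsSeparatrix k p σ) : G.IsSeparatrix k (h p) (h '' σ) := by
  obtain ⟨x, hx, hxp, rfl⟩ := hσ
  refine ⟨h x, H.mem_leaf_iff.1 hx, fun h' => hxp (h.injective h'), ?_⟩
  ext y
  obtain ⟨y, rfl⟩ := h.surjective y
  rw [h.injective.mem_set_image]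
  refine or_congr h.injective.eq_iff.symm ⟨?_, ?_⟩
  · rintro ⟨A, hA, hpA⟩
    exact ⟨_, (H.isLeafArc_iff _ _ _ _).1 hA, by rwa [h.injective.mem_set_image]⟩
  · rintro ⟨A, hA, hpA⟩
    have := (H.symm.isLeafArc_iff _ _ _ _).1 hA
    rw [h.symm_apply_apply, h.symm_apply_apply] at this
    refine ⟨_, this, ?_⟩
    rwa [← h.injective.mem_set_image, h.coe_image_coe_symm_image]

end Naturality

/-- A conjugacy between pseudo-Anosov homeomorphisms that respects foliations and `Sing`. -/
structure IsConjugacy {S T : Type*} [TopologicalSpace S] [TopologicalSpace T] {f : S ≃ₜ S}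
    {g : T ≃ₜ T} (F : PseudoAnosov f) (G : PseudoAnosov g) (h : S ≃ₜ T) : Prop extends
    PreservesLeaves F.toTransverseMeasuredFoliations G.toTransverseMeasuredFoliations h where
  comm : ∀ x, h (f x) = g (h x)
  image_sing : h '' F.sing = G.sing

namespace IsConjugacy

variable {S T : Type*} [TopologicalSpace S] [TopologicalSpace T] {f : S ≃ₜ S} {g : T ≃ₜ T}
  {F : PseudoAnosov f} {G : PseudoAnosov g} {h : S ≃ₜ T} {k : LeafKind}

theorem symm (H : IsConjugacy F G h) : IsConjugacy G F h.symm where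
  toPreservesLeaves := H.toPreservesLeaves.symm
  comm x := by rw [h.symm_apply_eq, H.comm, h.apply_symm_apply]
  image_sing := by rw [← H.image_sing, h.coe_symm_image_coe_image]

theorem comm_symm (H : IsConjugacy F G h) (x : S) : h (f.symm x) = g.symm (h x) := by
  rw [g.eq_symm_apply, ← H.comm, f.apply_symm_apply]

theorem comm_iterate (H : IsConjugacy F G h) (n : ℕ) (x : S) : h (f^[n] x) = g^[n] (h x) :=
  Function.Semiconj.iterate_right (H.comm : Function.Semiconj h f g) n x

theorem mem_sing (H : IsConjugacy F G h) {x : S} : h x ∈ G.sing ↔ x ∈ F.sing := by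
  rw [← H.image_sing, h.injective.mem_set_image]

theorem isLeafArc (H : IsConjugacy F G h) {A : Set S} {a b : S} (hA : F.IsLeafArc k A a b) :
    G.IsLeafArc k (h '' A) (h a) (h b) := (H.isLeafArc_iff _ _ _ _).1 hA

theorem isFirstIntersection (H : IsConjugacy F G h) {z : S} (hz : F.IsFirstIntersection z) :
    G.IsFirstIntersection (h z) := by
  obtain ⟨hz, p, hp, q, hq, I, J, hI, hJ, hIJ⟩ := hz
  refine ⟨fun h' => hz (H.mem_sing.1 h'), h p, H.mem_sing.2 hp, h q, H.mem_sing.2 hq, _, _,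
    H.isLeafArc hI, H.isLeafArc hJ, ?_⟩
  rw [← image_singleton, ← image_singleton, ← image_singleton, ← image_sdiff h.injective,
    ← image_sdiff h.injective, ← image_inter h.injective, hIJ]

theorem mem_primitiveSegment (H : IsConjugacy F G h) {z x : S} (hx : x ∈ F.primitiveSegment z) :
    h x ∈ G.primitiveSegment (h z) := by
  obtain ⟨q, hq, J, hJ, hxJ⟩ := hx
  exact ⟨_, H.mem_sing.2 hq, _, H.isLeafArc hJ, mem_image_of_mem h hxJ⟩

theorem mem_backwardSegments (H : IsConjugacy F G h) {z x : S} (hx : x ∈ F.backwardSegments z) :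
    h x ∈ G.backwardSegments (h z) := by
  obtain ⟨n, hn⟩ := mem_iUnion.1 hx
  refine mem_iUnion.2 ⟨n, ?_⟩
  rw [mem_preimage, ← H.comm_iterate]
  exact H.mem_primitiveSegment hn

theorem image_backwardSegments (H : IsConjugacy F G h) (z : S) :
    G.backwardSegments (h z) = h '' F.backwardSegments z := by
  apply Subset.antisymm
  · intro y hy
    have := H.symm.mem_backwardSegments hy
    rw [h.symm_apply_apply] at this
    exact ⟨_, this, h.apply_symm_apply y⟩
  · rintro _ ⟨x, hx, rfl⟩
    exact H.mem_backwardSegments hx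

theorem mem_generatedGraph (H : IsConjugacy F G h) {K : Set S} {I : Set S}
    (hI : I ∈ F.generatedGraph k K) : h '' I ∈ G.generatedGraph k (h '' K) := by
  obtain ⟨p, hp, x, hx, hI, hd⟩ := hI
  refine ⟨h p, H.mem_sing.2 hp, h x, mem_image_of_mem h hx, H.isLeafArc hI, ?_⟩
  rw [← image_pair, ← image_sdiff h.injective]
  exact (disjoint_image_iff h.injective).2 hd

theorem image_generatedGraph (H : IsConjugacy F G h) (K : Set S) :
    G.generatedGraph k (h '' K) = (fun A => h '' A) '' F.generatedGraph k K := by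
  apply Subset.antisymm
  · intro I hI
    have := H.symm.mem_generatedGraph hI
    rw [h.coe_symm_image_coe_image] at this
    exact ⟨_, this, h.coe_image_coe_symm_image I⟩
  · rintro _ ⟨I, hI, rfl⟩
    exact H.mem_generatedGraph hI

theorem image_stableGraph (H : IsConjugacy F G h) (z : S) :
    G.stableGraph (h z) = (fun A => h '' A) '' F.stableGraph z := by
  rw [PseudoAnosov.stableGraph, H.image_backwardSegments, H.image_generatedGraph,
    PseudoAnosov.stableGraph]

theorem image_unstableGraph (H : IsConjugacy F G h) (z : S) :
    G.unstableGraph (h z) = (fun A => h '' A) '' F.unstableGraph z := by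
  have : ⋃₀ ((fun A => h '' A) '' F.stableGraph z) = h '' ⋃₀ F.stableGraph z := by
    rw [image_sUnion]
  rw [PseudoAnosov.unstableGraph, H.image_stableGraph, this, H.image_generatedGraph,
    PseudoAnosov.unstableGraph]

theorem isAdapted (H : IsConjugacy F G h) {δ : Set (Set S)} (hδ : F.IsAdapted k δ) :
    G.IsAdapted k ((fun A => h '' A) '' δ) where
  finite := hδ.finite.image _
  isLeafArc := by
    rintro _ ⟨I, hI, rfl⟩
    obtain ⟨a, b, hab⟩ := hδ.isLeafArc I hI
    exact ⟨_, _, H.isLeafArc hab⟩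
  invariant := by
    have h1 := hδ.invariant
    cases k
    · rintro _ ⟨y, hy, rfl⟩
      obtain ⟨x, rfl⟩ := h.surjective y
      rw [Homeomorph.mem_image_image_sUnion] at hy
      rw [← H.comm, Homeomorph.mem_image_image_sUnion]
      exact h1 (mem_image_of_mem f hy)
    · rintro _ ⟨y, hy, rfl⟩
      obtain ⟨x, rfl⟩ := h.surjective y
      rw [Homeomorph.mem_image_image_sUnion] at hy
      rw [← H.comm_symm, Homeomorph.mem_image_image_sUnion]
      exact h1 (mem_image_of_mem f.symm hy)
  subset_leaf := by
    rintro _ ⟨I, hI, rfl⟩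
    obtain ⟨p, hp, hIp⟩ := hδ.subset_leaf I hI
    refine ⟨_, H.mem_sing.2 hp, ?_⟩
    rintro _ ⟨x, hx, rfl⟩
    exact H.mem_leaf_iff.1 (hIp hx)
  separatrix := by
    intro p hp σ hσ
    obtain ⟨I, hI, h1, h2⟩ := hδ.separatrix _ (H.symm.mem_sing.2 hp) _ (H.symm.isSeparatrix hσ)
    refine ⟨_, ⟨I, hI, rfl⟩, ?_, ?_⟩
    · rw [arcEnds_image]
      exact ⟨_, h1, h.apply_symm_apply p⟩
    · rintro _ ⟨⟨x, hx, rfl⟩, hn⟩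
      obtain ⟨y, hy, he⟩ := h2 ⟨hx, fun hx' => hn (by
        rw [mem_singleton_iff.1 hx', h.apply_symm_apply]
        rfl)⟩
      rwa [← he, h.apply_symm_apply]
  ends := by
    rintro _ ⟨I, hI, rfl⟩ a ha
    rw [arcEnds_image] at ha
    obtain ⟨a, ha, rfl⟩ := ha
    obtain ⟨q, hq, haq⟩ := hδ.ends I hI a ha
    exact ⟨_, H.mem_sing.2 hq, H.mem_leaf_iff.1 haq⟩

theorem compatible (H : IsConjugacy F G h) {δs δu : Set (Set S)} (hc : F.Compatible δs δu) :
    G.Compatible ((fun A => h '' A) '' δs) ((fun A => h '' A) '' δu) := by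
  have hends : ∀ δ δ' : Set (Set S), (∀ I ∈ δ, arcEnds I ⊆ ⋃₀ δ') →
      ∀ I ∈ (fun A => h '' A) '' δ, arcEnds I ⊆ ⋃₀ ((fun A => h '' A) '' δ') := by
    rintro δ δ' h' _ ⟨I, hI, rfl⟩ a ha
    rw [arcEnds_image] at ha
    obtain ⟨a, ha, rfl⟩ := ha
    exact Homeomorph.mem_image_image_sUnion.2 (h' I hI ha)
  have hext : ∀ k, ∀ δ δ' : Set (Set S), (∀ J, F.IsExtremeRail k δ J → J ⊆ ⋃₀ δ') →
      ∀ J, G.IsExtremeRail k ((fun A => h '' A) '' δ) J → J ⊆ ⋃₀ ((fun A => h '' A) '' δ') := by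
    intro k δ δ' h' J hJ y hy
    have h1 := H.symm.isExtremeRail hJ
    have h2 : (fun A => h.symm '' A) '' ((fun A => h '' A) '' δ) = δ :=
      h.symm.image_image_symm_image δ
    rw [h2] at h1
    obtain ⟨x, rfl⟩ := h.surjective y
    refine Homeomorph.mem_image_image_sUnion.2 (h' _ h1 ⟨_, hy, h.symm_apply_apply x⟩)
  exact ⟨H.isAdapted hc.adapted_stable, H.isAdapted hc.adapted_unstable,
    hends _ _ hc.ends_stable, hends _ _ hc.ends_unstable,
    hext _ _ _ hc.extreme_unstable, hext _ _ _ hc.extreme_stable⟩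

theorem compatibleOrders_subset (H : IsConjugacy F G h) (z : S) :
    F.compatibleOrders z ⊆ G.compatibleOrders (h z) := by
  intro N hN n hn
  have h1 := H.compatible (hN n hn)
  rw [H.image_stableGraph, H.image_unstableGraph]
  convert h1 using 1
  simp only [image_image, H.comm_iterate]

theorem compatibilityCoefficient_eq (H : IsConjugacy F G h) (z : S) :
    G.compatibilityCoefficient (h z) = F.compatibilityCoefficient z := by
  refine congrArg sInf (Subset.antisymm ?_ (H.compatibleOrders_subset z))
  have := H.symm.compatibleOrders_subset (h z)
  rwa [h.symm_apply_apply] at this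

theorem coefficients_subset (H : IsConjugacy F G h) : F.coefficients ⊆ G.coefficients := by
  rintro _ ⟨z, hz, rfl⟩
  exact ⟨h z, H.isFirstIntersection hz, H.compatibilityCoefficient_eq z⟩

theorem compatibilityOrder_eq (H : IsConjugacy F G h) :
    F.compatibilityOrder = G.compatibilityOrder :=
  congrArg sSup (Subset.antisymm H.coefficients_subset H.symm.coefficients_subset)

end IsConjugacy

theorem PseudoAnosov.isConjugacy_self {S : Type*} [TopologicalSpace S] {f : S ≃ₜ S}
    (F : PseudoAnosov f) : IsConjugacy F F f where
  toPreservesLeaves := preservesLeaves_of_localLeaf fun k p => by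
    have hs : F.stretch ≠ 0 := F.marked.stretch_ne_zero
    have hc : k.crossFactor F.stretch ^ 2 ≠ 0 := by
      cases k
      · exact pow_ne_zero 2 hs
      · exact pow_ne_zero 2 (inv_ne_zero hs)
    filter_upwards [F.marked.isAffine.hgt_map hs p,
      (F.chart p).open_source.mem_nhds (F.mem_source p),
      f.continuous.continuousAt.preimage_mem_nhds
        ((F.chart (f p)).open_source.mem_nhds (F.mem_source (f p)))] with x h1 h2 h3
    rw [F.mem_localLeaf_iff, F.mem_localLeaf_iff, h1 k, mul_eq_zero]
    have h3' : f x ∈ (F.chart (f p)).source := h3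
    simp only [h2, h3', hc, true_and, false_or]
  comm _ := rfl
  image_sing := F.sing_invariant

/-! ### Extreme rails are bounded -/

/-- An extreme rail has an end in the graph outside of its regular part. At a point of its interior,
the graph does not contain a neighbourhood of the point in its transverse leaf, since the rail is a
limit of regular rails, whose interiors avoid the graph. -/
theorem TransverseMeasuredFoliations.IsExtremeRail.exists_end {S : Type*} [TopologicalSpace S]
    [T2Space S] {F : TransverseMeasuredFoliations S} {k : LeafKind} {δ : Set (Set S)} {J : Set S}
    (h : F.IsExtremeRail k δ J) : ∃ a b, F.IsLeafArc k J a b ∧ a ∈ ⋃₀ δ ∧ a ∉ regularPart δ ∧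
      ∀ x ∈ J, x ≠ a → x ≠ b → ¬ ∀ᶠ y in 𝓝 x, y ∈ F.localLeaf k.other x → y ∈ ⋃₀ δ := by
  obtain ⟨⟨a, b, hJ, hab⟩, ρ, ⟨hc, hi, hv, hh⟩, h0, h1, s₀, -, rfl, hreg⟩ := h
  have key : ∀ t, t ≠ 0 → t ≠ 1 →
      ¬ ∀ᶠ y in 𝓝 (ρ (s₀, t)), y ∈ F.localLeaf k.other (ρ (s₀, t)) → y ∈ ⋃₀ δ := by
    intro t ht0 ht1 hcore
    have hA := (hh t).2 (ρ (s₀, t)) ⟨s₀, rfl⟩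
    have hlim : Tendsto (fun s => ρ (s, t)) (𝓝[≠] s₀)
        (𝓝[range fun s => ρ (s, t)] (ρ (s₀, t))) := by
      refine tendsto_nhdsWithin_iff.2 ⟨?_, Eventually.of_forall fun s => ⟨s, rfl⟩⟩
      have : Continuous fun s => ρ (s, t) := hc.comp (continuous_id.prodMk continuous_const)
      exact (this.tendsto s₀).mono_left nhdsWithin_le_nhds
    -- a regular rail of the rectangle next to `J` crosses the transverse leaf near the point
    obtain ⟨s, hs, hne⟩ := ((hlim.eventually
      (hA.and (hcore.filter_mono nhdsWithin_le_nhds))).and self_mem_nhdsWithin).exists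
    obtain ⟨a', b', hV, -, -, hd⟩ := hreg s hne
    refine Set.disjoint_left.1 hd ⟨⟨t, rfl⟩, ?_⟩ (hs.2 hs.1)
    have h2 : ({a', b'} : Set S) = {ρ (s, 0), ρ (s, 1)} := by
      rcases (hv s).1.ends_eq hV.1 with ⟨rfl, rfl⟩ | ⟨rfl, rfl⟩
      · rfl
      · exact pair_comm _ _
    rw [h2]
    rintro (h' | h')
    · exact ht0 (Prod.mk.inj (hi h')).2
    · exact ht1 (Prod.mk.inj (hi h')).2
  have hends := (hv s₀).1.ends_eq hJ.1
  have hint : ∀ x ∈ range fun t => ρ (s₀, t), x ≠ a → x ≠ b →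
      ¬ ∀ᶠ y in 𝓝 x, y ∈ F.localLeaf k.other x → y ∈ ⋃₀ δ := by
    rintro _ ⟨t, rfl⟩ hxa hxb
    apply key t
    · rintro rfl
      rcases hends with ⟨rfl, rfl⟩ | ⟨rfl, rfl⟩
      exacts [hxa rfl, hxb rfl]
    · rintro rfl
      rcases hends with ⟨rfl, rfl⟩ | ⟨rfl, rfl⟩
      exacts [hxb rfl, hxa rfl]
  have hmem : a ∈ ⋃₀ δ ∧ b ∈ ⋃₀ δ := by
    rcases hends with ⟨rfl, rfl⟩ | ⟨rfl, rfl⟩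
    exacts [⟨h0 s₀, h1 s₀⟩, ⟨h1 s₀, h0 s₀⟩]
  rcases hab with hab | hab
  · exact ⟨a, b, hJ, hmem.1, hab, hint⟩
  · exact ⟨b, a, hJ.symm, hmem.2, hab, fun x hx h2 h3 => hint x hx h3 h2⟩

namespace Marked

variable {S : Type*} [TopologicalSpace S] {f : S ≃ₜ S} {M : Marked f} {k : LeafKind} [T2Space S]

/-- The core of a graph: at an interior point of an edge, it contains the local leaf. -/
theorem eventually_mem_sUnion_rayGraph {T : M.Prong k → ℝ} {i : M.Prong k} {t : ℝ} (h0 : 0 < t)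
    (ht : t < T i) : ∀ᶠ y in 𝓝 (ray i t), y ∈ M.localLeaf k (ray i t) → y ∈ ⋃₀ rayGraph T := by
  filter_upwards [(lineAt_ray i h0).eventually_localLeaf (lt_min h0 (sub_pos.2 ht))] with y hy hyl
  obtain ⟨s, hs, rfl⟩ := hy hyl
  have h1 := abs_lt.1 (hs.trans_le (min_le_left _ _))
  have h2 := abs_lt.1 (hs.trans_le (min_le_right _ _))
  exact mem_sUnion_rayGraph.2 ⟨i, s, by linarith, by linarith, rfl⟩

/-- Marked points belong to the core of a graph too. -/
theorem eventually_mem_sUnion_rayGraph_pts {T : M.Prong k → ℝ} (hT : ∀ i, 0 < T i) {p : S}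
    (hp : p ∈ M.pts) : ∀ᶠ y in 𝓝 p, y ∈ M.localLeaf k p → y ∈ ⋃₀ rayGraph T := by
  obtain ⟨i₀, hi₀⟩ := Finite.exists_min T
  filter_upwards [eventually_localLeaf_pts hp k (hT i₀)] with y hy hyl
  obtain ⟨i, -, t, h0, ht, rfl⟩ := hy hyl
  exact mem_sUnion_rayGraph.2 ⟨i, t, h0, ht.le.trans (hi₀ i), rfl⟩

variable [CompactSpace S] [ConnectedSpace S]

/-- A separatrix crosses the core of a transverse graph arbitrarily far out. -/
theorem exists_ray_gt_eventually_mem {T : M.Prong k.other → ℝ} (hT : ∀ i, 0 < T i)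
    (j : M.Prong k) (t : ℝ) : ∃ t' > t, 0 < t' ∧
      ∀ᶠ y in 𝓝 (ray j t'), y ∈ M.localLeaf k.other (ray j t') → y ∈ ⋃₀ rayGraph T := by
  obtain ⟨i⟩ : Nonempty (M.Prong k.other) := inferInstance
  obtain ⟨s, t', hs, hsT, htt, ht0, he⟩ := exists_ray_other_eq_ray_lt j i (hT i) t
  exact ⟨t', htt, ht0, he ▸ eventually_mem_sUnion_rayGraph hs hsT⟩

/-- A bound, common to all separatrices through `a`, for the parameter of `a` and for that of a later
crossing with the core of the graph. -/
theorem exists_bound_forall_ray {T : M.Prong k.other → ℝ} (hT : ∀ i, 0 < T i) (a : S) :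
    ∃ B, ∀ (j : M.Prong k) t, 0 ≤ t → a = ray j t → t ≤ B ∧ ∃ t' > t, 0 < t' ∧ t' ≤ B ∧
      ∀ᶠ y in 𝓝 (ray j t'), y ∈ M.localLeaf k.other (ray j t') → y ∈ ⋃₀ rayGraph T := by
  have h : ∀ j : M.Prong k, ∃ B, ∀ t, 0 ≤ t → a = ray j t → t ≤ B ∧ ∃ t' > t, 0 < t' ∧ t' ≤ B ∧
      ∀ᶠ y in 𝓝 (ray j t'), y ∈ M.localLeaf k.other (ray j t') → y ∈ ⋃₀ rayGraph T := by
    intro j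
    by_cases hj : ∃ t, 0 ≤ t ∧ a = ray j t
    · obtain ⟨t, ht, rfl⟩ := hj
      obtain ⟨t', h1, h2, h3⟩ := exists_ray_gt_eventually_mem hT j t
      refine ⟨t', fun s hs he => ?_⟩
      rw [← injOn_ray j (mem_Ici.2 ht) (mem_Ici.2 hs) he]
      exact ⟨h1.le, t', h1, h2, le_rfl, h3⟩
    · exact ⟨0, fun t ht he => absurd ⟨t, ht, he⟩ hj⟩
  choose B hB using h
  obtain ⟨B', hB'⟩ := (finite_range B).bddAbove
  refine ⟨B', fun j t ht he => ?_⟩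
  obtain ⟨h1, t', h2, h3, h4, h5⟩ := hB j t ht he
  have hj := hB' (mem_range_self j)
  exact ⟨h1.trans hj, t', h2, h3, h4.trans hj, h5⟩

/-- The extreme rails of a graph whose ends lie on transverse separatrices are contained in
bounded initial segments of separatrices. -/
theorem exists_bound_isExtremeRail {T : M.Prong k.other → ℝ} (hT : ∀ i, 0 < T i)
    (hend : ∀ i, ∃ (j : M.Prong k) (t : ℝ), 0 ≤ t ∧ ray i (T i) = ray j t) :
    ∃ B, ∀ J, M.IsExtremeRail k (rayGraph T) J →
      J ⊆ segments (id : M.Prong k → M.Prong k) fun _ => B := by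
  choose B hB using fun a => exists_bound_forall_ray (k := k) hT a
  obtain ⟨B', hB'⟩ := (finite_range fun i => max (B (i : M.Prong k.other).base)
    (B (ray i (T i)))).bddAbove
  have hB1 : ∀ i : M.Prong k.other, B i.base ≤ B' ∧ B (ray i (T i)) ≤ B' := fun i =>
    max_le_iff.1 (hB' (mem_range_self i))
  refine ⟨B', fun J hJ => ?_⟩
  -- `a` is the end of the rail outside of the regular part, hence one of finitely many points
  obtain ⟨a, b, hab, ha, har, hint⟩ := hJ.exists_end
  have hcore : ∀ p ∈ M.pts, p ∈ J → p = a ∨ p = b := by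
    intro p hp hpJ
    by_contra! hn
    exact hint p hpJ hn.1 hn.2 (eventually_mem_sUnion_rayGraph_pts hT hp)
  have haE : ∃ i : M.Prong k.other, a = i.base ∨ a = ray i (T i) := by
    by_contra! hn
    refine har ⟨ha, ?_⟩
    simp only [mem_iUnion, not_exists]
    rintro _ ⟨i, rfl⟩ hai
    rw [arcEnds_ray i (hT i)] at hai
    rcases hai with h' | h'
    exacts [(hn i).1 h', (hn i).2 h']
  have haB : B a ≤ B' := by
    obtain ⟨i, rfl | rfl⟩ := haE
    exacts [(hB1 i).1, (hB1 i).2]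
  obtain ⟨j, t, ht, hjt⟩ : ∃ (j : M.Prong k) (t : ℝ), 0 ≤ t ∧ a = ray j t := by
    obtain ⟨i, rfl | rfl⟩ := haE
    · obtain ⟨j, hj⟩ := exists_prong k i.base_mem
      exact ⟨j, 0, le_rfl, by rw [ray_zero, hj]⟩
    · exact hend i
  by_cases hbj : b = j.base
  · obtain ⟨j', -, t', ht', hat, rfl⟩ := exists_eq_image_ray_Icc hab.symm (hbj ▸ j.base_mem)
    rintro _ ⟨s, hs, rfl⟩
    exact mem_segments.2 ⟨j', s, hs.1, hs.2.trans (((hB a) j' t' ht'.le hat).1.trans haB), rfl⟩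
  · obtain ⟨j', -, t₁, t₂, h1, h2, h12, hat, hbt, rfl⟩ := exists_eq_image_ray hab j.base_mem
      ⟨j, rfl, t, ht, hjt⟩ (by
        rintro x hx hxa rfl
        rcases hcore _ j.base_mem hx with h' | h'
        exacts [hxa h', hbj h'.symm])
    obtain ⟨h3, t', h4, h5, h6, h7⟩ := hB a j' t₁ h1 hat
    -- beyond `a`, the rail cannot pass the next crossing of its separatrix with the graph
    have h8 : t₂ ≤ t' := by
      by_contra! hlt
      refine hint (ray j' t') ⟨t', ?_, rfl⟩ ?_ ?_ h7
      · rw [uIcc_of_le (h4.le.trans hlt.le)]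
        exact ⟨h4.le, hlt.le⟩
      · rw [hat]
        exact fun h' => h4.ne' (injOn_ray j' (mem_Ici.2 h5.le) (mem_Ici.2 h1) h')
      · rw [hbt]
        exact fun h' => hlt.ne (injOn_ray j' (mem_Ici.2 h5.le) (mem_Ici.2 h2) h')
    rintro _ ⟨s, hs, rfl⟩
    refine mem_segments.2 ⟨j', s, (le_inf h1 h2).trans hs.1, hs.2.trans (sup_le ?_ ?_), rfl⟩
    · exact h3.trans haB
    · exact h8.trans (h6.trans haB)

end Marked

namespace PseudoAnosov

open Marked

variable {S : Type*} [TopologicalSpace S] {f : S ≃ₜ S} {F : PseudoAnosov f} {k : LeafKind}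

theorem exists_isExtremeRail_of_iterate {δ : Set (Set S)} (n : ℕ) {J : Set S}
    (hJ : F.IsExtremeRail k ((fun A => f^[n] '' A) '' δ) J) :
    ∃ J', F.IsExtremeRail k δ J' ∧ J = f^[n] '' J' := by
  induction n generalizing J with
  | zero =>
    simp only [Function.iterate_zero, image_id, image_id'] at hJ
    exact ⟨J, hJ, by simp⟩
  | succ n ih =>
    have h1 : (fun A => f.symm '' A) '' ((fun A => f^[n + 1] '' A) '' δ) =
        (fun A => f^[n] '' A) '' δ := by
      simp only [image_image, Function.iterate_succ_apply', f.symm_apply_apply]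
    have h2 := F.isConjugacy_self.symm.isExtremeRail hJ
    rw [h1] at h2
    obtain ⟨J', hJ', he⟩ := ih h2
    refine ⟨J', hJ', ?_⟩
    rw [Function.iterate_succ', image_comp, ← he, f.coe_image_coe_symm_image]

variable [T2Space S] [CompactSpace S] [ConnectedSpace S]

theorem exists_pow_mul_ge {ι : Type*} [Finite ι] [Nonempty ι] {T : ι → ℝ} (hT : ∀ i, 0 < T i)
    {c : ℝ} (hc : 1 < c) (B : ℝ) : ∃ N : ℕ, ∀ n ≥ N, ∀ i, B ≤ c ^ n * T i := by
  obtain ⟨i₀, hi₀⟩ := Finite.exists_min T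
  have h : Tendsto (fun n : ℕ => c ^ n * T i₀) atTop atTop :=
    (tendsto_pow_atTop_atTop_of_one_lt hc).atTop_mul_const (hT i₀)
  obtain ⟨N, hN⟩ := eventually_atTop.1 (h.eventually_ge_atTop B)
  exact ⟨N, fun n hn i => (hN n hn).trans
    (mul_le_mul_of_nonneg_left (hi₀ i) (pow_pos (one_pos.trans hc) n).le)⟩

/-- For large `n`, the graphs `δˢ(z)` and `fⁿ(δᵘ(z))` are compatible: the separatrix segments of
`fⁿ(δᵘ(z))` grow exponentially, whereas the unstable segments they have to cover are bounded, and
the stable segments that `δˢ(z)` has to cover are contracted. -/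
theorem nonempty_compatibleOrders (τ : F.marked.Prong .unstable) {b : ℝ} (hb : 0 < b) :
    (F.compatibleOrders (ray τ b)).Nonempty := by
  obtain ⟨m, hm0, hm⟩ := F.marked.exists_period
  have hs : 0 < F.stretch := F.marked.stretch_pos
  have hK := backwardSegments_ray τ hb hm0 (hm _ τ)
  obtain ⟨T, hT₀⟩ := exists_forall_isFirstHit (k := .stable)
    (fun n : Fin m => (step^[(n : ℕ)] τ : F.marked.Prong .unstable))
    (fun n : Fin m => b / F.stretch ^ (n : ℕ)) ⟨⟨0, hm0⟩, by simpa using hb⟩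
  have hT : ∀ i : F.marked.Prong .stable, IsFirstHit (F.backwardSegments (ray τ b)) i (T i) := by
    rw [hK]
    exact hT₀
  -- both graphs consist of the segments of separatrices up to first hits, of lengths `T` and `T'`
  have hδs : F.stableGraph (ray τ b) = rayGraph T := generatedGraph_eq hT
  have hT0 : ∀ i, 0 < T i := fun i => (hT i).pos
  have hTstep : ∀ i, T i / F.stretch ≤ T (step i) :=
    IsFirstHit.div_le hT fun x hx => symm_mem_backwardSegments hx
  have hTend : ∀ i, ∃ (j : F.marked.Prong .unstable) (t : ℝ), 0 ≤ t ∧ t ≤ b ∧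
      ray i (T i) = ray j t := by
    intro i
    have h1 := (hT i).mem
    rw [hK] at h1
    obtain ⟨n, t, h2, h3, h4⟩ := mem_segments.1 h1
    exact ⟨_, t, h2, h3.trans (div_le_self hb.le (one_le_pow₀ F.one_lt_stretch.le)), h4⟩
  obtain ⟨i₀⟩ : Nonempty (F.marked.Prong .stable) := inferInstance
  obtain ⟨T', hT'₀⟩ := exists_forall_isFirstHit (k := .unstable)
    (id : F.marked.Prong .stable → F.marked.Prong .stable) T ⟨i₀, hT0 i₀⟩
  have hT' : ∀ j : F.marked.Prong .unstable, IsFirstHit (⋃₀ rayGraph T) j (T' j) := by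
    rw [sUnion_rayGraph]
    exact hT'₀
  have hδu : F.unstableGraph (ray τ b) = rayGraph T' := by
    rw [unstableGraph, hδs]
    exact generatedGraph_eq hT'
  have hT'0 : ∀ j, 0 < T' j := fun j => (hT' j).pos
  have hT'step : ∀ j, T' j / F.stretch ≤ T' (step j) :=
    IsFirstHit.div_le hT' fun x hx => contr_image_sUnion_rayGraph hTstep hx
  have hT'end : ∀ j, ∃ (i : F.marked.Prong .stable) (t : ℝ), 0 ≤ t ∧ ray j (T' j) = ray i t := by
    intro j
    obtain ⟨i, t, h1, -, h2⟩ := mem_sUnion_rayGraph.1 (hT' j).mem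
    exact ⟨i, t, h1, h2⟩
  have hadS : F.IsAdapted .stable (rayGraph T) := by
    refine isAdapted_rayGraph hT0 hTstep fun i => ?_
    obtain ⟨j, t, h0, -, he⟩ := hTend i
    exact ⟨j.base, j.base_mem, he ▸ ray_mem_leaf j h0⟩
  obtain ⟨B₁, hB₁⟩ := exists_bound_isExtremeRail (k := .unstable) hT0 fun i => by
    obtain ⟨j, t, h0, -, he⟩ := hTend i
    exact ⟨j, t, h0, he⟩
  obtain ⟨B₂, hB₂⟩ := exists_bound_isExtremeRail (k := .stable) hT'0 hT'end
  obtain ⟨N₁, hN₁⟩ := exists_pow_mul_ge hT'0 F.one_lt_stretch (max B₁ b)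
  obtain ⟨N₂, hN₂⟩ := exists_pow_mul_ge hT0 F.one_lt_stretch B₂
  refine ⟨max N₁ N₂, fun n hn => ?_⟩
  have hpow : 0 < F.stretch ^ n := pow_pos hs n
  have hδun : (fun J => f^[n] '' J) '' F.unstableGraph (ray τ b) =
      rayGraph fun j => F.stretch ^ n * T' (step^[n] j) := by
    rw [hδu]
    exact image_rayGraph T' n
  rw [hδs, hδun]
  have hmap : ∀ (i : F.marked.Prong .stable) t, 0 ≤ t →
      f^[n] (ray i t) = ray (step^[n] i) (t / F.stretch ^ n) := fun i t ht =>
    contr_iterate_ray i ht n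
  have hend : ∀ j : F.marked.Prong .unstable,
      ray j (F.stretch ^ n * T' (step^[n] j)) = f^[n] (ray (step^[n] j) (T' (step^[n] j))) :=
    fun j => (contr_symm_iterate_ray j (hT'0 _).le n).symm
  have hcov : ∀ x (j : F.marked.Prong .unstable) t, 0 ≤ t → t ≤ max B₁ b → x = ray j t →
      x ∈ ⋃₀ rayGraph fun j => F.stretch ^ n * T' (step^[n] j) := fun x j t h0 ht he =>
    mem_sUnion_rayGraph.2 ⟨j, t, h0, ht.trans (hN₁ n ((le_max_left _ _).trans hn) _), he⟩
  have hpos : ∀ j : F.marked.Prong .unstable, 0 < F.stretch ^ n * T' (step^[n] j) := fun j =>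
    mul_pos hpow (hT'0 _)
  refine ⟨hadS, isAdapted_rayGraph hpos (fun j => ?_) (fun j => ?_), ?_, ?_, fun J hJ x hx => ?_,
    fun I hI x hx => ?_⟩
  · rw [← Function.iterate_succ_apply, Function.iterate_succ_apply', mul_div_assoc]
    exact mul_le_mul_of_nonneg_left (hT'step _) hpow.le
  · obtain ⟨i, t, h0, he⟩ := hT'end (step^[n] j)
    rw [hend, he, hmap i t h0]
    exact ⟨_, (step^[n] i).base_mem, ray_mem_leaf _ (div_nonneg h0 hpow.le)⟩
  · rintro _ ⟨i, rfl⟩ a ha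
    simp only [arcEnds_ray i (hT0 i)] at ha
    rcases ha with rfl | rfl
    · exact pts_subset_sUnion_rayGraph hpos i.base_mem
    · obtain ⟨j, t, h0, htb, he⟩ := hTend i
      exact hcov _ j t h0 (htb.trans (le_max_right _ _)) he
  · rintro _ ⟨j, rfl⟩ a ha
    simp only [arcEnds_ray j (hpos j)] at ha
    rcases ha with rfl | rfl
    · exact pts_subset_sUnion_rayGraph hT0 j.base_mem
    · rw [hend]
      have h1 : MapsTo f (⋃₀ rayGraph T) (⋃₀ rayGraph T) := fun x hx =>
        contr_image_sUnion_rayGraph hTstep hx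
      exact h1.iterate n (hT' _).mem
  · obtain ⟨j, t, h0, ht, he⟩ := mem_segments.1 (hB₁ J hJ hx)
    exact hcov x j t h0 (ht.trans (le_max_left _ _)) he
  · rw [← hδun, hδu] at hI
    obtain ⟨I', hI', rfl⟩ := exists_isExtremeRail_of_iterate n hI
    obtain ⟨x, hx, rfl⟩ := hx
    obtain ⟨i, t, h0, ht, rfl⟩ := mem_segments.1 (hB₂ I' hI' hx)
    refine mem_sUnion_rayGraph.2 ⟨step^[n] i, t / F.stretch ^ n, div_nonneg h0 hpow.le, ?_,
      hmap i t h0⟩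
    rw [div_le_iff₀' hpow]
    exact ht.trans (hN₂ n ((le_max_right _ _).trans hn) _)

theorem isLeast_compatibilityCoefficient {z : S} (hz : F.IsFirstIntersection z) :
    IsLeast (F.compatibleOrders z) (F.compatibilityCoefficient z) := by
  obtain ⟨σ, τ, a, b, ha, hb, -, rfl, -⟩ := hz.exists_ray
  exact ⟨Nat.sInf_mem (nonempty_compatibleOrders τ hb), fun n hn => Nat.sInf_le hn⟩

end PseudoAnosov

/-! ### First intersection points modulo the dynamics -/

namespace PseudoAnosov

open Marked

variable {S : Type*} [TopologicalSpace S] {f : S ≃ₜ S} {F : PseudoAnosov f}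

/-- First intersection points and their coefficients are invariant, as `f` conjugates itself to itself. -/
theorem iterate_isFirstIntersection {z : S} (hz : F.IsFirstIntersection z) (n : ℕ) :
    F.IsFirstIntersection (f^[n] z) ∧
      F.compatibilityCoefficient (f^[n] z) = F.compatibilityCoefficient z := by
  induction n with
  | zero => exact ⟨hz, rfl⟩
  | succ n ih =>
    rw [Function.iterate_succ_apply']
    exact ⟨F.isConjugacy_self.isFirstIntersection ih.1,
      (F.isConjugacy_self.compatibilityCoefficient_eq _).trans ih.2⟩

theorem symm_iterate_isFirstIntersection {z : S} (hz : F.IsFirstIntersection z) (n : ℕ) :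
    F.IsFirstIntersection (f.symm^[n] z) ∧
      F.compatibilityCoefficient (f.symm^[n] z) = F.compatibilityCoefficient z := by
  induction n with
  | zero => exact ⟨hz, rfl⟩
  | succ n ih =>
    rw [Function.iterate_succ_apply']
    exact ⟨F.isConjugacy_self.symm.isFirstIntersection ih.1,
      (F.isConjugacy_self.symm.compatibilityCoefficient_eq _).trans ih.2⟩

variable [T2Space S]

/-- A segment of a stable and a segment of an unstable separatrix have finitely many common
points, as they are transverse. -/
theorem finite_ray_mem_ray (σ : F.marked.Prong .stable) (τ : F.marked.Prong .unstable) {s₀ : ℝ}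
    (hs₀ : 0 < s₀) {L : ℝ} : {b ∈ Icc 1 L | ray τ b ∈ ray σ '' Icc 0 s₀}.Finite := by
  by_contra hinf
  obtain ⟨b, hb, hacc⟩ := Set.Infinite.exists_accPt_of_subset_isCompact hinf isCompact_Icc
    (sep_subset _ _)
  have hb0 : 0 < b := one_pos.trans_le hb.1
  have hcl : IsClosed (ray σ '' Icc 0 s₀) :=
    (isCompact_Icc.image_of_continuousOn
      ((continuousOn_ray σ).mono Icc_subset_Ici_self)).isClosed
  have hline := lineAt_ray τ hb0
  have hcont : ContinuousAt (ray τ) b := hline.1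
  rw [accPt_iff_frequently] at hacc
  have hmem : ray τ b ∈ ray σ '' Icc 0 s₀ := by
    by_contra hn
    obtain ⟨t, ⟨-, -, h1⟩, h2⟩ := (hacc.and_eventually
      (hcont.eventually (hcl.isOpen_compl.mem_nhds hn))).exists
    exact h2 h1
  -- near an accumulation point, common points lie in both local leaves at this point
  have h1 := eventually_nhdsWithin_iff.1 ((isLeafArc_ray σ hs₀).2 _ hmem)
  obtain ⟨t, ⟨⟨hne, ht, htm⟩, h2⟩, h3⟩ := ((hacc.and_eventually (hcont.eventually h1)).and_eventually
    hline.eventually_mem_localLeaf).exists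
  have h4 := F.eq_of_mem_localLeaf (k := .stable) (h2 htm) h3
  exact hne (injOn_ray τ (mem_Ici.2 (zero_le_one.trans ht.1)) (mem_Ici.2 hb0.le) h4)

variable [CompactSpace S] [ConnectedSpace S]

theorem exists_isFirstIntersection : ∃ z, F.IsFirstIntersection z := by
  obtain ⟨σ⟩ : Nonempty (F.marked.Prong .stable) := inferInstance
  obtain ⟨τ⟩ : Nonempty (F.marked.Prong .unstable) := inferInstance
  obtain ⟨s, t, hs, ht, he⟩ := exists_ray_eq_ray (k := .stable) σ τ
  -- the first point on a stable separatrix of an unstable segment that it meets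
  obtain ⟨a, -, hT⟩ := exists_isFirstHit (k := .stable) (fun _ : Unit => τ) (fun _ => t) σ hs
    (mem_segments.2 ⟨(), t, ht.le, le_rfl, he⟩)
  obtain ⟨-, b, hb, hbt, hab'⟩ := mem_segments.1 hT.mem
  have hab : ray σ a = ray τ b := hab'
  have hb0 : 0 < b := by
    refine lt_of_le_of_ne hb ?_
    rintro rfl
    refine ray_notMem_pts σ hT.pos ?_
    rw [hab, ray_zero]
    exact τ.base_mem
  refine ⟨_, isFirstIntersection_ray hT.pos hb0 hab fun s' t' h1 h2 h3 h4 h5 => ?_⟩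
  have h6 : s' = a := le_antisymm h2 (hT.le h1 (mem_segments.2 ⟨(), t', h3.le, h4.trans hbt, h5⟩))
  have h7 : ray τ t' = ray τ b := by rw [← h5, h6, hab]
  exact ⟨h6, (ray_inj h3.le hb0 h7).2⟩

/-- The first intersection points with unstable parameter in a compact interval are finitely
many. Their stable parameters are bounded, since the stable separatrix meets the beginning of the
unstable one. -/
theorem finite_isFirstIntersection (L : ℝ) : {z | F.IsFirstIntersection z ∧
    ∃ (τ : F.marked.Prong .unstable) (b : ℝ), 1 ≤ b ∧ b ≤ L ∧ z = ray τ b}.Finite := by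
  have h : ∀ (σ : F.marked.Prong .stable) (τ : F.marked.Prong .unstable),
      ∃ s₀ t₀, 0 < s₀ ∧ 0 < t₀ ∧ t₀ < 1 ∧ ray σ s₀ = ray τ t₀ := by
    intro σ τ
    obtain ⟨t₀, s₀, h1, h2, -, h3, h4⟩ := exists_ray_other_eq_ray_lt (k := .stable) σ τ one_pos 0
    exact ⟨s₀, t₀, h3, h1, h2, h4.symm⟩
  choose s₀ t₀ hs₀ ht₀ ht₁ he using h
  refine Finite.subset (finite_iUnion fun σ => finite_iUnion fun τ =>
    (finite_ray_mem_ray σ τ (hs₀ σ τ) (L := L)).image (ray τ)) ?_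
  rintro z ⟨hz, τ', b', hb1, hbL, hzb⟩
  obtain ⟨σ, τ, a, b, ha, hb, hza, hzb', hmin⟩ := hz.exists_ray
  obtain ⟨rfl, rfl⟩ := ray_inj (zero_le_one.trans hb1) hb (hzb.symm.trans hzb')
  -- otherwise the intersection with parameters `s₀`, `t₀ < 1 ≤ b` would precede `z`
  have has : a ≤ s₀ σ τ' := by
    by_contra! hlt
    exact hlt.ne (hmin _ _ (hs₀ σ τ') hlt.le (ht₀ σ τ') ((ht₁ σ τ').le.trans hb1) (he σ τ')).1
  refine mem_iUnion.2 ⟨σ, mem_iUnion.2 ⟨τ', b', ⟨⟨hb1, hbL⟩, a, ⟨ha.le, has⟩, ?_⟩, hzb.symm⟩⟩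
  rw [← hza, hzb]

/-- Every first intersection point has an iterate whose unstable parameter lies in a fundamental
domain, and these are finitely many. -/
theorem finite_coefficients : F.coefficients.Finite := by
  obtain ⟨m, hm0, hm⟩ := F.marked.exists_period
  have hs : 0 < F.stretch := F.marked.stretch_pos
  have hL : 1 < F.stretch ^ m := one_lt_pow₀ F.one_lt_stretch hm0.ne'
  refine ((finite_isFirstIntersection (F := F) (F.stretch ^ m)).image
    F.compatibilityCoefficient).subset ?_
  rintro _ ⟨z, hz, rfl⟩
  have hz' : F.IsFirstIntersection z := hz
  obtain ⟨σ, τ, a, b, ha, hb, -, hzb, -⟩ := hz'.exists_ray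
  have hper : ∀ N, step^[m * N] τ = τ := fun N => by
    rw [Function.iterate_mul]
    exact Function.iterate_fixed (hm _ τ) N
  -- a power of `fᵐ` moves the unstable parameter `b` into the fundamental domain `[1, λᵐ]`
  rcases le_or_gt 1 b with h1 | h1
  · obtain ⟨N, hN1, hN2⟩ := exists_nat_pow_near h1 hL
    obtain ⟨h2, h3⟩ := symm_iterate_isFirstIntersection hz' (m * N)
    have hp : 0 < (F.stretch ^ m) ^ N := pow_pos (pow_pos hs m) N
    refine ⟨_, ⟨h2, τ, b / (F.stretch ^ m) ^ N, (one_le_div₀ hp).2 hN1, ?_, ?_⟩, h3⟩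
    · rw [div_le_iff₀ hp, ← pow_succ']
      exact hN2.le
    · rw [hzb]
      have h4 := contr_iterate_ray τ hb.le (m * N)
      rw [hper, pow_mul] at h4
      exact h4
  · have hex : ∃ N : ℕ, 1 ≤ (F.stretch ^ m) ^ N * b := by
      obtain ⟨N, hN⟩ := pow_unbounded_of_one_lt b⁻¹ hL
      refine ⟨N, ?_⟩
      rw [inv_lt_iff_one_lt_mul₀ hb] at hN
      linarith [mul_comm b ((F.stretch ^ m) ^ N)]
    classical
    have hN1 := Nat.find_spec hex
    obtain ⟨N, hN⟩ : ∃ N, Nat.find hex = N + 1 := by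
      refine Nat.exists_eq_succ_of_ne_zero fun h0 => ?_
      rw [h0, pow_zero, one_mul] at hN1
      exact absurd hN1 (not_le.2 h1)
    have hN2 := not_le.1 (Nat.find_min hex (m := N) (by omega))
    rw [hN] at hN1
    obtain ⟨h2, h3⟩ := iterate_isFirstIntersection hz' (m * (N + 1))
    refine ⟨_, ⟨h2, τ, (F.stretch ^ m) ^ (N + 1) * b, hN1, ?_, ?_⟩, h3⟩
    · rw [pow_succ', mul_assoc]
      exact mul_le_of_le_one_right (pow_pos hs m).le hN2.le
    · rw [hzb]
      have h4 := contr_symm_iterate_ray τ hb.le (m * (N + 1))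
      rw [hper, pow_mul] at h4
      exact h4

theorem isGreatest_compatibilityOrder : IsGreatest F.coefficients F.compatibilityOrder := by
  obtain ⟨z, hz⟩ := exists_isFirstIntersection (F := F)
  have hbdd := (finite_coefficients (F := F)).bddAbove
  exact ⟨Nat.sSup_mem ⟨_, z, hz, rfl⟩ hbdd, fun n hn => le_csSup hbdd hn⟩

end PseudoAnosov

/-! ### Separatrices are determined by the dynamics -/

namespace Marked

variable {S : Type*} [TopologicalSpace S] {f : S ≃ₜ S} {M : Marked f} {k : LeafKind}

theorem norm_quad_le {R : ℝ} (hR : 0 < R) {p x : S} (hx : x ∈ M.disc R p) :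
    ‖M.quad p x‖ ≤ R ^ 2 := by
  have hn : (M.prong p : ℝ) ≠ 0 := Nat.cast_ne_zero.2 (M.prong_ne_zero p)
  calc ‖M.quad p x‖ = ‖M.chart p x‖ ^ M.prong p := norm_pow _ _
    _ ≤ (R ^ (2 / M.prong p : ℝ)) ^ M.prong p := pow_le_pow_left₀ (norm_nonneg _) hx.2.le _
    _ = R ^ 2 := by
      rw [← Real.rpow_natCast, ← Real.rpow_mul hR.le, div_mul_cancel₀ _ hn]
      norm_num

variable [T2Space S]

/-- The separatrices of kind `k` consist of the points that are attracted by the marked points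
under the contracting dynamics. In natural coordinates the distance to the separatrix is expanded,
so that an orbit that stays near the marked points lies on a separatrix. -/
theorem exists_eq_ray_iff {x : S} : (∃ (i : M.Prong k) (t : ℝ), 0 ≤ t ∧ x = ray i t) ↔
    Tendsto (fun n => (M.contr k)^[n] x) atTop (𝓝ˢ M.pts) := by
  constructor
  · rintro ⟨i, t, ht, rfl⟩
    rw [tendsto_def]
    intro U hU
    have h1 : ∀ i : M.Prong k, ∃ ε > 0, ∀ s, 0 ≤ s → s < ε → ray i s ∈ U := by
      intro i
      have hc := (continuousOn_ray i) 0 (mem_Ici.2 le_rfl)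
      have hU' : U ∈ 𝓝 (ray i 0) := by
        rw [ray_zero]
        exact mem_nhdsSet_iff_forall.1 hU _ i.base_mem
      obtain ⟨ε, hε, h⟩ := mem_nhdsGE_iff_exists_Ico_subset.1 (hc hU')
      exact ⟨ε, hε, fun s h0 hs => h ⟨h0, hs⟩⟩
    choose ε hε h using h1
    obtain ⟨i₀, hi₀⟩ := Finite.exists_min ε
    obtain ⟨N, hN⟩ := M.exists_div_pow_lt t (hε i₀)
    filter_upwards [eventually_ge_atTop N] with n hn
    rw [mem_preimage, contr_iterate_ray i ht]
    refine h _ _ (div_nonneg ht (pow_pos M.stretch_pos n).le) ?_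
    calc t / M.stretch ^ n ≤ t / M.stretch ^ N := div_le_div_of_nonneg_left ht
          (pow_pos M.stretch_pos N) (pow_le_pow_right₀ M.one_lt_stretch.le hn)
      _ < ε i₀ := hN
      _ ≤ _ := hi₀ _
  · intro h
    have hR := M.isRadius
    -- an orbit that is eventually in standard discs follows the orbit of one marked point
    have hV : {x | ∃ p ∈ M.pts, x ∈ M.disc M.radius p ∧
        M.contr k x ∈ M.disc M.radius (M.contr k p)} ∈ 𝓝ˢ M.pts := by
      refine mem_nhdsSet_iff_forall.2 fun p hp => ?_
      filter_upwards [M.disc_mem_nhds hR.pos p, (M.contr k).continuous.continuousAt.preimage_mem_nhds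
        (M.disc_mem_nhds hR.pos (M.contr k p))] with y h1 h2
      exact ⟨p, hp, h1, h2⟩
    obtain ⟨N, hN⟩ := eventually_atTop.1 (h hV)
    choose p hp h1 h2 using fun j : ℕ => hN (N + j) (Nat.le_add_right N j)
    simp only [← Function.iterate_succ_apply'] at h2
    have hstep : ∀ j, p (j + 1) = M.contr k (p j) := fun j =>
      hR.disjoint _ (hp _) _ (M.contr_mem_pts.2 (hp j)) _ (h1 (j + 1)) (h2 j)
    have hgt : ∀ j, k.hgt (M.quad (p j) ((M.contr k)^[N + j] x)) =
        (M.stretch ^ 2) ^ j * k.hgt (M.quad (p 0) ((M.contr k)^[N] x)) := by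
      intro j
      induction j with
      | zero => rw [pow_zero, one_mul, add_zero]
      | succ j ih =>
        rw [hstep, ← add_assoc, Function.iterate_succ_apply',
          (hR.hgt_contr _ (hp j) _ (h1 j) k).1, ih, pow_succ']
        ring
    -- the transverse coordinate is multiplied by `λ²` at each step, but it stays bounded
    have hzero : k.hgt (M.quad (p 0) ((M.contr k)^[N] x)) = 0 := by
      by_contra hne
      have hpos := lt_of_le_of_ne (k.hgt_nonneg _) (Ne.symm hne)
      have hs : 1 < M.stretch ^ 2 := one_lt_pow₀ M.one_lt_stretch two_ne_zero
      obtain ⟨j, hj⟩ := pow_unbounded_of_one_lt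
        (M.radius ^ 2 / k.hgt (M.quad (p 0) ((M.contr k)^[N] x))) hs
      rw [div_lt_iff₀ hpos, ← hgt] at hj
      exact absurd ((k.hgt_le_norm _).trans (norm_quad_le hR.pos (h1 j))) (not_le.2 hj)
    obtain ⟨i, -, t, h0, ht, he, -⟩ := exists_eq_loc (hp 0) (h1 0) hzero
    obtain ⟨i, rfl⟩ := (step_iterate_bijective N).2 i
    refine ⟨i, M.stretch ^ N * t, mul_nonneg (pow_pos M.stretch_pos N).le h0, ?_⟩
    rw [← contr_symm_iterate_ray i h0 N, ray_eq_loc _ h0 ht, ← he]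
    exact ((M.contr k).toEquiv.left_inv.iterate N x).symm

/-- The transverse coordinates, in a given chart, of the points of the separatrices of kind `k` are
countably many. -/
theorem countable_hgt_ray (k : LeafKind) (q : S) : {c : ℝ | ∃ (i : M.Prong k) (t : ℝ), 0 ≤ t ∧
    ray i t ∈ (M.chart q).source ∧ k.hgt (M.quad q (ray i t)) = c}.Countable := by
  refine Countable.mono ?_ (countable_iUnion fun i : M.Prong k =>
    ((countable_range fun r : ℚ => k.hgt (M.quad q (ray i r))).insert
      (k.hgt (M.quad q (ray i 0)))))
  rintro _ ⟨i, t, ht, hs, rfl⟩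
  refine mem_iUnion.2 ⟨i, ?_⟩
  rcases eq_or_lt_of_le ht with rfl | h0
  · exact Or.inl rfl
  · obtain ⟨-, hr, r, rfl⟩ := mem_closure_iff_nhds.1 (Rat.denseRange_cast (𝕜 := ℝ) t) _
      ((lineAt_ray i h0).hgt_eventually_eq hs)
    exact Or.inr ⟨r, hr⟩

/-- A path in the separatrices of kind `k` has constant transverse coordinate. -/
theorem hgt_eq_of_isPreconnected {I : Set ℝ} (hI : IsPreconnected I) {α : ℝ → S}
    (hα : ContinuousOn α I) {q : S} (hq : ∀ s ∈ I, α s ∈ (M.chart q).source)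
    (hray : ∀ s ∈ I, ∃ (i : M.Prong k) (t : ℝ), 0 ≤ t ∧ α s = ray i t) {s s' : ℝ} (hs : s ∈ I)
    (hs' : s' ∈ I) : k.hgt (M.quad q (α s)) = k.hgt (M.quad q (α s')) := by
  have hc : ContinuousOn (fun s => k.hgt (M.quad q (α s))) I := fun u hu =>
    k.continuous_hgt.continuousAt.comp_continuousWithinAt
      ((M.continuousAt_quad (hq u hu)).comp_continuousWithinAt (hα u hu))
  refine (countable_hgt_ray (M := M) k q).isTotallyDisconnected _ ?_ (hI.image _ hc) ⟨s, hs, rfl⟩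
    ⟨s', hs', rfl⟩
  rintro _ ⟨u, hu, rfl⟩
  obtain ⟨i, t, h0, he⟩ := hray u hu
  exact ⟨i, t, h0, he ▸ hq u hu, by rw [← he]⟩

end Marked

/-! ### Topological conjugacies preserve the foliations -/

section Conjugacy

open Marked

variable {S T : Type*} [TopologicalSpace S] [TopologicalSpace T] {f : S ≃ₜ S} {g : T ≃ₜ T}
  {M : Marked f} {N : Marked g} {h : S ≃ₜ T} {k : LeafKind}

theorem Marked.semiconj_contr (hc : ∀ x, h (f x) = g (h x)) (k : LeafKind) (x : S) :
    h (M.contr k x) = N.contr k (h x) := by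
  cases k
  · exact hc x
  · change h (f.symm x) = g.symm (h x)
    rw [g.eq_symm_apply, ← hc, f.apply_symm_apply]

theorem Marked.image_symm_pts (hp : h '' M.pts = N.pts) : h.symm '' N.pts = M.pts := by
  rw [← hp, h.coe_symm_image_coe_image]

theorem symm_semiconj (hc : ∀ x, h (f x) = g (h x)) (y : T) : h.symm (g y) = f (h.symm y) := by
  rw [h.symm_apply_eq, hc, h.apply_symm_apply]

variable [T2Space S] [T2Space T]

/-- A conjugacy maps separatrices into separatrices, because it respects the attraction by the marked
points. -/
theorem Marked.map_ray (hc : ∀ x, h (f x) = g (h x)) (hp : h '' M.pts = N.pts) (i : M.Prong k)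
    {t : ℝ} (ht : 0 ≤ t) : ∃ (j : N.Prong k) (u : ℝ), 0 ≤ u ∧ h (ray i t) = ray j u := by
  have h1 := exists_eq_ray_iff.1 ⟨i, t, ht, rfl⟩
  rw [exists_eq_ray_iff]
  have h2 : Tendsto h (𝓝ˢ M.pts) (𝓝ˢ N.pts) := by
    rw [← hp]
    exact h.continuous.tendsto_nhdsSet (mapsTo_image h _)
  convert h2.comp h1 using 2 with n
  exact (Function.Semiconj.iterate_right (semiconj_contr hc k) n _).symm

/-- At a marked point, the image of a prong is a path in the separatrices, so it stays at height `0`. -/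
theorem Marked.map_localLeaf_pts (hc : ∀ x, h (f x) = g (h x)) (hp : h '' M.pts = N.pts) {x : S}
    (hx : x ∈ M.pts) : ∀ᶠ y in 𝓝 x, y ∈ M.localLeaf k x → h y ∈ N.localLeaf k (h x) := by
  have hU : h ⁻¹' (N.chart (h x)).source ∈ 𝓝 x := h.continuous.continuousAt.preimage_mem_nhds
    ((N.chart (h x)).open_source.mem_nhds (N.mem_source _))
  have h1 : ∀ i : M.Prong k, ∃ ε > 0, i.base = x → ∀ s, 0 ≤ s → s < ε →
      h (ray i s) ∈ (N.chart (h x)).source := by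
    intro i
    by_cases hi : i.base = x
    · have hc := (continuousOn_ray i) 0 (mem_Ici.2 le_rfl)
      obtain ⟨ε, hε, h'⟩ := mem_nhdsGE_iff_exists_Ico_subset.1
        (hc (by rw [ray_zero, hi]; exact hU))
      exact ⟨ε, hε, fun _ s h0 hs => h' ⟨h0, hs⟩⟩
    · exact ⟨1, one_pos, fun h' => absurd h' hi⟩
  choose ε hε h1 using h1
  obtain ⟨i₀, hi₀⟩ := Finite.exists_min ε
  filter_upwards [eventually_localLeaf_pts hx k (hε i₀)] with y hy hyl
  obtain ⟨i, hi, t, h0, ht, rfl⟩ := hy hyl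
  have hsrc : ∀ s ∈ Icc 0 t, h (ray i s) ∈ (N.chart (h x)).source := fun s hs =>
    h1 i hi s hs.1 ((hs.2.trans_lt ht).trans_le (hi₀ i))
  refine N.mem_localLeaf_iff.2 ⟨hsrc t ⟨h0, le_rfl⟩, ?_⟩
  have h2 := hgt_eq_of_isPreconnected (M := N) (k := k) isPreconnected_Icc
    (h.continuous.comp_continuousOn ((continuousOn_ray i).mono Icc_subset_Ici_self)) hsrc
    (fun s hs => map_ray hc hp i hs.1) (s := t) (s' := 0) ⟨h0, le_rfl⟩ ⟨le_rfl, h0⟩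
  simp only [Function.comp_apply, ray_zero, hi] at h2
  rw [h2, N.quad_self]
  exact (k.hgt_eq_zero_iff 0).2 (by simp)

/-- Away from the marked points, the transverse coordinate of the image is constant on the plaques
of separatrices, which are dense. -/
theorem Marked.map_localLeaf [CompactSpace S] [ConnectedSpace S] (hc : ∀ x, h (f x) = g (h x))
    (hp : h '' M.pts = N.pts) (k : LeafKind) (x : S) :
    ∀ᶠ y in 𝓝 x, y ∈ M.localLeaf k x → h y ∈ N.localLeaf k (h x) := by
  by_cases hx : x ∈ M.pts
  · exact map_localLeaf_pts hc hp hx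
  have hU : h ⁻¹' (N.chart (h x)).source ∈ 𝓝 x := h.continuous.continuousAt.preimage_mem_nhds
    ((N.chart (h x)).open_source.mem_nhds (N.mem_source _))
  obtain ⟨r, hr, hbox'⟩ := exists_box hx hU
  have h0r : |(0 : ℝ)| < r := by rwa [abs_zero]
  have hbox : ∀ w : ℂ, |w.re| < r → |w.im| < r → w ∈ (M.chart x).target ∧
      (M.chart x).symm w ∉ M.pts := fun w h1 h2 => ⟨(hbox' w h1 h2).1, (hbox' w h1 h2).2.1⟩
  have hx2 := M.prong_eq_two hx
  have hnorm : Tendsto (fun y => ‖M.chart x y‖) (𝓝 x) (𝓝 0) := by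
    have := ((M.chart x).continuousAt (M.mem_source _)).norm.tendsto
    rwa [M.chart_self, norm_zero] at this
  obtain ⟨pt, hpt⟩ : ∃ pt : ℝ → ℝ → S, ∀ s v,
      pt s v = (M.chart x).symm (s * k.dir + v * k.other.dir) := ⟨_, fun _ _ => rfl⟩
  have hsrc : ∀ s v, |s| < r → |v| < r → h (pt s v) ∈ (N.chart (h x)).source := by
    intro s v hs hv
    obtain ⟨h1, h2⟩ := k.abs_re_im_lt hs hv
    rw [hpt]
    exact (hbox' _ h1 h2).2.2
  have hcont : ∀ s v, |s| < r → |v| < r → ContinuousAt (fun w : ℂ =>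
      k.hgt (N.quad (h x) (h ((M.chart x).symm w)))) (s * k.dir + v * k.other.dir) := by
    intro s v hs hv
    obtain ⟨h1, h2⟩ := k.abs_re_im_lt hs hv
    have h3 := hsrc s v hs hv
    rw [hpt] at h3
    have h4 := h.continuous.continuousAt.comp ((M.chart x).continuousAt_symm (hbox _ h1 h2).1)
    exact k.continuous_hgt.continuousAt.comp
      (ContinuousAt.comp (f := h ∘ (M.chart x).symm) (N.continuousAt_quad h3) h4)
  obtain ⟨i⟩ : Nonempty (M.Prong k) := inferInstance
  -- the heights of the plaques of a dense separatrix accumulate at `0`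
  have hfreq : ∃ᶠ v in 𝓝 (0 : ℝ), ∀ s, |s| < r → pt s v ∈ ray i '' Ioi 0 := by
    have hmem : x ∈ closure (ray i '' Ici 0) := by rw [closure_ray i]; trivial
    have h1 : ∃ᶠ y in 𝓝 x, ∀ s, |s| < r → pt s (k.cross (M.chart x y)) ∈ ray i '' Ioi 0 := by
      refine ((mem_closure_iff_frequently.1 hmem).and_eventually
        (((M.chart x).open_source.eventually_mem (M.mem_source _)).and
          (hnorm.eventually_lt_const hr))).mono ?_
      rintro y ⟨hy, hys, hyr⟩ s hs
      rw [hpt]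
      refine box_mem_ray hx2 hbox (s := k.other.cross (M.chart x y)) (k.other.abs_cross_lt hyr) hs
        (k.abs_cross_lt hyr) ?_
      rwa [← k.eq_cross_add, (M.chart x).left_inv hys]
    have h2 : Tendsto (fun y => k.cross (M.chart x y)) (𝓝 x) (𝓝 0) := by
      have h3 : Tendsto (fun y => k.cross (M.chart x y)) (𝓝 x) (𝓝 (k.cross (M.chart x x))) :=
        (k.continuous_cross.continuousAt.comp ((M.chart x).continuousAt (M.mem_source x))).tendsto
      rw [M.chart_self] at h3
      convert h3 using 2
      cases k <;> simp [LeafKind.cross]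
    exact h2.frequently h1
  have hconst : ∀ s, |s| < r →
      k.hgt (N.quad (h x) (h (pt s 0))) = k.hgt (N.quad (h x) (h (pt 0 0))) := by
    intro s hs
    by_contra hne
    have hlim : ∀ s, |s| < r → ContinuousAt (fun v : ℝ => k.hgt (N.quad (h x) (h (pt s v)))) 0 := by
      intro s hs
      have h1 := hcont s 0 hs h0r
      have h2 : ContinuousAt (fun v : ℝ => (s * k.dir + v * k.other.dir : ℂ)) 0 := by fun_prop
      have h3 := ContinuousAt.comp (f := fun v : ℝ => (s * k.dir + v * k.other.dir : ℂ)) h1 h2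
      simp only [hpt]
      exact h3
    have hr0 : ∀ᶠ v : ℝ in 𝓝 0, |v| < r :=
      continuous_abs.continuousAt.eventually_lt_const h0r
    obtain ⟨v, hv, hvne, hvr⟩ := (hfreq.and_eventually
      (((hlim s hs).ne_iff_eventually_ne (hlim 0 h0r)).1 hne |>.and hr0)).exists
    refine hvne (hgt_eq_of_isPreconnected (M := N) (k := k)
      (α := fun s => h (pt s v)) (I := Ioo (-r) r) isPreconnected_Ioo ?_ ?_ ?_
      (abs_lt.1 hs) (abs_lt.1 h0r))
    · refine h.continuous.comp_continuousOn fun u hu => ContinuousAt.continuousWithinAt ?_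
      obtain ⟨h1, h2⟩ := k.abs_re_im_lt (abs_lt.2 hu) hvr
      have h2 : ContinuousAt (fun s : ℝ => (s * k.dir + v * k.other.dir : ℂ)) u := by fun_prop
      simp only [hpt]
      exact ContinuousAt.comp (f := fun s : ℝ => (s * k.dir + v * k.other.dir : ℂ))
        ((M.chart x).continuousAt_symm (hbox _ h1 ‹_›).1) h2
    · exact fun u hu => hsrc u v (abs_lt.2 hu) hvr
    · intro u hu
      obtain ⟨t, ht, he⟩ := hv u (abs_lt.2 hu)
      obtain ⟨j, t', h1, h2⟩ := map_ray hc hp i (le_of_lt ht)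
      exact ⟨j, t', h1, by rw [← h2, he]⟩
  filter_upwards [(M.chart x).open_source.mem_nhds (M.mem_source x),
    hnorm.eventually_lt_const hr] with y hy hyr hyl
  have hcr : k.cross (M.chart x y) = 0 := by
    have := (M.mem_localLeaf_iff.1 hyl).2
    rw [TransverseMeasuredFoliations.quad, hx2, LeafKind.hgt_sq] at this
    exact pow_eq_zero_iff two_ne_zero |>.1 this
  obtain ⟨s, hs⟩ : ∃ s, s = k.other.cross (M.chart x y) := ⟨_, rfl⟩
  have hsr : |s| < r := hs ▸ k.other.abs_cross_lt hyr
  have hys : y = pt s 0 := by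
    rw [hpt, hs, ← hcr, ← k.eq_cross_add, (M.chart x).left_inv hy]
  refine N.mem_localLeaf_iff.2 ⟨hys ▸ hsrc s 0 hsr h0r, ?_⟩
  have h00 : pt 0 0 = x := by
    rw [hpt]
    simp [M.chart_symm_zero]
  rw [hys, hconst s hsr, h00, N.quad_self]
  exact (k.hgt_eq_zero_iff 0).2 (by simp)

theorem Marked.preservesLeaves [CompactSpace S] [ConnectedSpace S] [CompactSpace T]
    [ConnectedSpace T] (hc : ∀ x, h (f x) = g (h x)) (hp : h '' M.pts = N.pts) :
    PreservesLeaves M.toTransverseMeasuredFoliations N.toTransverseMeasuredFoliations h := by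
  refine preservesLeaves_of_localLeaf fun k x => ?_
  have h1 := h.continuous.continuousAt.eventually
    (map_localLeaf (symm_semiconj hc) (image_symm_pts hp) k (h x))
  filter_upwards [map_localLeaf hc hp k x, h1] with y h2 h3
  rw [h.symm_apply_apply, h.symm_apply_apply] at h3
  exact ⟨h2, h3⟩

/-! ### Conjugacies preserve the number of prongs -/

theorem ncard_pow_eq_one {n : ℕ} (hn : n ≠ 0) : {ζ : ℂ | ζ ^ n = 1}.ncard = n := by
  have h1 : {ζ : ℂ | ζ ^ n = 1} = ↑(Polynomial.nthRootsFinset n (1 : ℂ)) := by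
    ext ζ
    rw [Finset.mem_coe, Polynomial.mem_nthRootsFinset (Nat.pos_of_ne_zero hn)]
    rfl
  rw [h1, Set.ncard_coe_finset, (Complex.isPrimitiveRoot_exp n hn).card_nthRootsFinset]

/-- The stable prongs at a marked point are counted by separatrices, which are mapped
injectively to separatrices. -/
theorem Marked.prong_le (H : PreservesLeaves M.toTransverseMeasuredFoliations
    N.toTransverseMeasuredFoliations h) (hp : h '' M.pts = N.pts) {p : S} (hpM : p ∈ M.pts) :
    M.prong p ≤ N.prong (h p) := by
  have hpN : h p ∈ N.pts := hp ▸ mem_image_of_mem h hpM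
  have h1 : ∀ ζ : ℂ, ζ ^ M.prong p = 1 → ∃ i : M.Prong .stable, i.base = p ∧ i.angle = ζ :=
    fun ζ hζ => ⟨⟨(p, ζ), hpM, by simpa [LeafKind.sgn] using hζ⟩, rfl, rfl⟩
  have h2 : ∀ i : M.Prong .stable, i.base = p → ∃ j : N.Prong .stable, j.base = h p ∧
      ∃ t, 0 < t ∧ h '' (ray i '' Icc 0 1) = ray j '' Icc 0 t := by
    intro i hi
    have h3 := (H.isLeafArc_iff _ _ _ _).1 (isLeafArc_ray i one_pos)
    rw [hi] at h3
    obtain ⟨j, hj, t, ht, -, h4⟩ := exists_eq_image_ray_Icc h3 hpN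
    exact ⟨j, hj, t, ht, h4⟩
  have h3 : ∀ ζ : ℂ, ∃ ξ : ℂ, ζ ^ M.prong p = 1 → ∃ i : M.Prong .stable, i.angle = ζ ∧
      i.base = p ∧ ∃ j : N.Prong .stable, j.base = h p ∧ j.angle = ξ ∧
        ∃ t, 0 < t ∧ h '' (ray i '' Icc 0 1) = ray j '' Icc 0 t := by
    intro ζ
    by_cases hζ : ζ ^ M.prong p = 1
    · obtain ⟨i, hi, hiζ⟩ := h1 ζ hζ
      obtain ⟨j, hj, t, ht, he⟩ := h2 i hi
      exact ⟨j.angle, fun _ => ⟨i, hiζ, hi, j, hj, rfl, t, ht, he⟩⟩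
    · exact ⟨0, fun h' => absurd h' hζ⟩
  choose φ hφ using h3
  rw [← ncard_pow_eq_one (M.prong_ne_zero p), ← ncard_pow_eq_one (N.prong_ne_zero (h p))]
  refine Set.ncard_le_ncard_of_injOn φ (fun ζ hζ => ?_) (fun ζ hζ ζ' hζ' he => ?_)
    (finite_pow_eq (N.prong_ne_zero _) 1)
  · obtain ⟨-, -, -, j, hj, hjφ, -⟩ := hφ ζ hζ
    have := j.angle_pow
    rw [hj, hjφ] at this
    simpa [LeafKind.sgn] using this
  · obtain ⟨i, hi, hib, j, hj, hjφ, t, ht, hit⟩ := hφ ζ hζ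
    obtain ⟨i', hi', hib', j', hj', hjφ', t', ht', hit'⟩ := hφ ζ' hζ'
    obtain rfl : j = j' := Prong.ext (hj.trans hj'.symm) (by rw [hjφ, hjφ', he])
    -- of two images on the same separatrix, one contains the other, so that the two original
    -- separatrices have a point in common
    have key : ∀ (i i' : M.Prong .stable) t t', t ≤ t' →
        h '' (ray i '' Icc 0 1) = ray j '' Icc 0 t →
        h '' (ray i' '' Icc 0 1) = ray j '' Icc 0 t' → i' = i := by
      intro i i' t t' htt h4 h5
      have h6 : h '' (ray i '' Icc 0 1) ⊆ h '' (ray i' '' Icc 0 1) := by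
        rw [h4, h5]
        exact image_mono (Icc_subset_Icc_right htt)
      obtain ⟨s, hs, hse⟩ := (image_subset_image_iff h.injective).1 h6
        ⟨1, ⟨zero_le_one, le_rfl⟩, rfl⟩
      exact (ray_inj hs.1 one_pos hse).1
    have hii : i' = i := by
      rcases le_total t t' with htt | htt
      · exact key i i' t t' htt hit hit'
      · exact (key i' i t' t htt hit' hit).symm
    rw [← hi, ← hi', hii]

end Conjugacy

/-- A topological conjugacy respects foliations, and `Sing` unless there are no prong
singularities. -/
theorem PseudoAnosov.isConjugacy {S T : Type*}
    [TopologicalSpace S] [T2Space S] [CompactSpace S] [ConnectedSpace S]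
    [TopologicalSpace T] [T2Space T] [CompactSpace T] [ConnectedSpace T]
    {f : S ≃ₜ S} {g : T ≃ₜ T} (F : PseudoAnosov f) (G : PseudoAnosov g) (h : S ≃ₜ T)
    (hc : ∀ x, h (f x) = g (h x)) (hs : (∀ x, F.prong x = 2) → h '' F.sing = G.sing) :
    IsConjugacy F G h := by
  have hpre : ∀ x, x ∈ h ⁻¹' G.sing ↔ f x ∈ h ⁻¹' G.sing := by
    intro x
    rw [mem_preimage, mem_preimage, hc, ← g.injective.mem_set_image (s := G.sing),
      G.sing_invariant]
  have hinvS : f '' (F.sing ∪ h ⁻¹' G.sing) = F.sing ∪ h ⁻¹' G.sing := by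
    rw [image_union, F.sing_invariant]
    congr 1
    ext x
    obtain ⟨x, rfl⟩ := f.surjective x
    rw [f.injective.mem_set_image, hpre]
  have hinvT : g '' (h '' (F.sing ∪ h ⁻¹' G.sing)) = h '' (F.sing ∪ h ⁻¹' G.sing) := by
    conv_rhs => rw [← hinvS]
    simp only [image_image, hc]
  have hfin : (F.sing ∪ h ⁻¹' G.sing).Finite :=
    F.sing_finite.union (G.sing_finite.preimage h.injective.injOn)
  -- both homeomorphisms with corresponding sets of marked points
  let M := F.mark _ hfin hinvS subset_union_left
  let N := G.mark _ (hfin.image h) hinvT fun y hy => ⟨h.symm y, Or.inr (by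
    rwa [mem_preimage, h.apply_symm_apply]), h.apply_symm_apply y⟩
  have H : PreservesLeaves M.toTransverseMeasuredFoliations N.toTransverseMeasuredFoliations h :=
    Marked.preservesLeaves hc rfl
  have hprong : ∀ p, G.prong (h p) = F.prong p := by
    intro p
    by_cases hp : p ∈ M.pts
    · have h1 : M.prong p ≤ N.prong (h p) := Marked.prong_le H rfl hp
      have h2 : N.prong (h p) ≤ M.prong (h.symm (h p)) :=
        Marked.prong_le H.symm (Marked.image_symm_pts rfl) (mem_image_of_mem h hp)
      rw [h.symm_apply_apply] at h2
      exact le_antisymm h2 h1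
    · have h1 : M.prong p = 2 := M.prong_eq_two hp
      have h2 : N.prong (h p) = 2 := N.prong_eq_two fun h' =>
        hp ((h.injective.mem_set_image (s := M.pts)).1 h')
      exact h2.trans h1.symm
  refine ⟨H, hc, ?_⟩
  by_cases hF : ∀ x, F.prong x = 2
  · exact hs hF
  · push Not at hF
    obtain ⟨p, hp⟩ := hF
    rw [F.sing_eq ⟨p, hp⟩, G.sing_eq ⟨h p, by rwa [hprong]⟩]
    ext y
    obtain ⟨x, rfl⟩ := h.surjective y
    rw [h.injective.mem_set_image, mem_ofPred_eq, mem_ofPred_eq, hprong]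

theorem mainTheorem9 {S T : Type*}
    [TopologicalSpace S] [T2Space S] [CompactSpace S] [ConnectedSpace S]
    [TopologicalSpace T] [T2Space T] [CompactSpace T] [ConnectedSpace T] :
    -- existence: every `n(z)` is a genuine minimum and `n(f)` is a genuine maximum
    (∀ (f : S ≃ₜ S) (F : PseudoAnosov f),
      (∀ z, F.IsFirstIntersection z →
        IsLeast (F.compatibleOrders z) (F.compatibilityCoefficient z)) ∧
      IsGreatest F.coefficients F.compatibilityOrder) ∧
    -- invariance under topological conjugacy
    (∀ (f : S ≃ₜ S) (g : T ≃ₜ T) (F : PseudoAnosov f) (G : PseudoAnosov g) (h : S ≃ₜ T),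
      (∀ x, h (f x) = g (h x)) →
      -- without prong singularities, `h` has to respect the chosen families of periodic points
      ((∀ x, F.prong x = 2) → h '' F.sing = G.sing) →
      F.compatibilityOrder = G.compatibilityOrder) := by
  refine ⟨fun f F => ⟨fun z hz => PseudoAnosov.isLeast_compatibilityCoefficient hz,
    PseudoAnosov.isGreatest_compatibilityOrder⟩, fun f g F G h hc hs =>
    (F.isConjugacy G h hc hs).compatibilityOrder_eq⟩
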